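/- Let $g(x)=-\frac1{2\pi}\ln|x|$ on $\mathbb R^2$ and let $\Delta$ be the diagonal of $(\mathbb R^2)^2$. A *density* is a real-valued function in $L^1\cap L^\infty(\mathbb R^2)$ with compact support. For $M\ge 0$ let $B(M)\ge 0$ be the least non-negative number such that $$\int_{(\mathbb R^2)^2\setminus\Delta} g(x-y)\Big(\mu-\frac1N\sum_{i=1}^N\delta_{x_i}\Big)^{\otimes 2}(dx\,dy)+\frac{B(M)}{N}+\frac{\ln N}{2N}\ \ge 0$$ for all $N\ge1$, all pairwise distinct $x_1,\dots,x_N\in\mathbb R^2$ and all densities $\mu$ with $\int\mu=1$ and $\|\mu\|_{L^\infty}=M$. For densities $\omega,\rho,\omega_N$, a field $v\in W^{2,\infty}(\mathbb R^2,\mathbb R^2)$ (identified with its continuous representative), $Q_N=(q_1,\dots,q_N)$ with pairwise distinct $q_i\in\mathbb R^2$, and $P_N=(p_1,\dots,p_N)\in(\mathbb R^2)^N$, put $\rho_N=\frac1N\sum_{i=1}^N\delta_{q_i}$ and $$\mathcal H_N=\mathcal H(\omega,\rho,v,\omega_N,Q_N,P_N)=\frac1N\sum_{i=1}^N|v(q_i)-p_i|^2+\int_{(\mathbb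 R^2)^2\setminus\Delta} g(x-y)(\rho+\omega-\rho_N-\omega_N)^{\otimes2}(dx\,dy)+\|\omega-\omega_N\|_{L^2}^2+\frac{B(\|\rho+\omega-\omega_N\|_{L^\infty})}{N}+\frac{\ln N}{2N}.$$ For a finite signed measure $\sigma$ on $\mathbb R^d$ and $s\in\mathbb R$, $\|\sigma\|_{H^s}=\big(\int(1+|\zeta|^2)^s|\widehat\sigma(\zeta)|^2d\zeta\big)^{1/2}$, where $\widehat\sigma(\zeta)=\int e^{-i x\cdot\zeta}\sigma(dx)$. The measure $\rho\otimes\delta_{\xi=v(x)}$ on $\mathbb R^2\times\mathbb R^2$ is the image of $\rho(x)\,dx$ under $x\mapsto(x,v(x))$, and $\|\nabla v\|_{W^{1,\infty}}=\|\nabla v\|_{L^\infty}+\|\nabla^2v\|_{L^\infty}$. **Proposition.** There is $\beta>0$ such that for every $M$ there is $C>0$ with the following property. For all $N\ge1$, all densities $\omega,\rho,\omega_N$ with $\int(\rho+\omega-\omega_N)=1$, $\|\omega\|_{L^\infty}\le M$ and $\|\omega_N\|_{L^\infty}\le M$, all $v\in W^{2,\infty}(\mathbb R^2,\mathbb R^2)$,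 all $Q_N\in(\mathbb R^2)^N$ with pairwise distinct entries and all $P_N\in(\mathbb R^2)^N$, $$\Big\|\frac1N\sum_{i=1}^N\delta_{(q_i,p_i)}-\rho\otimes\delta_{\xi=v(x)}\Big\|_{H^{-5}}\le C\big(1+\|\nabla v\|_{W^{1,\infty}}^2\big)\Big(\mathcal H_N+(1+\|\rho\|_{L^\infty})N^{-\beta}\Big)^{1/2}.$$ Moreover, fix densities $\omega,\rho$ and $v\in W^{2,\infty}(\mathbb R^2,\mathbb R^2)$, and for each $N\ge 1$ let $\omega_N$ be a density with $\int(\rho+\omega-\omega_N)=1$, let $Q_N\in(\mathbb R^2)^N$ have pairwise distinct entries and let $P_N\in(\mathbb R^2)^N$ (the entries of $Q_N$, $P_N$ may depend on $N$). If $\sup_{N\ge1}\|\omega_N\|_{L^\infty}<\infty$ and $\mathcal H(\omega,\rho,v,\omega_N,Q_N,P_N)\to0$ as $N\to\infty$, then $\omega_N\to\omega$ in $L^2$, $\rho_N\to\rho$ in $H^a$ for every $a<-1$, and $\frac1N\sum_{i=1}^N\delta_{(q_i,p_i)}\to\rho\otimes\delta_{\xi=v(x)}$ in $H^{-5}$.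 -/

import Mathlib

open MeasureTheory Filter Topology
open scoped ENNReal

noncomputable section

namespace Spray

/-- The Euclidean plane `ℝ²`. -/
abbrev Plane := EuclideanSpace ℝ (Fin 2)

/-- The phase space `ℝ² × ℝ²` of pairs (position, velocity), with the Euclidean structure of `ℝ⁴`. -/
abbrev Phase := WithLp 2 (Plane × Plane)

/-! ### Measures, Coulomb energy and Sobolev norms -/

/-- The kernel `g(x) = -(1 / 2π) ln |x|` on the plane. -/
def coulomb (x : Plane) : ℝ := -(1 / (2 * Real.pi)) * Real.log ‖x‖

/-- The empirical measure `(1 / N) ∑ᵢ δ_{xᵢ}`, as a signed measure. -/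
def empirical {E : Type*} [MeasurableSpace E] {N : ℕ} (x : Fin N → E) : SignedMeasure E :=
  (1 / (N : ℝ)) • ∑ i, VectorMeasure.dirac (x i) (1 : ℝ)

/-- The signed measure `f(x) dx` on the plane, for an integrable function `f`. -/
def density (f : Plane → ℝ) : SignedMeasure Plane := volume.withDensityᵥ f

/-- The monokinetic measure `ρ ⊗ δ_{ξ = v(x)}` on the phase space: the image of `ρ(x) dx` under
`x ↦ (x, v(x))`. -/
def monokinetic (ρ : Plane → ℝ) (v : Plane → Plane) : SignedMeasure Phase :=
  (density ρ).map (fun x => WithLp.toLp 2 (x, v x))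

/-- `∬_{(ℝ² × ℝ²) ∖ Δ} g(x - y) σ(dx) σ(dy)`, where `Δ` is the diagonal. -/
def offDiagEnergy (σ : SignedMeasure Plane) : ℝ :=
  ∫ᵛ z in (Set.diagonal Plane)ᶜ, coulomb (z.1 - z.2)
    ∂<•(σ.prod σ (ContinuousLinearMap.mul ℝ ℝ))

/-- The Fourier transform `ζ ↦ ∫ exp(-i ⟨x, ζ⟩) σ(dx)` of a signed measure. -/
def fourierMeasure {E : Type*} [NormedAddCommGroup E] [InnerProductSpace ℝ E] [MeasurableSpace E]
    (σ : SignedMeasure E) (ζ : E) : ℂ :=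
  ∫ᵛ x, Complex.exp (-((inner ℝ x ζ : ℝ) : ℂ) * Complex.I) ∂<•σ

/-- The norm `‖σ‖_{H^s} = (∫ (1 + |ζ|²)^s |σ̂(ζ)|² dζ)^{1/2}` (possibly infinite) of a signed
measure. -/
def sobolevNorm {E : Type*} [NormedAddCommGroup E] [InnerProductSpace ℝ E] [FiniteDimensional ℝ E]
    [MeasurableSpace E] [BorelSpace E] (s : ℝ) (σ : SignedMeasure E) : ℝ≥0∞ :=
  (∫⁻ ζ : E, ENNReal.ofReal ((1 + ‖ζ‖ ^ 2) ^ s) * ‖fourierMeasure σ ζ‖ₑ ^ 2) ^ (1 / 2 : ℝ)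

/-! ### Function spaces -/

/-- The `L^∞` norm (essential supremum), as a real number; meaningful for `MemLp f ∞`. -/
def normLinf {F : Type*} [NormedAddCommGroup F] (f : Plane → F) : ℝ :=
  (eLpNorm f ∞ volume).toReal

/-- `f ∈ L¹ ∩ L^∞` with compact support. -/
structure IsDensity (f : Plane → ℝ) : Prop where
  memLp_one : MemLp f 1 volume
  memLp_top : MemLp f ∞ volume
  compact : HasCompactSupport f

/-- `u'` is the weak (distributional) derivative of `u` on the plane. -/
def HasWeakFDeriv {F : Type*} [NormedAddCommGroup F] [NormedSpace ℝ F]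
    (u : Plane → F) (u' : Plane → Plane →L[ℝ] F) : Prop :=
  LocallyIntegrable u volume ∧ LocallyIntegrable u' volume ∧
    ∀ φ : Plane → ℝ, ContDiff ℝ (⊤ : ℕ∞) φ → HasCompactSupport φ → ∀ e : Plane,
      ∫ x, (fderiv ℝ φ x e) • u x = -∫ x, φ x • u' x e

/-- `v ∈ W^{2,∞}(ℝ², ℝ²)`, with first and second weak derivatives `Dv` and `D2v`. The field `v` is
its continuous representative, since it is evaluated at points. -/
structure IsW2Inf (v : Plane → Plane) (Dv : Plane → Plane →L[ℝ] Plane)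
    (D2v : Plane → Plane →L[ℝ] Plane →L[ℝ] Plane) : Prop where
  cont : Continuous v
  memLp : MemLp v ∞ volume
  memLp_deriv : MemLp Dv ∞ volume
  memLp_deriv2 : MemLp D2v ∞ volume
  weak_deriv : HasWeakFDeriv v Dv
  weak_deriv2 : HasWeakFDeriv Dv D2v

/-- `‖∇v‖_{W^{1,∞}}`, in terms of the first and second weak derivatives of `v`. -/
def gradNorm (Dv : Plane → Plane →L[ℝ] Plane)
    (D2v : Plane → Plane →L[ℝ] Plane →L[ℝ] Plane) : ℝ :=
  normLinf Dv + normLinf D2v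

/-! ### The modulated energies -/

/-- The numbers `b ≥ 0` such that
`∬_{Δᶜ} g(x - y) (μ - μ_N)^{⊗2}(dx dy) + b / N + ln N / (2N) ≥ 0`
for all `N ≥ 1`, all empirical measures `μ_N` of `N` distinct points and all `μ ∈ L¹ ∩ L^∞` with
compact support, integral `1` and `‖μ‖_{L^∞} = M`. -/
def correctionSet (M : ℝ) : Set ℝ :=
  {b | 0 ≤ b ∧ ∀ (N : ℕ) (X : Fin N → Plane) (μ : Plane → ℝ), 1 ≤ N → Function.Injective X →
    IsDensity μ → ∫ x, μ x = 1 → normLinf μ = M →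
      0 ≤ offDiagEnergy (density μ - empirical X) + b / N + Real.log N / (2 * N)}

/-- The least admissible correction constant; it depends only on the value `M` of the `L^∞` norm. -/
def correction (M : ℝ) : ℝ := sInf (correctionSet M)

/-- The modulated energy `𝓗(ω, ρ, v, ω_N, Q_N, P_N)`. -/
def modulatedEnergy (ω ρ : Plane → ℝ) (v : Plane → Plane) (ωN : Plane → ℝ) {N : ℕ}
    (Q P : Fin N → Plane) : ℝ :=
  1 / (N : ℝ) * ∑ i, ‖v (Q i) - P i‖ ^ 2
    + offDiagEnergy (density (fun x => ρ x + ω x - ωN x) - empirical Q)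
    + (eLpNorm (fun x => ω x - ωN x) 2 volume).toReal ^ 2
    + correction (normLinf (fun x => ρ x + ω x - ωN x)) / N
    + Real.log N / (2 * N)

end Spray

end

open MeasureTheory Filter Topology
open scoped ENNReal NNReal

/-!
All quantities are compared in Fourier variables. Write `u = ω - ω_N` and `f = ρ + u`, and let `f̃`
be `f` minus the empirical measure of `Q` smeared by Gaussians at the scale `N^(-1/2)`. The Coulomb
kernel is a superposition of Gaussians up to a constant, and `f̃` has mean zero, so that cutting the
superposition at `t = N` bounds the off-diagonal energy of `f - ρ_N` below by
`∫ |ζ|⁻² |f̃^(ζ)|² dζ`, up to `ln N / 2N` and `O((1 + ‖f‖_∞) / N)`. This makes the correction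
constant finite, and shows that the modulated energy controls the kinetic term, `‖u‖_{L²}` and
`‖f̃‖_{Ḣ⁻¹}`.

The difference of the two phase space measures is split into an average of the differences between
`δ_{(q, p)}` and the lift of the smeared charge at `q` to the graph of `v`, the lift of `f̃` and the
lift of `u`. The first is controlled by the kinetic term and the scale `N^(-1/2)`, because the
characters and `v` are Lipschitz. The Fourier transform of the lift of `h` at `(ξ, η)` is that of
`exp (-i ⟨v, η⟩) h` at `ξ`; multiplication by this function, whose Lipschitz constant grows linearly
in `η`, maps `Ḣ⁻¹` to `H⁻²`, and the weight `(1 + |ξ|² + |η|²)⁻⁵` absorbs the growth in `η`.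
-/

noncomputable section

namespace Spray

/-! ### The Fourier transform on `L¹ ∩ L²` -/

section Chr

variable {E : Type*} [NormedAddCommGroup E] [InnerProductSpace ℝ E]

/-- The character `x ↦ exp (-i ⟨x, ζ⟩)`, which is the integrand of `fourierMeasure`. -/
def chr (x ζ : E) : ℂ := Complex.exp (-((inner ℝ x ζ : ℝ) : ℂ) * Complex.I)

@[simp] lemma norm_chr (x ζ : E) : ‖chr x ζ‖ = 1 := by
  rw [chr, ← Complex.ofReal_neg, Complex.norm_exp_ofReal_mul_I]

lemma chr_add_left (x y ζ : E) : chr (x + y) ζ = chr x ζ * chr y ζ := by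
  simp only [chr, ← Complex.exp_add, inner_add_left]
  congr 1; push_cast; ring

lemma conj_chr (x ζ : E) : (starRingEnd ℂ) (chr x ζ) = chr (-x) ζ := by
  simp only [chr, ← Complex.exp_conj, inner_neg_left]
  congr 1; simp

lemma chr_comm (x ζ : E) : chr x ζ = chr ζ x := by
  simp only [chr, real_inner_comm]

lemma chr_neg_right (x ζ : E) : chr x (-ζ) = chr (-x) ζ := by
  simp only [chr, inner_neg_left, inner_neg_right]

lemma continuous_chr : Continuous (fun p : E × E => chr p.1 p.2) := by
  unfold chr; fun_prop

@[fun_prop] lemma continuous_chr_comp {X : Type*} [TopologicalSpace X] {a b : X → E}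
    (ha : Continuous a) (hb : Continuous b) : Continuous (fun x => chr (a x) (b x)) :=
  continuous_chr.comp (ha.prodMk hb)

lemma norm_chr_sub_one_le (x ζ : E) : ‖chr x ζ - 1‖ ≤ ‖x‖ * ‖ζ‖ := by
  have h := Real.norm_exp_I_mul_ofReal_sub_one_le (x := -inner ℝ x ζ)
  rw [chr, mul_comm, ← Complex.ofReal_neg]
  exact h.trans ((norm_neg _).trans_le (norm_inner_le_norm x ζ))

lemma norm_chr_sub_le (x y ζ : E) : ‖chr x ζ - chr y ζ‖ ≤ ‖x - y‖ * ‖ζ‖ := by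
  have h : chr x ζ - chr y ζ = chr y ζ * (chr (x - y) ζ - 1) := by
    rw [mul_sub_one, ← chr_add_left, add_sub_cancel]
  rw [h, norm_mul, norm_chr, one_mul]
  exact norm_chr_sub_one_le _ _

lemma hasDerivAt_chr_smul (e ζ : E) :
    HasDerivAt (fun t : ℝ => chr (-(t • e)) ζ) ((inner ℝ e ζ : ℝ) * Complex.I) 0 := by
  have h : HasDerivAt (fun t : ℝ => ((t * inner ℝ e ζ : ℝ) : ℂ) * Complex.I)
      ((inner ℝ e ζ : ℝ) * Complex.I) 0 := by
    simpa using ((hasDerivAt_id (0 : ℝ)).mul_const (inner ℝ e ζ)).ofReal_comp.mul_const Complex.I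
  simpa [chr, inner_neg_left, inner_smul_left] using h.cexp

end Chr

section Fourier

open FourierTransform

variable {E : Type*} [NormedAddCommGroup E] [InnerProductSpace ℝ E] [FiniteDimensional ℝ E]
  [MeasurableSpace E] [BorelSpace E]

/-- The Fourier transform `ζ ↦ ∫ exp (-i ⟨x, ζ⟩) f(x) dx`, normalized as `fourierMeasure`. -/
def ft (f : E → ℂ) (ζ : E) : ℂ := ∫ x, chr x ζ * f x

lemma ft_eq_fourier (f : E → ℂ) (ζ : E) : ft f ζ = 𝓕 f ((2 * Real.pi)⁻¹ • ζ) := by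
  rw [Real.fourier_eq', ft]
  congr 1; ext x
  have h : -2 * Real.pi * ((2 * Real.pi)⁻¹ * inner ℝ x ζ) = -inner ℝ x ζ := by field_simp
  rw [chr, smul_eq_mul, inner_smul_right, h, Complex.ofReal_neg]

lemma integrable_chr_mul {f : E → ℂ} (hf : Integrable f) (ζ : E) :
    Integrable (fun x => chr x ζ * f x) :=
  hf.bdd_mul (c := 1) (by fun_prop) (by simp)

lemma continuous_ft {f : E → ℂ} (hf : Integrable f) : Continuous (ft f) :=
  continuous_of_dominated (bound := fun x => ‖f x‖)
    (fun ζ => (integrable_chr_mul hf ζ).aestronglyMeasurable)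
    (fun ζ => Eventually.of_forall fun x => by simp) hf.norm
    (Eventually.of_forall fun x => by fun_prop)

lemma norm_ft_le (f : E → ℂ) (ζ : E) : ‖ft f ζ‖ ≤ ∫ x, ‖f x‖ :=
  (norm_integral_le_integral_norm _).trans_eq (by simp)

lemma ft_comp_add_right (f : E → ℂ) (h ζ : E) :
    ft (fun x => f (x + h)) ζ = chr (-h) ζ * ft f ζ := by
  unfold ft
  rw [← integral_const_mul, ← integral_add_right_eq_self (fun x => chr (-h) ζ * (chr x ζ * f x)) h]
  congr 1; ext x
  rw [← mul_assoc, ← chr_add_left, neg_add_cancel_comm_assoc]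

lemma ft_sub {f g : E → ℂ} (hf : Integrable f) (hg : Integrable g) (ζ : E) :
    ft (fun x => f x - g x) ζ = ft f ζ - ft g ζ := by
  unfold ft
  rw [← integral_sub (integrable_chr_mul hf ζ) (integrable_chr_mul hg ζ)]
  simp only [mul_sub]

open SchwartzMap in
lemma fourier_toLp_ae_eq {f : E → ℂ} (h1 : Integrable f) (h2 : MemLp f 2 volume) :
    (𝓕 (h2.toLp f) : Lp ℂ 2 (volume : Measure E)) =ᵐ[volume] 𝓕 f := by
  have hc : Continuous (𝓕 f) :=
    VectorFourier.fourierIntegral_continuous Real.continuous_fourierChar continuous_inner h1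
  -- Both sides are the Fourier transform of `f` as a tempered distribution.
  refine ae_eq_of_integral_contDiff_smul_eq ((Lp.memLp _).locallyIntegrable (by norm_num))
    hc.locallyIntegrable fun g hg hg' => ?_
  have hgc : HasCompactSupport (fun x => (g x : ℂ)) := hg'.comp_left (g := ((↑) : ℝ → ℂ)) (by simp)
  let G : 𝓢(E, ℂ) := hgc.toSchwartzMap (Complex.ofRealCLM.contDiff.comp hg)
  have hLp := DFunLike.congr_fun (Lp.fourier_toTemperedDistribution_eq (h2.toLp f)) G
  rw [TemperedDistribution.fourier_apply, Lp.toTemperedDistribution_apply,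
    Lp.toTemperedDistribution_apply] at hLp
  have hflip : ∫ x, 𝓕 (G : E → ℂ) x • f x = ∫ x, G x • 𝓕 f x := by
    have h := VectorFourier.integral_fourierIntegral_smul_eq_flip (L := innerₗ E) (μ := volume)
      (ν := volume) Real.continuous_fourierChar continuous_inner G.integrable h1
    rwa [flip_innerₗ] at h
  calc ∫ x, g x • (𝓕 (h2.toLp f) : Lp ℂ 2 (volume : Measure E)) x
      = ∫ x, G x • (𝓕 (h2.toLp f) : Lp ℂ 2 (volume : Measure E)) x := rfl
    _ = ∫ x, 𝓕 (G : E → ℂ) x • f x := by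
        refine hLp.symm.trans (integral_congr_ae ?_)
        filter_upwards [h2.coeFn_toLp] with x hx
        rw [hx]; rfl
    _ = ∫ x, g x • 𝓕 f x := hflip

lemma lintegral_comp_inv_smul {g : E → ℝ≥0∞} (hg : Measurable g) {c : ℝ} (hc : 0 < c) :
    ∫⁻ x, g (c⁻¹ • x) = ENNReal.ofReal (c ^ Module.finrank ℝ E) * ∫⁻ x, g x := by
  rw [← lintegral_map hg (measurable_const_smul _), Measure.map_addHaar_smul _ (inv_ne_zero hc.ne'),
    lintegral_smul_measure, smul_eq_mul]
  congr 2
  rw [inv_pow, inv_inv, abs_of_pos (by positivity)]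

/-- The constant `(2π)^d` of Plancherel's theorem in the present normalization. -/
def plancherelConst (E : Type*) [NormedAddCommGroup E] [InnerProductSpace ℝ E] : ℝ≥0∞ :=
  ENNReal.ofReal ((2 * Real.pi) ^ Module.finrank ℝ E)

omit [FiniteDimensional ℝ E] [MeasurableSpace E] [BorelSpace E] in
lemma plancherelConst_ne_zero : plancherelConst E ≠ 0 := by
  rw [plancherelConst, ne_eq, ENNReal.ofReal_eq_zero, not_le]
  positivity

omit [FiniteDimensional ℝ E] [MeasurableSpace E] [BorelSpace E] in
lemma plancherelConst_ne_top : plancherelConst E ≠ ∞ := ENNReal.ofReal_ne_top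

lemma eLpNorm_two_sq {X : Type*} [MeasurableSpace X] {ν : Measure X} {F : Type*}
    [NormedAddCommGroup F] (f : X → F) :
    eLpNorm f 2 ν ^ 2 = ∫⁻ x, ‖f x‖ₑ ^ 2 ∂ν := by
  simpa using eLpNorm_nnreal_pow_eq_lintegral (f := f) (μ := ν) (p := 2) two_ne_zero

lemma lintegral_enorm_ft_sq {f : E → ℂ} (h1 : Integrable f) (h2 : MemLp f 2 volume) :
    ∫⁻ ζ, ‖ft f ζ‖ₑ ^ 2 = plancherelConst E * ∫⁻ x, ‖f x‖ₑ ^ 2 := by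
  have hc : Continuous (𝓕 f) :=
    VectorFourier.fourierIntegral_continuous Real.continuous_fourierChar continuous_inner h1
  simp_rw [ft_eq_fourier]
  rw [lintegral_comp_inv_smul (g := fun ζ => ‖𝓕 f ζ‖ₑ ^ 2) (by fun_prop) (by positivity),
    plancherelConst]
  congr 1
  rw [← eLpNorm_two_sq, ← eLpNorm_two_sq, ← eLpNorm_congr_ae (fourier_toLp_ae_eq h1 h2),
    ← Lp.enorm_def, ← eLpNorm_congr_ae h2.coeFn_toLp, ← Lp.enorm_def, ← ofReal_norm, ← ofReal_norm,
    Lp.norm_fourier_eq]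

lemma integral_conj_mul_eq_fourier {f g : E → ℂ} (hf1 : Integrable f) (hf2 : MemLp f 2 volume)
    (hg1 : Integrable g) (hg2 : MemLp g 2 volume) :
    ∫ x, (starRingEnd ℂ) (f x) * g x = ∫ x, (starRingEnd ℂ) (𝓕 f x) * 𝓕 g x := by
  have h := Lp.inner_fourier_eq (hf2.toLp f) (hg2.toLp g)
  rw [L2.inner_def, L2.inner_def] at h
  calc _ = ∫ x, inner ℂ (hf2.toLp f x) (hg2.toLp g x) := by
        refine integral_congr_ae ?_
        filter_upwards [hf2.coeFn_toLp, hg2.coeFn_toLp] with x hf hg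
        rw [hf, hg, RCLike.inner_apply, mul_comm]
    _ = _ := by
        rw [← h]
        refine integral_congr_ae ?_
        filter_upwards [fourier_toLp_ae_eq hf1 hf2, fourier_toLp_ae_eq hg1 hg2] with x hf hg
        rw [hf, hg, RCLike.inner_apply, mul_comm]

lemma enorm_integral_conj_mul_le {f g : E → ℂ} (hf1 : Integrable f) (hf2 : MemLp f 2 volume)
    (hg1 : Integrable g) (hg2 : MemLp g 2 volume) :
    plancherelConst E * ‖∫ x, (starRingEnd ℂ) (f x) * g x‖ₑ ≤ ∫⁻ ζ, ‖ft f ζ‖ₑ * ‖ft g ζ‖ₑ := by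
  have hcf : Continuous (𝓕 f) :=
    VectorFourier.fourierIntegral_continuous Real.continuous_fourierChar continuous_inner hf1
  have hcg : Continuous (𝓕 g) :=
    VectorFourier.fourierIntegral_continuous Real.continuous_fourierChar continuous_inner hg1
  simp_rw [ft_eq_fourier]
  rw [lintegral_comp_inv_smul (g := fun ζ => ‖𝓕 f ζ‖ₑ * ‖𝓕 g ζ‖ₑ) (by fun_prop) (by positivity),
    plancherelConst, integral_conj_mul_eq_fourier hf1 hf2 hg1 hg2]
  gcongr
  refine (enorm_integral_le_lintegral_enorm _).trans_eq ?_
  simp only [enorm_mul, RCLike.enorm_conj]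

end Fourier

/-! ### Multiplication by Lipschitz functions, from `Ḣ^{-1}` to `H^{-2}` -/

section Lintegral

variable {X : Type*} [MeasurableSpace X] {ν : Measure X}

lemma lintegral_le_of_tendsto_of_le {ι : Type*} {l : Filter ι} [l.NeBot] [l.IsCountablyGenerated]
    {F : ι → X → ℝ≥0∞} {g : X → ℝ≥0∞} {C : ℝ≥0∞} (hF : ∀ i, Measurable (F i))
    (hlim : ∀ x, Tendsto (fun i => F i x) l (𝓝 (g x))) (hC : ∀ i, ∫⁻ x, F i x ∂ν ≤ C) :
    ∫⁻ x, g x ∂ν ≤ C :=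
  calc ∫⁻ x, g x ∂ν = ∫⁻ x, liminf (fun i => F i x) l ∂ν := by simp only [(hlim _).liminf_eq]
    _ ≤ liminf (fun i => ∫⁻ x, F i x ∂ν) l := lintegral_liminf_le hF
    _ ≤ C := liminf_le_of_frequently_le' (.of_forall hC)

lemma sq_lintegral_mul_le {f g : X → ℝ≥0∞} (hf : AEMeasurable f ν) (hg : AEMeasurable g ν) :
    (∫⁻ x, f x * g x ∂ν) ^ 2 ≤ (∫⁻ x, f x ^ 2 ∂ν) * ∫⁻ x, g x ^ 2 ∂ν := by
  refine (pow_le_pow_left' (ENNReal.lintegral_mul_le_Lp_mul_Lq ν Real.HolderConjugate.two_two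
    hf hg) 2).trans_eq ?_
  simp [mul_pow, ← ENNReal.rpow_mul_natCast]

lemma memLp_two_of_memLp_one_of_memLp_top {F : Type*} [NormedAddCommGroup F] {f : X → F}
    (h1 : MemLp f 1 ν) (htop : MemLp f ∞ ν) : MemLp f 2 ν := by
  refine (memLp_two_iff_integrable_sq_norm h1.1).2 ?_
  have hb : ∀ᵐ x ∂ν, ‖‖f x‖‖ ≤ (eLpNorm f ∞ ν).toReal := by
    filter_upwards [enorm_ae_le_eLpNormEssSup f ν] with x hx
    rw [norm_norm, ← toReal_enorm]
    exact ENNReal.toReal_mono htop.2.ne (by simpa using hx)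
  have hf := (memLp_one_iff_integrable.1 h1).norm
  simpa only [sq] using hf.bdd_mul hf.aestronglyMeasurable hb

lemma memLp_two_of_integrable_of_norm_le {F : Type*} [NormedAddCommGroup F] {f : X → F}
    (h1 : Integrable f ν) {C : ℝ} (hC : ∀ x, ‖f x‖ ≤ C) : MemLp f 2 ν :=
  memLp_two_of_memLp_one_of_memLp_top (memLp_one_iff_integrable.2 h1)
    (memLp_top_of_bound h1.aestronglyMeasurable C (Eventually.of_forall hC))

end Lintegral

lemma enorm_coe_complex (r : ℝ) : ‖(r : ℂ)‖ₑ = ‖r‖ₑ := by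
  rw [← ofReal_norm, ← ofReal_norm, Complex.norm_real]

lemma sq_add_le_two_mul (a b : ℝ≥0∞) : (a + b) ^ 2 ≤ 2 * (a ^ 2 + b ^ 2) := by
  have h := ENNReal.rpow_add_le_mul_rpow_add_rpow a b (p := 2) (by norm_num)
  norm_num at h
  exact_mod_cast h

section Multiplication

variable {E : Type*} [NormedAddCommGroup E] [InnerProductSpace ℝ E] [FiniteDimensional ℝ E]
  [MeasurableSpace E] [BorelSpace E]

lemma lintegral_enorm_chr_sub_one_mul_ft_sq {ψ : E → ℂ} (h1 : Integrable ψ)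
    (h2 : MemLp ψ 2 volume) (h : E) :
    ∫⁻ ζ, ‖(chr (-h) ζ - 1) * ft ψ ζ‖ₑ ^ 2
      = plancherelConst E * ∫⁻ x, ‖ψ (x + h) - ψ x‖ₑ ^ 2 := by
  have hI : Integrable (fun x => ψ (x + h)) := h1.comp_add_right h
  have hM : MemLp (fun x => ψ (x + h)) 2 volume :=
    h2.comp_measurePreserving (measurePreserving_add_right volume h)
  rw [← lintegral_enorm_ft_sq (f := fun x => ψ (x + h) - ψ x) (hI.sub h1) (hM.sub h2)]
  simp only [ft_sub hI h1, ft_comp_add_right, sub_one_mul]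

lemma lintegral_inner_sq_mul_ft_le {ψ : E → ℂ} (h1 : Integrable ψ) (h2 : MemLp ψ 2 volume)
    {K : ℝ≥0∞} (hK : ∀ h : E, ∫⁻ x, ‖ψ (x + h) - ψ x‖ₑ ^ 2 ≤ K * ‖h‖ₑ ^ 2) (e : E) :
    ∫⁻ ζ, ‖(inner ℝ e ζ : ℝ)‖ₑ ^ 2 * ‖ft ψ ζ‖ₑ ^ 2 ≤ plancherelConst E * (K * ‖e‖ₑ ^ 2) := by
  have hc := continuous_ft h1
  refine lintegral_le_of_tendsto_of_le (l := 𝓝[≠] (0 : ℝ))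
    (F := fun t ζ => ‖t⁻¹‖ₑ ^ 2 * ‖(chr (-(t • e)) ζ - 1) * ft ψ ζ‖ₑ ^ 2)
    (fun t => ?_) (fun ζ => ?_) fun t => ?_
  · have : Continuous fun ζ => (chr (-(t • e)) ζ - 1) * ft ψ ζ := by fun_prop
    fun_prop
  · have hslope := ((hasDerivAt_chr_smul e ζ).tendsto_slope_zero.mul_const (ft ψ ζ)).enorm
    have hsq := ENNReal.Tendsto.pow (n := 2) hslope
    simp only [zero_add, zero_smul, neg_zero] at hsq
    simpa [chr, mul_pow, enorm_mul, enorm_smul, mul_assoc, ← ofReal_norm Complex.I,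
      ← Complex.ofReal_inv, enorm_coe_complex] using hsq
  · rw [lintegral_const_mul' _ _ (by finiteness), lintegral_enorm_chr_sub_one_mul_ft_sq h1 h2]
    calc _ ≤ ‖t⁻¹‖ₑ ^ 2 * (plancherelConst E * (K * ‖t • e‖ₑ ^ 2)) := by gcongr; exact hK _
      _ = ‖t⁻¹ * t‖ₑ ^ 2 * (plancherelConst E * (K * ‖e‖ₑ ^ 2)) := by
          rw [enorm_smul, enorm_mul]; ring
      _ ≤ 1 * (plancherelConst E * (K * ‖e‖ₑ ^ 2)) := by
          gcongr
          rcases eq_or_ne t 0 with rfl | ht <;> simp [*]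
      _ = _ := one_mul _

lemma lintegral_norm_sq_mul_ft_le {ψ : E → ℂ} (h1 : Integrable ψ) (h2 : MemLp ψ 2 volume)
    {K : ℝ≥0∞} (hK : ∀ h : E, ∫⁻ x, ‖ψ (x + h) - ψ x‖ₑ ^ 2 ≤ K * ‖h‖ₑ ^ 2) :
    ∫⁻ ζ, ‖ζ‖ₑ ^ 2 * ‖ft ψ ζ‖ₑ ^ 2 ≤ Module.finrank ℝ E * (plancherelConst E * K) := by
  have hc := continuous_ft h1
  set b := stdOrthonormalBasis ℝ E
  have hsum (ζ : E) : ‖ζ‖ₑ ^ 2 = ∑ i, ‖(inner ℝ (b i) ζ : ℝ)‖ₑ ^ 2 := by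
    simp only [← ofReal_norm, ← ENNReal.ofReal_pow (norm_nonneg _)]
    rw [← ENNReal.ofReal_sum_of_nonneg (fun _ _ => by positivity), b.sum_sq_norm_inner_right]
  calc _ = ∑ i, ∫⁻ ζ, ‖(inner ℝ (b i) ζ : ℝ)‖ₑ ^ 2 * ‖ft ψ ζ‖ₑ ^ 2 := by
        rw [← lintegral_finsetSum _ fun i _ => by fun_prop]
        simp only [hsum, Finset.sum_mul]
    _ ≤ ∑ i, plancherelConst E * (K * ‖b i‖ₑ ^ 2) :=
        Finset.sum_le_sum fun i _ => lintegral_inner_sq_mul_ft_le h1 h2 hK (b i)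
    _ = _ := by simp [← ofReal_norm]

lemma lintegral_comp_neg (g : E → ℝ≥0∞) : ∫⁻ x, g (-x) = ∫⁻ x, g x :=
  (Measure.measurePreserving_neg (volume : Measure E)).lintegral_comp_emb
    (MeasurableEquiv.neg E).measurableEmbedding g

lemma lintegral_enorm_ft_neg_sq {a : E → ℂ} (h1 : Integrable a) (h2 : MemLp a 2 volume) :
    ∫⁻ x, ‖ft a (-x)‖ₑ ^ 2 = plancherelConst E * ∫⁻ ζ, ‖a ζ‖ₑ ^ 2 := by
  rw [lintegral_comp_neg (fun x => ‖ft a x‖ₑ ^ 2), lintegral_enorm_ft_sq h1 h2]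

lemma lintegral_enorm_ft_neg_add_sub_sq_le {a : E → ℂ} (h1 : Integrable a)
    (h2 : MemLp a 2 volume) (h : E) :
    ∫⁻ x, ‖ft a (-(x + h)) - ft a (-x)‖ₑ ^ 2
      ≤ plancherelConst E * ‖h‖ₑ ^ 2 * ∫⁻ ζ, ‖ζ‖ₑ ^ 2 * ‖a ζ‖ₑ ^ 2 := by
  have hI : Integrable (fun ζ => chr (-h) ζ * a ζ) := by
    simp_rw [chr_comm (-h)]; exact integrable_chr_mul h1 _
  have hM : MemLp (fun ζ => chr (-h) ζ * a ζ) 2 volume :=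
    h2.of_le hI.aestronglyMeasurable (Eventually.of_forall fun x => by simp)
  have hshift (x : E) : ft a (-(x + h)) = ft (fun ζ => chr (-h) ζ * a ζ) (-x) := by
    simp only [ft, neg_add, chr_comm _ (-x + -h), chr_add_left, chr_comm (-x), mul_assoc]
  calc _ = ∫⁻ x, ‖ft (fun ζ => chr (-h) ζ * a ζ - a ζ) (-x)‖ₑ ^ 2 := by
        simp only [ft_sub hI h1, hshift]
    _ = plancherelConst E * ∫⁻ ζ, ‖chr (-h) ζ * a ζ - a ζ‖ₑ ^ 2 :=
        lintegral_enorm_ft_neg_sq (hI.sub h1) (hM.sub h2)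
    _ ≤ plancherelConst E * ∫⁻ ζ, ‖h‖ₑ ^ 2 * (‖ζ‖ₑ ^ 2 * ‖a ζ‖ₑ ^ 2) := by
        refine mul_le_mul' le_rfl (lintegral_mono fun ζ => ?_)
        rw [← sub_one_mul, enorm_mul, mul_pow, ← mul_assoc, ← mul_pow ‖h‖ₑ]
        gcongr
        simpa [← ofReal_norm, ← ENNReal.ofReal_mul] using
          ENNReal.ofReal_le_ofReal (norm_chr_sub_one_le (-h) ζ)
    _ = _ := by rw [lintegral_const_mul' _ _ (by finiteness)]; ring

lemma integral_conj_ft_neg_mul {a g : E → ℂ} (ha : Integrable a) (hg : Integrable g) :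
    ∫ x, (starRingEnd ℂ) (ft a (-x)) * g x = ∫ ζ, (starRingEnd ℂ) (a ζ) * ft g ζ := by
  have hca : Integrable (fun ζ => (starRingEnd ℂ) (a ζ)) :=
    ha.congr' (RCLike.continuous_conj.comp_aestronglyMeasurable ha.aestronglyMeasurable)
      (Eventually.of_forall fun x => by simp)
  have hconj (x : E) : (starRingEnd ℂ) (ft a (-x)) = ∫ ζ, chr x ζ * (starRingEnd ℂ) (a ζ) := by
    simp only [ft, ← integral_conj, map_mul, conj_chr, ← chr_neg_right, neg_neg, chr_comm x]
  calc _ = ∫ x, ∫ ζ, chr x ζ * (g x * (starRingEnd ℂ) (a ζ)) := by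
        simp only [hconj, ← integral_mul_const, mul_assoc, mul_comm (g _)]
    _ = ∫ ζ, ∫ x, chr x ζ * (g x * (starRingEnd ℂ) (a ζ)) :=
        integral_integral_swap ((hg.mul_prod hca).bdd_mul (c := 1)
          continuous_chr.aestronglyMeasurable (Eventually.of_forall fun p => by simp))
    _ = _ := by
        simp only [ft, ← integral_const_mul, mul_left_comm, mul_comm (g _)]

omit [InnerProductSpace ℝ E] [FiniteDimensional ℝ E] [MeasurableSpace E] [BorelSpace E] in
lemma enorm_conj_mul_sub_sq_le {w u : E → ℂ} {L : ℝ≥0} (hw : ∀ x, ‖w x‖ ≤ 1)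
    (hL : LipschitzWith L w) (x y : E) :
    ‖(starRingEnd ℂ) (w x) * u x - (starRingEnd ℂ) (w y) * u y‖ₑ ^ 2
      ≤ 2 * (‖u x - u y‖ₑ ^ 2 + (L * ‖x - y‖ₑ) ^ 2 * ‖u y‖ₑ ^ 2) := by
  have hsplit : (starRingEnd ℂ) (w x) * u x - (starRingEnd ℂ) (w y) * u y
      = (starRingEnd ℂ) (w x) * (u x - u y) + (starRingEnd ℂ) (w x - w y) * u y := by
    rw [map_sub]; ring
  have hbound : ‖w x‖ₑ ≤ 1 := by
    rw [← ofReal_norm]; exact ENNReal.ofReal_le_one.2 (hw x)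
  have hlip : ‖w x - w y‖ₑ ≤ L * ‖x - y‖ₑ := by
    simpa only [edist_eq_enorm_sub] using hL x y
  rw [hsplit, ← mul_pow]
  refine le_trans ?_ (sq_add_le_two_mul _ _)
  gcongr
  refine (enorm_add_le _ _).trans ?_
  rw [enorm_mul, enorm_mul, RCLike.enorm_conj, RCLike.enorm_conj]
  gcongr
  exact mul_le_of_le_one_left' hbound

lemma lintegral_conj_mul_ft_neg_add_sub_sq_le {a w : E → ℂ} {L : ℝ≥0} (h1 : Integrable a)
    (h2 : MemLp a 2 volume) (hw : ∀ x, ‖w x‖ ≤ 1) (hL : LipschitzWith L w) (h : E) :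
    ∫⁻ x, ‖(starRingEnd ℂ) (w (x + h)) * ft a (-(x + h)) - (starRingEnd ℂ) (w x) * ft a (-x)‖ₑ ^ 2
      ≤ 2 * plancherelConst E * ((∫⁻ ζ, ‖ζ‖ₑ ^ 2 * ‖a ζ‖ₑ ^ 2) + L ^ 2 * ∫⁻ ζ, ‖a ζ‖ₑ ^ 2)
        * ‖h‖ₑ ^ 2 := by
  have hc := continuous_ft h1
  calc _ ≤ ∫⁻ x, 2 * (‖ft a (-(x + h)) - ft a (-x)‖ₑ ^ 2
          + (L * ‖h‖ₑ) ^ 2 * ‖ft a (-x)‖ₑ ^ 2) := by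
        refine lintegral_mono fun x => ?_
        simpa only [add_sub_cancel_left] using
          enorm_conj_mul_sub_sq_le (u := fun x => ft a (-x)) hw hL (x + h) x
    _ = 2 * ((∫⁻ x, ‖ft a (-(x + h)) - ft a (-x)‖ₑ ^ 2)
          + (L * ‖h‖ₑ) ^ 2 * ∫⁻ x, ‖ft a (-x)‖ₑ ^ 2) := by
        rw [lintegral_const_mul' _ _ (by finiteness), lintegral_add_left (by fun_prop),
          lintegral_const_mul' _ _ (by finiteness)]
    _ ≤ 2 * (plancherelConst E * ‖h‖ₑ ^ 2 * (∫⁻ ζ, ‖ζ‖ₑ ^ 2 * ‖a ζ‖ₑ ^ 2)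
          + (L * ‖h‖ₑ) ^ 2 * (plancherelConst E * ∫⁻ ζ, ‖a ζ‖ₑ ^ 2)) := by
        rw [lintegral_enorm_ft_neg_sq h1 h2]
        gcongr
        exact lintegral_enorm_ft_neg_add_sub_sq_le h1 h2 h
    _ = _ := by ring

/-- The square of the homogeneous Sobolev norm `‖f‖_{Ḣ^{-1}}`. -/
def hDotNegOneSq (f : E → ℂ) : ℝ≥0∞ := ∫⁻ ζ, ‖ft f ζ‖ₑ ^ 2 / ‖ζ‖ₑ ^ 2

lemma sq_lintegral_enorm_ft_mul_le [Nontrivial E] {ψ f : E → ℂ} (hψ : Integrable ψ)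
    (hf : Integrable f) :
    (∫⁻ ζ, ‖ft ψ ζ‖ₑ * ‖ft f ζ‖ₑ) ^ 2
      ≤ (∫⁻ ζ, ‖ζ‖ₑ ^ 2 * ‖ft ψ ζ‖ₑ ^ 2) * hDotNegOneSq f := by
  have hψc := continuous_ft hψ
  have hfc := continuous_ft hf
  calc _ = (∫⁻ ζ, (‖ζ‖ₑ * ‖ft ψ ζ‖ₑ) * (‖ft f ζ‖ₑ / ‖ζ‖ₑ)) ^ 2 := by
        congr 1
        refine lintegral_congr_ae ?_
        filter_upwards [Measure.ae_ne volume (0 : E)] with ζ hζ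
        rw [mul_comm ‖ζ‖ₑ, mul_assoc, ENNReal.mul_div_cancel (by simpa using hζ) (by finiteness)]
    _ ≤ (∫⁻ ζ, (‖ζ‖ₑ * ‖ft ψ ζ‖ₑ) ^ 2) * ∫⁻ ζ, (‖ft f ζ‖ₑ / ‖ζ‖ₑ) ^ 2 :=
        sq_lintegral_mul_le (by fun_prop) (by fun_prop)
    _ = _ := by
        simp only [hDotNegOneSq, mul_pow, div_eq_mul_inv, ENNReal.inv_pow]

/-- The bound dual to the continuity of multiplication by `w` from `Ḣ^{-1}` to `H^{-1}`. -/
lemma enorm_integral_conj_mul_ft_mul_sq_le [Nontrivial E] {a f w : E → ℂ} {L : ℝ≥0}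
    (ha1 : Integrable a) (ha2 : MemLp a 2 volume) (hf1 : Integrable f) (hf2 : MemLp f 2 volume)
    (hw1 : Integrable w) (hw : ∀ x, ‖w x‖ ≤ 1) (hL : LipschitzWith L w) :
    ‖∫ ζ, (starRingEnd ℂ) (a ζ) * ft (fun x => w x * f x) ζ‖ₑ ^ 2
      ≤ 2 * Module.finrank ℝ E
        * ((∫⁻ ζ, ‖ζ‖ₑ ^ 2 * ‖a ζ‖ₑ ^ 2) + L ^ 2 * ∫⁻ ζ, ‖a ζ‖ₑ ^ 2) * hDotNegOneSq f := by
  set S := (∫⁻ ζ, ‖ζ‖ₑ ^ 2 * ‖a ζ‖ₑ ^ 2) + L ^ 2 * ∫⁻ ζ, ‖a ζ‖ₑ ^ 2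
  set ψ : E → ℂ := fun x => (starRingEnd ℂ) (w x) * ft a (-x) with hψ
  have hwf : Integrable (fun x => w x * f x) :=
    hf1.bdd_mul hw1.aestronglyMeasurable (Eventually.of_forall hw)
  have hft : Continuous fun x => ft a (-x) := (continuous_ft ha1).comp continuous_neg
  have hψ1 : Integrable ψ := by
    refine Integrable.mul_bdd ?_ hft.aestronglyMeasurable
      (Eventually.of_forall fun x => norm_ft_le a (-x))
    exact hw1.congr' (RCLike.continuous_conj.comp_aestronglyMeasurable hw1.aestronglyMeasurable)
      (Eventually.of_forall fun x => by simp)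
  have hψ2 : MemLp ψ 2 volume :=
    memLp_two_of_integrable_of_norm_le hψ1 (C := 1 * ∫ x, ‖a x‖) fun x => by
      rw [hψ, norm_mul, RCLike.norm_conj]
      exact mul_le_mul (hw x) (norm_ft_le a (-x)) (norm_nonneg _) zero_le_one
  have hpair : ∫ ζ, (starRingEnd ℂ) (a ζ) * ft (fun x => w x * f x) ζ
      = ∫ x, (starRingEnd ℂ) (ψ x) * f x := by
    rw [← integral_conj_ft_neg_mul ha1 hwf]
    simp only [hψ, map_mul, Complex.conj_conj, mul_assoc, mul_left_comm]
  have hgrad := lintegral_norm_sq_mul_ft_le hψ1 hψ2 fun h =>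
    lintegral_conj_mul_ft_neg_add_sub_sq_le ha1 ha2 hw hL h
  have hconst : plancherelConst E ^ 2 ≠ ∞ := ENNReal.pow_ne_top plancherelConst_ne_top
  refine (ENNReal.mul_le_mul_iff_right (pow_ne_zero 2 plancherelConst_ne_zero) hconst).1 ?_
  rw [hpair, ← mul_pow]
  calc _ ≤ (∫⁻ ζ, ‖ft ψ ζ‖ₑ * ‖ft f ζ‖ₑ) ^ 2 := by
        gcongr
        exact enorm_integral_conj_mul_le hψ1 hψ2 hf1 hf2
    _ ≤ (Module.finrank ℝ E * (plancherelConst E * (2 * plancherelConst E * S)))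
          * hDotNegOneSq f := (sq_lintegral_enorm_ft_mul_le hψ1 hf1).trans (by gcongr)
    _ = _ := by ring

/-- The weight `(1 + |ζ|²)^{-2}` of the Sobolev space `H^{-2}`. -/
def bessel (ζ : E) : ℝ := ((1 + ‖ζ‖ ^ 2) ^ 2)⁻¹

omit [InnerProductSpace ℝ E] [FiniteDimensional ℝ E] [MeasurableSpace E] [BorelSpace E] in
lemma bessel_pos (ζ : E) : 0 < bessel ζ := by unfold bessel; positivity

omit [InnerProductSpace ℝ E] [FiniteDimensional ℝ E] [MeasurableSpace E] [BorelSpace E] in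
lemma one_add_sq_mul_bessel_le (ζ : E) : (1 + ‖ζ‖ ^ 2) * bessel ζ ≤ 1 := by
  unfold bessel
  rw [← div_eq_mul_inv, div_le_one (by positivity)]
  nlinarith [sq_nonneg ‖ζ‖]

omit [InnerProductSpace ℝ E] [FiniteDimensional ℝ E] [MeasurableSpace E] [BorelSpace E] in
lemma bessel_le_one (ζ : E) : bessel ζ ≤ 1 := by
  nlinarith [one_add_sq_mul_bessel_le ζ, bessel_pos ζ, sq_nonneg ‖ζ‖]

omit [InnerProductSpace ℝ E] [FiniteDimensional ℝ E] [MeasurableSpace E] [BorelSpace E] in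
@[fun_prop] lemma continuous_bessel : Continuous (bessel : E → ℝ) := by
  unfold bessel
  exact Continuous.inv₀ (by fun_prop) fun ζ => by positivity

lemma integrable_bessel (hE : Module.finrank ℝ E < 4) : Integrable (bessel : E → ℝ) := by
  refine (integrable_rpow_neg_one_add_norm_sq (E := E) (μ := volume) (r := 4)
    (by exact_mod_cast hE)).congr (Eventually.of_forall fun ζ => ?_)
  simp only [bessel]
  rw [show (-4 / 2 : ℝ) = -(2 : ℕ) by norm_num, Real.rpow_neg (by positivity), Real.rpow_natCast]

lemma lintegral_enorm_bessel_mul_sq_le (H : E → ℂ) :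
    ∫⁻ ζ, ‖bessel ζ * H ζ‖ₑ ^ 2 ≤ ∫⁻ ζ, ENNReal.ofReal (bessel ζ) * ‖H ζ‖ₑ ^ 2 := by
  refine lintegral_mono fun ζ => ?_
  have h0 := bessel_pos ζ
  rw [enorm_mul, mul_pow, enorm_coe_complex, Real.enorm_of_nonneg h0.le, ← ENNReal.ofReal_pow h0.le]
  gcongr
  nlinarith [bessel_le_one ζ]

lemma lintegral_norm_sq_mul_enorm_bessel_mul_sq_le (H : E → ℂ) :
    ∫⁻ ζ, ‖ζ‖ₑ ^ 2 * ‖bessel ζ * H ζ‖ₑ ^ 2 ≤ ∫⁻ ζ, ENNReal.ofReal (bessel ζ) * ‖H ζ‖ₑ ^ 2 := by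
  refine lintegral_mono fun ζ => ?_
  have h0 := bessel_pos ζ
  rw [enorm_mul, mul_pow, ← mul_assoc, enorm_coe_complex, Real.enorm_of_nonneg h0.le,
    ← ofReal_norm, ← ENNReal.ofReal_pow (norm_nonneg _), ← ENNReal.ofReal_pow h0.le,
    ← ENNReal.ofReal_mul (by positivity)]
  gcongr
  nlinarith [one_add_sq_mul_bessel_le ζ]

lemma integrable_bessel_mul_norm_ft_sq (hE : Module.finrank ℝ E < 4) {f : E → ℂ}
    (hf : Integrable f) : Integrable (fun ζ => bessel ζ * ‖ft f ζ‖ ^ 2) := by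
  have hc := continuous_ft hf
  refine (integrable_bessel hE).mul_bdd (c := (∫ x, ‖f x‖) ^ 2) (by fun_prop)
    (Eventually.of_forall fun ζ => ?_)
  rw [Real.norm_of_nonneg (by positivity)]
  exact pow_le_pow_left₀ (norm_nonneg _) (norm_ft_le f ζ) 2

lemma integrable_bessel_mul_ft (hE : Module.finrank ℝ E < 4) {f : E → ℂ} (hf : Integrable f) :
    Integrable (fun ζ => (bessel ζ : ℂ) * ft f ζ) :=
  (integrable_bessel hE).ofReal.mul_bdd (continuous_ft hf).aestronglyMeasurable
    (Eventually.of_forall (norm_ft_le f))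

lemma lintegral_bessel_mul_ft_sq_ne_top (hE : Module.finrank ℝ E < 4) {f : E → ℂ}
    (hf : Integrable f) : ∫⁻ ζ, ENNReal.ofReal (bessel ζ) * ‖ft f ζ‖ₑ ^ 2 ≠ ∞ := by
  refine ((integrable_bessel_mul_norm_ft_sq hE hf).lintegral_lt_top.trans_eq' ?_).ne
  congr 1 with ζ
  rw [ENNReal.ofReal_mul (bessel_pos ζ).le, ENNReal.ofReal_pow (norm_nonneg _), ofReal_norm]

lemma enorm_integral_conj_bessel_mul_ft_mul_ft (hE : Module.finrank ℝ E < 4) {f : E → ℂ}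
    (hf : Integrable f) :
    ‖∫ ζ, (starRingEnd ℂ) (bessel ζ * ft f ζ) * ft f ζ‖ₑ
      = ∫⁻ ζ, ENNReal.ofReal (bessel ζ) * ‖ft f ζ‖ₑ ^ 2 := by
  have hnn (ζ : E) : 0 ≤ bessel ζ * ‖ft f ζ‖ ^ 2 := mul_nonneg (bessel_pos ζ).le (sq_nonneg _)
  have hreal (ζ : E) : (starRingEnd ℂ) (bessel ζ * ft f ζ) * ft f ζ
      = ((bessel ζ * ‖ft f ζ‖ ^ 2 : ℝ) : ℂ) := by
    rw [map_mul, Complex.conj_ofReal, mul_assoc, Complex.conj_mul']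
    push_cast; rfl
  simp_rw [hreal]
  rw [integral_complex_ofReal, enorm_coe_complex, Real.enorm_of_nonneg (integral_nonneg hnn),
    ofReal_integral_eq_lintegral_ofReal (integrable_bessel_mul_norm_ft_sq hE hf)
      (Eventually.of_forall hnn)]
  congr 1 with ζ
  rw [ENNReal.ofReal_mul (bessel_pos ζ).le, ENNReal.ofReal_pow (norm_nonneg _), ofReal_norm]

lemma lintegral_bessel_mul_ft_mul_le_of_integrable [Nontrivial E]
    (hE : Module.finrank ℝ E < 4) {f w : E → ℂ} {L : ℝ≥0} (hf1 : Integrable f)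
    (hf2 : MemLp f 2 volume) (hw1 : Integrable w) (hw : ∀ x, ‖w x‖ ≤ 1) (hL : LipschitzWith L w) :
    ∫⁻ ζ, ENNReal.ofReal (bessel ζ) * ‖ft (fun x => w x * f x) ζ‖ₑ ^ 2
      ≤ 2 * Module.finrank ℝ E * (1 + L ^ 2) * hDotNegOneSq f := by
  have hwf : Integrable (fun x => w x * f x) :=
    hf1.bdd_mul hw1.aestronglyMeasurable (Eventually.of_forall hw)
  have ha := integrable_bessel_mul_ft hE hwf
  have ha2 := memLp_two_of_integrable_of_norm_le ha (C := 1 * ∫ x, ‖w x * f x‖) fun ζ => by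
    rw [norm_mul, Complex.norm_real, Real.norm_of_nonneg (bessel_pos ζ).le]
    exact mul_le_mul (bessel_le_one ζ) (norm_ft_le _ ζ) (norm_nonneg _) zero_le_one
  have hdual := enorm_integral_conj_mul_ft_mul_sq_le ha ha2 hf1 hf2 hw1 hw hL
  rw [enorm_integral_conj_bessel_mul_ft_mul_ft hE hwf] at hdual
  have hfin := lintegral_bessel_mul_ft_sq_ne_top hE hwf
  have ha3 := lintegral_enorm_bessel_mul_sq_le (ft fun x => w x * f x)
  have ha4 := lintegral_norm_sq_mul_enorm_bessel_mul_sq_le (ft fun x => w x * f x)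
  set T := ∫⁻ ζ, ENNReal.ofReal (bessel ζ) * ‖ft (fun x => w x * f x) ζ‖ₑ ^ 2
  rcases eq_or_ne T 0 with hT | hT
  · rw [hT]; exact zero_le
  refine (ENNReal.mul_le_mul_iff_right hT hfin).1 ?_
  calc T * T = T ^ 2 := (sq T).symm
    _ ≤ 2 * Module.finrank ℝ E * (T + L ^ 2 * T) * hDotNegOneSq f := hdual.trans (by gcongr)
    _ = T * (2 * Module.finrank ℝ E * (1 + L ^ 2) * hDotNegOneSq f) := by ring

end Multiplication

section Cutoff

variable {E : Type*} [NormedAddCommGroup E]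

/-- The Lipschitz cutoff `max (1 - ‖x‖ / (n + 1)) 0`, used to make Lipschitz multipliers
integrable. -/
def cutoff (n : ℕ) (x : E) : ℝ := max (1 - ‖x‖ / (n + 1)) 0

lemma cutoff_nonneg (n : ℕ) (x : E) : 0 ≤ cutoff n x := le_max_right _ _

lemma cutoff_le_one (n : ℕ) (x : E) : cutoff n x ≤ 1 :=
  max_le (sub_le_self _ (by positivity)) zero_le_one

lemma lipschitzWith_cutoff (n : ℕ) : LipschitzWith 1 (cutoff n : E → ℝ) := by
  refine LipschitzWith.of_dist_le_mul fun x y => ?_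
  rw [NNReal.coe_one, one_mul, dist_eq_norm, dist_eq_norm, Real.norm_eq_abs]
  calc |cutoff n x - cutoff n y| ≤ |(1 - ‖x‖ / ((n : ℝ) + 1)) - (1 - ‖y‖ / (n + 1))| :=
        abs_max_sub_max_le_abs _ _ _
    _ = |‖y‖ - ‖x‖| / (n + 1) := by
        rw [sub_sub_sub_cancel_left, ← sub_div, abs_div,
          abs_of_pos (by positivity : 0 < (n : ℝ) + 1)]
    _ ≤ |‖y‖ - ‖x‖| := div_le_self (abs_nonneg _) (by simp)
    _ ≤ ‖x - y‖ := norm_sub_rev x y ▸ abs_norm_sub_norm_le y x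

lemma hasCompactSupport_cutoff [ProperSpace E] (n : ℕ) :
    HasCompactSupport (cutoff n : E → ℝ) := by
  refine HasCompactSupport.intro (isCompact_closedBall (0 : E) (n + 1)) fun x hx => ?_
  have hx' : (n : ℝ) + 1 < ‖x‖ := by simpa using hx
  exact max_eq_right (sub_nonpos.2 ((one_lt_div (by positivity)).2 hx').le)

lemma tendsto_cutoff (x : E) : Tendsto (fun n => cutoff n x) atTop (𝓝 1) := by
  have hdiv : Tendsto (fun n : ℕ => ‖x‖ / ((n : ℝ) + 1)) atTop (𝓝 0) := by
    simpa [div_eq_mul_inv] using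
      (tendsto_one_div_add_atTop_nhds_zero_nat (𝕜 := ℝ)).const_mul ‖x‖
  simpa [cutoff] using (hdiv.const_sub 1).max (tendsto_const_nhds (x := (0 : ℝ)))

lemma norm_cutoff_mul_le {w : E → ℂ} (hw : ∀ x, ‖w x‖ ≤ 1) (n : ℕ) (x : E) :
    ‖(cutoff n x : ℂ) * w x‖ ≤ 1 := by
  rw [norm_mul, Complex.norm_real, Real.norm_of_nonneg (cutoff_nonneg n x)]
  exact mul_le_one₀ (cutoff_le_one n x) (norm_nonneg _) (hw x)

lemma lipschitzWith_cutoff_mul {w : E → ℂ} {L : ℝ≥0} (hw : ∀ x, ‖w x‖ ≤ 1)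
    (hL : LipschitzWith L w) (n : ℕ) :
    LipschitzWith (L + 1) (fun x => (cutoff n x : ℂ) * w x) := by
  refine LipschitzWith.of_dist_le_mul fun x y => ?_
  have hsplit : (cutoff n x : ℂ) * w x - cutoff n y * w y
      = (cutoff n x : ℂ) * (w x - w y) + ((cutoff n x - cutoff n y : ℝ) : ℂ) * w y := by
    push_cast; ring
  have hc := (lipschitzWith_cutoff n).norm_sub_le x y
  have hw' := hL.norm_sub_le x y
  simp only [dist_eq_norm, hsplit, NNReal.coe_add, NNReal.coe_one, one_mul] at hc ⊢
  calc _ ≤ ‖(cutoff n x : ℂ) * (w x - w y)‖ + ‖((cutoff n x - cutoff n y : ℝ) : ℂ) * w y‖ :=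
        norm_add_le _ _
    _ ≤ 1 * (L * ‖x - y‖) + ‖x - y‖ * 1 := by
        rw [norm_mul, norm_mul, Complex.norm_real, Complex.norm_real,
          Real.norm_of_nonneg (cutoff_nonneg n x)]
        gcongr
        exacts [cutoff_le_one n x, hw y]
    _ = (L + 1) * ‖x - y‖ := by ring

end Cutoff

lemma lintegral_bessel_mul_ft_mul_le {E : Type*} [NormedAddCommGroup E] [InnerProductSpace ℝ E]
    [FiniteDimensional ℝ E] [MeasurableSpace E] [BorelSpace E] [Nontrivial E]
    (hE : Module.finrank ℝ E < 4) {f w : E → ℂ} {L : ℝ≥0} (hf1 : Integrable f)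
    (hf2 : MemLp f 2 volume) (hw : ∀ x, ‖w x‖ ≤ 1) (hL : LipschitzWith L w) :
    ∫⁻ ζ, ENNReal.ofReal (bessel ζ) * ‖ft (fun x => w x * f x) ζ‖ₑ ^ 2
      ≤ 2 * Module.finrank ℝ E * (1 + (L + 1) ^ 2) * hDotNegOneSq f := by
  set W : ℕ → E → ℂ := fun n x => (cutoff n x : ℂ) * w x
  have hWc (n : ℕ) : Continuous (W n) := (lipschitzWith_cutoff_mul hw hL n).continuous
  have hWf (n : ℕ) : Integrable (fun x => W n x * f x) :=
    hf1.bdd_mul (hWc n).aestronglyMeasurable (Eventually.of_forall (norm_cutoff_mul_le hw n))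
  refine lintegral_le_of_tendsto_of_le (l := atTop)
    (F := fun n ζ => ENNReal.ofReal (bessel ζ) * ‖ft (fun x => W n x * f x) ζ‖ₑ ^ 2)
    (fun n => ?_) (fun ζ => ?_) fun n => ?_
  · have := continuous_ft (hWf n)
    fun_prop
  · refine ENNReal.Tendsto.const_mul (ENNReal.Tendsto.pow (Tendsto.enorm ?_))
      (Or.inr (by finiteness))
    refine tendsto_integral_of_dominated_convergence (fun x => ‖f x‖)
      (fun n => (integrable_chr_mul (hWf n) ζ).aestronglyMeasurable) hf1.norm
      (fun n => Eventually.of_forall fun x => ?_) (Eventually.of_forall fun x => ?_)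
    · rw [norm_mul, norm_mul, norm_chr, one_mul]
      exact mul_le_of_le_one_left (norm_nonneg _) (norm_cutoff_mul_le hw n x)
    · have hone := (Complex.continuous_ofReal.tendsto 1).comp (tendsto_cutoff x)
      simpa using ((hone.mul_const (w x)).mul_const (f x)).const_mul (chr x ζ)
  · have hWi : Integrable (W n) :=
      (hWc n).integrable_of_hasCompactSupport
        ((hasCompactSupport_cutoff n).comp_left (g := ((↑) : ℝ → ℂ)) (by simp)).mul_right
    simpa using lintegral_bessel_mul_ft_mul_le_of_integrable hE hf1 hf2 hWi
      (norm_cutoff_mul_le hw n) (lipschitzWith_cutoff_mul hw hL n)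

/-! ### Integrals against signed measures -/

section SignedMeasure

variable {X F : Type*} [MeasurableSpace X] [NormedAddCommGroup F] [NormedSpace ℝ F]

instance isFiniteMeasure_variation (σ : SignedMeasure X) : IsFiniteMeasure σ.variation := by
  rw [← SignedMeasure.totalVariation_eq_variation]
  infer_instance

lemma integrable_variation_withDensityᵥ {ν : Measure X} {f : X → ℝ} {φ : X → F}
    (hf : Integrable f ν) (h : Integrable (fun x => f x • φ x) ν)
    (hφ : AEStronglyMeasurable φ ν) : Integrable φ (ν.withDensityᵥ f).variation := by
  have hm := hf.aestronglyMeasurable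
  rw [Measure.variation_withDensityᵥ hf,
    integrable_withDensity_iff_integrable_smul₀' (by fun_prop) (by simp)]
  refine h.congr' (AEStronglyMeasurable.smul ?_ hφ) (Eventually.of_forall fun x => ?_)
  · simpa only [toReal_enorm] using hm.norm
  · simp [norm_smul]

lemma integrable_toReal_ofReal_smul {ν : Measure X} {f : X → ℝ} {φ : X → F}
    (hf : AEStronglyMeasurable f ν) (h : Integrable (fun x => f x • φ x) ν)
    (hφ : AEStronglyMeasurable φ ν) :
    Integrable (fun x => (ENNReal.ofReal (f x)).toReal • φ x) ν := by
  refine h.mono (AEStronglyMeasurable.smul ?_ hφ) (Eventually.of_forall fun x => ?_)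
  · exact (AEMeasurable.ennreal_toReal (by fun_prop)).aestronglyMeasurable
  rw [norm_smul, norm_smul, Real.norm_of_nonneg ENNReal.toReal_nonneg, ENNReal.toReal_ofReal']
  gcongr
  exact max_le (le_abs_self _) (abs_nonneg _)

lemma integral_withDensityᵥ {ν : Measure X} {f : X → ℝ} {φ : X → F}
    (hf : Integrable f ν) (h : Integrable (fun x => f x • φ x) ν)
    (hφ : AEStronglyMeasurable φ ν) :
    ∫ᵛ x, φ x ∂<•(ν.withDensityᵥ f) = ∫ x, f x • φ x ∂ν := by
  have := isFiniteMeasure_withDensity_ofReal hf.2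
  have := isFiniteMeasure_withDensity_ofReal hf.neg.2
  have hm := hf.aestronglyMeasurable
  have hpos := integrable_toReal_ofReal_smul hm h hφ
  have hneg := integrable_toReal_ofReal_smul (f := fun x => -f x) hm.neg
    (h.neg.congr (Eventually.of_forall fun x => (neg_smul _ _).symm)) hφ
  rw [withDensityᵥ_eq_withDensity_pos_part_sub_withDensity_neg_part hf,
    VectorMeasure.integral_sub_vectorMeasure, VectorMeasure.integral_toSignedMeasure,
    VectorMeasure.integral_toSignedMeasure,
    integral_withDensity_eq_integral_toReal_smul₀ (by fun_prop) (by simp),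
    integral_withDensity_eq_integral_toReal_smul₀ (by fun_prop) (by simp), ← integral_sub hpos hneg]
  · congr 1 with x
    rw [← sub_smul, ENNReal.toReal_ofReal', ENNReal.toReal_ofReal']
    congr 1
    rcases le_total (f x) 0 with h0 | h0 <;> simp [h0]
  all_goals
    rw [VectorMeasure.Integrable, Measure.variation_toSignedMeasure,
      integrable_withDensity_iff_integrable_smul₀' (by fun_prop) (by simp)]
    assumption

omit [NormedSpace ℝ F] in
lemma integrable_variation_dirac [MeasurableSingletonClass X] (φ : X → F) (x : X) (c : ℝ) :
    Integrable φ (VectorMeasure.dirac x c).variation := by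
  rw [VectorMeasure.variation_dirac]
  exact (integrable_dirac (by finiteness)).smul_measure (by finiteness)

lemma integral_sum_dirac [MeasurableSingletonClass X] [CompleteSpace F] (φ : X → F) {ι : Type*}
    (s : Finset ι) (x : ι → X) :
    ∫ᵛ z, φ z ∂<•(∑ i ∈ s, VectorMeasure.dirac (x i) (1 : ℝ)) = ∑ i ∈ s, φ (x i) := by
  rw [VectorMeasure.integral_finsetSum_vectorMeasure
    fun i _ => integrable_variation_dirac φ (x i) 1]
  simp [VectorMeasure.integral_dirac]

end SignedMeasure

section FourierMeasure

variable {E : Type*} [NormedAddCommGroup E] [InnerProductSpace ℝ E] [MeasurableSpace E]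
  [BorelSpace E]

lemma aestronglyMeasurable_chr (ν : Measure E) (ζ : E) :
    AEStronglyMeasurable (fun x => chr x ζ) ν :=
  (by fun_prop : Continuous fun x => chr x ζ).aestronglyMeasurable

lemma integrable_chr_variation (σ : SignedMeasure E) (ζ : E) :
    σ.Integrable (fun x => chr x ζ) :=
  Integrable.of_bound (aestronglyMeasurable_chr _ ζ) 1 (Eventually.of_forall fun x => by simp)

lemma fourierMeasure_sub (σ τ : SignedMeasure E) (ζ : E) :
    fourierMeasure (σ - τ) ζ = fourierMeasure σ ζ - fourierMeasure τ ζ :=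
  VectorMeasure.integral_sub_vectorMeasure (integrable_chr_variation σ ζ)
    (integrable_chr_variation τ ζ)

/-- The Fourier transform of the empirical measure of the points `x i`. -/
def empFt {N : ℕ} (x : Fin N → E) (ζ : E) : ℂ := (1 / (N : ℝ)) • ∑ i, chr (x i) ζ

lemma fourierMeasure_empirical {N : ℕ} (x : Fin N → E) :
    fourierMeasure (empirical x) = empFt x := by
  ext ζ
  rw [fourierMeasure, empirical, VectorMeasure.integral_smul_vectorMeasure, integral_sum_dirac,
    empFt]
  rfl

/-- The Fourier transform of a real-valued function. -/
def rft (f : Plane → ℝ) : Plane → ℂ := ft fun x => (f x : ℂ)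

lemma fourierMeasure_density {f : Plane → ℝ} (hf : Integrable f) :
    fourierMeasure (density f) = rft f := by
  ext ζ
  have hfchr : Integrable (fun x => f x • chr x ζ) :=
    (integrable_chr_mul hf.ofReal ζ).congr (Eventually.of_forall fun x => by simp [mul_comm])
  refine (integral_withDensityᵥ hf hfchr (aestronglyMeasurable_chr _ ζ)).trans ?_
  simp only [rft, ft, Complex.real_smul, mul_comm]

/-- The map `x ↦ (x, v x)` into the phase space. -/
def graphMap (v : Plane → Plane) (x : Plane) : Phase := WithLp.toLp 2 (x, v x)

@[fun_prop] lemma continuous_graphMap {v : Plane → Plane} (hv : Continuous v) :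
    Continuous (graphMap v) := by
  unfold graphMap; fun_prop

/-- The Fourier transform of the measure `u ⊗ δ_{ξ = v(x)}` on the phase space. -/
def graphFt (v : Plane → Plane) (u : Plane → ℝ) (ζ : Phase) : ℂ := ∫ x, chr (graphMap v x) ζ * u x

lemma fourierMeasure_monokinetic {ρ : Plane → ℝ} (hρ : Integrable ρ) {v : Plane → Plane}
    (hv : Continuous v) : fourierMeasure (monokinetic ρ v) = graphFt v ρ := by
  ext ζ
  have hgraph := continuous_graphMap hv
  have hchr : Continuous fun x => chr (graphMap v x) ζ := by fun_prop
  have hρchr : Integrable (fun x => ρ x • chr (graphMap v x) ζ) :=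
    hρ.smul_bdd 1 hchr.aestronglyMeasurable (Eventually.of_forall fun x => by simp)
  calc fourierMeasure (monokinetic ρ v) ζ = ∫ᵛ x, chr (graphMap v x) ζ ∂<•(density ρ) :=
        VectorMeasure.integral_map hgraph.measurable (aestronglyMeasurable_chr _ ζ)
          (Integrable.of_bound hchr.aestronglyMeasurable 1
            (Eventually.of_forall fun x => (norm_chr _ _).le))
    _ = ∫ x, ρ x • chr (graphMap v x) ζ :=
        integral_withDensityᵥ hρ hρchr hchr.aestronglyMeasurable
    _ = _ := by simp only [graphFt, Complex.real_smul, mul_comm]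

end FourierMeasure

/-! ### The off-diagonal energy -/

lemma prod_density_sub_empirical {f : Plane → ℝ} (hf : Integrable f) {N : ℕ} (x : Fin N → Plane) :
    (density f - empirical x).prod (density f - empirical x) (ContinuousLinearMap.mul ℝ ℝ)
      = ((volume : Measure (Plane × Plane)).withDensityᵥ (fun z => f z.1 * f z.2)
          - (1 / (N : ℝ)) • ∑ i, ((density f).map (fun y => (y, x i))
              + (density f).map (fun y => (x i, y))))
        + (1 / (N : ℝ) ^ 2) • ∑ p : Fin N × Fin N, VectorMeasure.dirac (x p.1, x p.2) (1 : ℝ) := by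
  refine VectorMeasure.prod_eq_of_forall_apply_prod fun s t hs ht => ?_
  have hff : Integrable (fun z : Plane × Plane => f z.1 * f z.2) := hf.mul_prod hf
  have hst := hs.prod ht
  have hdens : (volume : Measure (Plane × Plane)).withDensityᵥ (fun z => f z.1 * f z.2) (s ×ˢ t)
      = density f s * density f t := by
    rw [withDensityᵥ_apply hff hst, density, withDensityᵥ_apply hf hs, withDensityᵥ_apply hf ht,
      Measure.volume_eq_prod, setIntegral_prod_mul]
  have hleft (i) : (density f).map (fun y => (y, x i)) (s ×ˢ t)
      = density f s * VectorMeasure.dirac (x i) (1 : ℝ) t := by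
    rw [VectorMeasure.map_apply _ (by fun_prop) hst]
    by_cases h : x i ∈ t <;> simp [h, ht]
  have hright (i) : (density f).map (fun y => (x i, y)) (s ×ˢ t)
      = VectorMeasure.dirac (x i) (1 : ℝ) s * density f t := by
    rw [VectorMeasure.map_apply _ (by fun_prop) hst]
    by_cases h : x i ∈ s <;> simp [h, hs]
  have hdirac (i j) : VectorMeasure.dirac (x i, x j) (1 : ℝ) (s ×ˢ t)
      = VectorMeasure.dirac (x i) (1 : ℝ) s * VectorMeasure.dirac (x j) (1 : ℝ) t := by
    by_cases h : x i ∈ s <;> by_cases h' : x j ∈ t <;> simp [h, h', hs, ht, hst]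
  simp only [empirical, _root_.sub_apply, _root_.add_apply, _root_.smul_apply,
    FunLike.coe_sum, Finset.sum_apply, Fintype.sum_prod_type, hdens, hleft, hright, hdirac,
    Finset.sum_add_distrib, ← Finset.mul_sum, ← Finset.sum_mul]
  simp only [ContinuousLinearMap.mul_apply', smul_eq_mul]
  ring

section SymmetricKernel

variable {K : Plane × Plane → ℝ} {f : Plane → ℝ}

lemma integral_map_prodMk_add_map_prodMk (hK : Measurable K) (hsymm : ∀ z, K z.swap = K z)
    (hf : Integrable f) {x : Plane} (hfx : Integrable (fun y => f y * K (y, x))) :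
    ((density f).map (fun y => (y, x)) + (density f).map (fun y => (x, y))).Integrable K ∧
      ∫ᵛ z, K z ∂<•((density f).map (fun y => (y, x)) + (density f).map (fun y => (x, y)))
        = 2 * ∫ y, f y * K (y, x) := by
  have hmeas : AEStronglyMeasurable (fun y => K (y, x)) (volume : Measure Plane) :=
    (hK.comp (by fun_prop)).aestronglyMeasurable
  have hint : (density f).Integrable fun y => K (y, x) :=
    integrable_variation_withDensityᵥ hf hfx hmeas
  have hswap : (fun y => K (x, y)) = fun y => K (y, x) := funext fun y => (hsymm (x, y)).symm
  have hint' : (density f).Integrable fun y => K (x, y) := hswap ▸ hint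
  have hleft : ((density f).map (fun y => (y, x))).Integrable K :=
    VectorMeasure.Integrable.map hK.aestronglyMeasurable hint
  have hright : ((density f).map (fun y => (x, y))).Integrable K :=
    VectorMeasure.Integrable.map hK.aestronglyMeasurable hint'
  have hval : ∫ᵛ y, K (y, x) ∂<•(density f) = ∫ y, f y * K (y, x) :=
    integral_withDensityᵥ hf hfx hmeas
  refine ⟨hleft.add_vectorMeasure hright, ?_⟩
  rw [VectorMeasure.integral_add_vectorMeasure hleft hright,
    VectorMeasure.integral_map (by fun_prop) hK.aestronglyMeasurable hint,
    VectorMeasure.integral_map (by fun_prop) hK.aestronglyMeasurable hint', hswap, hval, two_mul]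

lemma integral_prod_density_sub_empirical (hK : Measurable K) (hsymm : ∀ z, K z.swap = K z)
    (hf : Integrable f) (hff : Integrable (fun z : Plane × Plane => f z.1 * f z.2 * K z))
    {N : ℕ} (x : Fin N → Plane) (hfx : ∀ i, Integrable (fun y => f y * K (y, x i))) :
    ∫ᵛ z, K z ∂<•((density f - empirical x).prod (density f - empirical x)
        (ContinuousLinearMap.mul ℝ ℝ))
      = (∫ z : Plane × Plane, f z.1 * f z.2 * K z)
        - 2 / (N : ℝ) * (∑ i, ∫ y, f y * K (y, x i))
        + 1 / (N : ℝ) ^ 2 * ∑ p : Fin N × Fin N, K (x p.1, x p.2) := by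
  have hKm : AEStronglyMeasurable K (volume : Measure (Plane × Plane)) := hK.aestronglyMeasurable
  have hdens : ((volume : Measure (Plane × Plane)).withDensityᵥ fun z => f z.1 * f z.2).Integrable
      K := integrable_variation_withDensityᵥ (hf.mul_prod hf) hff hKm
  have hcross (i) := integral_map_prodMk_add_map_prodMk hK hsymm hf (hfx i)
  have hcross' := VectorMeasure.Integrable.smul_vectorMeasure
    (VectorMeasure.Integrable.finsetSum_vectorMeasure
      fun i (_ : i ∈ Finset.univ) => (hcross i).1) (1 / (N : ℝ))
  have hdirac (p : Fin N × Fin N) : (VectorMeasure.dirac (x p.1, x p.2) (1 : ℝ)).Integrable K :=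
    integrable_variation_dirac K _ 1
  have hdirac' := VectorMeasure.Integrable.smul_vectorMeasure
    (VectorMeasure.Integrable.finsetSum_vectorMeasure
      fun p (_ : p ∈ Finset.univ) => hdirac p) (1 / (N : ℝ) ^ 2)
  have hself : ∫ᵛ z, K z ∂<•((volume : Measure (Plane × Plane)).withDensityᵥ
      fun z => f z.1 * f z.2) = ∫ z : Plane × Plane, f z.1 * f z.2 * K z :=
    integral_withDensityᵥ (hf.mul_prod hf) hff hKm
  rw [prod_density_sub_empirical hf, VectorMeasure.integral_add_vectorMeasure
      (VectorMeasure.Integrable.sub_vectorMeasure hdens hcross') hdirac',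
    VectorMeasure.integral_sub_vectorMeasure hdens hcross',
    VectorMeasure.integral_smul_vectorMeasure, VectorMeasure.integral_smul_vectorMeasure,
    VectorMeasure.integral_finsetSum_vectorMeasure fun i _ => (hcross i).1, integral_sum_dirac,
    hself]
  simp only [hcross, ← Finset.mul_sum, smul_eq_mul]
  ring

end SymmetricKernel

/-- The self-energy `∬ k(x - y) f(x) f(y) dx dy` of `f` for the pair interaction `k`. -/
def selfEnergy (k f : Plane → ℝ) : ℝ := ∫ z : Plane × Plane, f z.1 * f z.2 * k (z.1 - z.2)

/-- The potential at `y` generated by `f` through the pair interaction `k`. -/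
def potential (k f : Plane → ℝ) (y : Plane) : ℝ := ∫ z, f z * k (z - y)

/-- The energy `∬ k(x - y) (f - μ_N)(dx) (f - μ_N)(dy)`, diagonal included, where `μ_N` is the
empirical measure of the points `x i` and `k` is an even kernel. -/
def pairEnergy (k f : Plane → ℝ) {N : ℕ} (x : Fin N → Plane) : ℝ :=
  selfEnergy k f - 2 / (N : ℝ) * ∑ i, potential k f (x i)
    + 1 / (N : ℝ) ^ 2 * ∑ p : Fin N × Fin N, k (x p.1 - x p.2)

lemma coulomb_zero : coulomb 0 = 0 := by simp [coulomb]

lemma coulomb_neg (x : Plane) : coulomb (-x) = coulomb x := by simp [coulomb]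

lemma measurable_coulomb : Measurable coulomb := by unfold coulomb; fun_prop

lemma offDiagEnergy_density_sub_empirical {f : Plane → ℝ} (hf : Integrable f)
    (hff : Integrable (fun z : Plane × Plane => f z.1 * f z.2 * coulomb (z.1 - z.2)))
    (hfx : ∀ y, Integrable (fun z => f z * coulomb (z - y))) {N : ℕ} (x : Fin N → Plane) :
    offDiagEnergy (density f - empirical x) = pairEnergy coulomb f x := by
  have hdiag : (Set.diagonal Plane)ᶜ.indicator (fun z => coulomb (z.1 - z.2))
      = fun z => coulomb (z.1 - z.2) := by
    rw [Set.indicator_eq_self]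
    rintro z hz (hzd : z.1 = z.2)
    exact hz (by simp [hzd, coulomb_zero])
  have hsymm (z : Plane × Plane) : coulomb (z.swap.1 - z.swap.2) = coulomb (z.1 - z.2) := by
    rw [← coulomb_neg, neg_sub, Prod.fst_swap, Prod.snd_swap]
  have hmeas : Measurable fun z : Plane × Plane => coulomb (z.1 - z.2) :=
    measurable_coulomb.comp (by fun_prop)
  rw [offDiagEnergy, ← VectorMeasure.integral_indicator measurableSet_diagonal.compl, hdiag]
  exact integral_prod_density_sub_empirical hmeas hsymm hf hff x fun i => hfx (x i)

/-! ### Densities and the Coulomb kernel -/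

lemma IsDensity.integrable {f : Plane → ℝ} (hf : IsDensity f) : Integrable f :=
  memLp_one_iff_integrable.1 hf.memLp_one

lemma ae_norm_le_normLinf {F : Type*} [NormedAddCommGroup F] {f : Plane → F}
    (hf : MemLp f ∞ volume) : ∀ᵐ x, ‖f x‖ ≤ normLinf f := by
  filter_upwards [enorm_ae_le_eLpNormEssSup f volume] with x hx
  rw [← toReal_enorm]
  exact ENNReal.toReal_mono hf.2.ne (by simpa using hx)

lemma normLinf_nonneg {F : Type*} [NormedAddCommGroup F] (f : Plane → F) : 0 ≤ normLinf f :=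
  ENNReal.toReal_nonneg

lemma IsDensity.integrable_norm_mul {f : Plane → ℝ} (hf : IsDensity f) :
    Integrable (fun x => ‖x‖ * f x) := by
  obtain ⟨R, hR⟩ := hf.compact.isCompact.isBounded.exists_norm_le
  refine (hf.integrable.norm.const_mul R).mono'
    (continuous_norm.aestronglyMeasurable.mul hf.integrable.aestronglyMeasurable)
    (Eventually.of_forall fun x => ?_)
  by_cases hx : f x = 0
  · simp [hx]
  · rw [norm_mul, norm_norm]
    gcongr
    exact hR x (subset_tsupport _ hx)

/-- The singular part `1_{|x| < 1} ln |x|` of the logarithm. -/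
def logNear : Plane → ℝ := (Metric.ball 0 1).indicator fun x => Real.log ‖x‖

lemma integrable_logNear : Integrable logNear := by
  have hm : Measurable fun x : Plane => Real.log ‖x‖ := by fun_prop
  refine (integrable_indicator_iff Metric.isOpen_ball.measurableSet).2 ?_
  refine integrableOn_ball_of_norm_le_rpow (C := 1) (α := 1) (by simp) (by simp) ?_
    hm.aestronglyMeasurable
  filter_upwards [ae_restrict_mem Metric.isOpen_ball.measurableSet] with x hx
  have hx1 : ‖x‖ < 1 := by simpa using hx
  rcases eq_or_ne x 0 with rfl | h0
  · simp
  have hpos : 0 < ‖x‖ := norm_pos_iff.2 h0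
  rw [Real.norm_eq_abs, abs_of_nonpos (Real.log_nonpos hpos.le hx1.le), one_mul,
    Real.rpow_neg_one, ← Real.log_inv]
  exact (Real.log_le_sub_one_of_pos (by positivity)).trans (by linarith)

lemma abs_log_norm_le (x : Plane) : |Real.log ‖x‖| ≤ |logNear x| + ‖x‖ := by
  by_cases hx : x ∈ Metric.ball (0 : Plane) 1
  · rw [logNear, Set.indicator_of_mem hx]
    linarith [norm_nonneg x]
  · rw [logNear, Set.indicator_of_notMem hx]
    have h1 : 1 ≤ ‖x‖ := by simpa using hx
    rw [abs_of_nonneg (Real.log_nonneg h1), abs_zero, zero_add]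
    exact (Real.log_le_sub_one_of_pos (by positivity)).trans (by linarith)

lemma abs_coulomb_le (x : Plane) : |coulomb x| ≤ |logNear x| + ‖x‖ := by
  have hpi : |-(1 / (2 * Real.pi))| ≤ 1 := by
    rw [abs_neg, abs_of_pos (by positivity)]
    exact div_le_one_of_le₀ (by linarith [Real.pi_gt_three]) (by positivity)
  rw [coulomb, abs_mul]
  exact (mul_le_of_le_one_left (abs_nonneg _) hpi).trans (abs_log_norm_le x)

lemma abs_coulomb_sub_le (x y : Plane) : |coulomb (x - y)| ≤ |logNear (x - y)| + (‖x‖ + ‖y‖) :=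
  (abs_coulomb_le _).trans (by gcongr; exact norm_sub_le x y)

lemma IsDensity.integrable_mul_coulomb {f : Plane → ℝ} (hf : IsDensity f) (y : Plane) :
    Integrable (fun x => f x * coulomb (x - y)) := by
  have hdom : Integrable
      (fun x => normLinf f * |logNear (x - y)| + (|‖x‖ * f x| + ‖y‖ * |f x|)) :=
    ((integrable_logNear.comp_sub_right y).abs.const_mul _).add
      (hf.integrable_norm_mul.abs.add (hf.integrable.abs.const_mul _))
  refine hdom.mono' (hf.integrable.aestronglyMeasurable.mul
    (measurable_coulomb.comp (by fun_prop)).aestronglyMeasurable) ?_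
  filter_upwards [ae_norm_le_normLinf hf.memLp_top] with x hx
  rw [Real.norm_eq_abs] at hx
  rw [norm_mul, Real.norm_eq_abs, Real.norm_eq_abs, abs_mul, abs_norm]
  calc |f x| * |coulomb (x - y)| ≤ |f x| * (|logNear (x - y)| + (‖x‖ + ‖y‖)) := by
        gcongr; exact abs_coulomb_sub_le x y
    _ = |f x| * |logNear (x - y)| + (‖x‖ * |f x| + ‖y‖ * |f x|) := by ring
    _ ≤ _ := by gcongr

lemma IsDensity.integrable_mul_mul_coulomb {f : Plane → ℝ} (hf : IsDensity f) :
    Integrable (fun z : Plane × Plane => f z.1 * f z.2 * coulomb (z.1 - z.2)) := by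
  have hconv : Integrable (fun z : Plane × Plane => f z.2 * logNear (z.1 - z.2)) :=
    hf.integrable.convolution_integrand (ContinuousLinearMap.mul ℝ ℝ) integrable_logNear
  have hdom : Integrable (fun z : Plane × Plane => normLinf f * |f z.2 * logNear (z.1 - z.2)|
      + (|(‖z.1‖ * f z.1) * f z.2| + |f z.1 * (‖z.2‖ * f z.2)|)) :=
    (hconv.abs.const_mul _).add ((hf.integrable_norm_mul.mul_prod hf.integrable).abs.add
      (hf.integrable.mul_prod hf.integrable_norm_mul).abs)
  refine hdom.mono' ((hf.integrable.mul_prod hf.integrable).aestronglyMeasurable.mul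
    (measurable_coulomb.comp (by fun_prop)).aestronglyMeasurable) ?_
  have hbound : ∀ᵐ z : Plane × Plane, ‖f z.1‖ ≤ normLinf f :=
    Measure.quasiMeasurePreserving_fst.ae (ae_norm_le_normLinf hf.memLp_top)
  filter_upwards [hbound] with z hz
  rw [Real.norm_eq_abs] at hz
  simp only [norm_mul, Real.norm_eq_abs, abs_mul, abs_norm]
  calc |f z.1| * |f z.2| * |coulomb (z.1 - z.2)|
      ≤ |f z.1| * |f z.2| * (|logNear (z.1 - z.2)| + (‖z.1‖ + ‖z.2‖)) := by
        gcongr; exact abs_coulomb_sub_le _ _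
    _ = |f z.1| * (|f z.2| * |logNear (z.1 - z.2)|)
        + (‖z.1‖ * |f z.1| * |f z.2| + |f z.1| * (‖z.2‖ * |f z.2|)) := by ring
    _ ≤ _ := by gcongr

/-! ### The Coulomb kernel as a superposition of Gaussians -/

lemma norm_exp_sub_exp_le (a : ℝ) {t : ℝ} (ht : 0 < t) :
    ‖t⁻¹ * (Real.exp (-(a * t)) - Real.exp (-t))‖ ≤ |a - 1| * Real.exp (-(min a 1 * t)) := by
  rw [norm_mul, norm_inv, Real.norm_of_nonneg ht.le, Real.norm_eq_abs, inv_mul_le_iff₀ ht]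
  have key {b c : ℝ} (hbc : b ≤ c) :
      |Real.exp (-(b * t)) - Real.exp (-(c * t))| ≤ t * ((c - b) * Real.exp (-(b * t))) := by
    have hmono : Real.exp (-(c * t)) ≤ Real.exp (-(b * t)) := by gcongr
    have hsplit : Real.exp (-(c * t)) = Real.exp (-(b * t)) * Real.exp (-((c - b) * t)) := by
      rw [← Real.exp_add]; ring_nf
    have hlin := mul_le_mul_of_nonneg_left (Real.add_one_le_exp (-((c - b) * t)))
      (Real.exp_pos (-(b * t))).le
    rw [abs_of_nonneg (sub_nonneg.2 hmono)]
    linarith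
  rcases le_total a 1 with h | h
  · rw [min_eq_left h, abs_sub_comm a, abs_of_nonneg (sub_nonneg.2 h)]
    simpa only [one_mul] using key h
  · rw [min_eq_right h, abs_of_nonneg (sub_nonneg.2 h), abs_sub_comm]
    simpa only [one_mul] using key h

lemma integrableOn_exp_sub_exp {a : ℝ} (ha : 0 < a) :
    IntegrableOn (fun t => t⁻¹ * (Real.exp (-(a * t)) - Real.exp (-t))) (Set.Ioi 0) := by
  refine Integrable.mono' ((exp_neg_integrableOn_Ioi 0 (lt_min ha one_pos)).const_mul |a - 1|)
    (by fun_prop : Measurable _).aestronglyMeasurable ?_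
  filter_upwards [ae_restrict_mem measurableSet_Ioi] with t ht
  simpa only [neg_mul] using norm_exp_sub_exp_le a ht

lemma integral_exp_sub_exp {a : ℝ} (ha : 0 < a) :
    ∫ t in Set.Ioi 0, t⁻¹ * (Real.exp (-(a * t)) - Real.exp (-t)) = -Real.log a := by
  have hcont : Continuous fun t : ℝ => Real.exp (-t) := by fun_prop
  have hzero : Tendsto (fun t : ℝ => Real.exp (-t)) (𝓝[>] 0) (𝓝 1) := by
    simpa using (hcont.tendsto 0).mono_left nhdsWithin_le_nhds
  have h := Frullani.integral_Ioi_eq (hcont.locallyIntegrable.locallyIntegrableOn _) ha one_pos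
    hzero Real.tendsto_exp_neg_atTop_nhds_zero (by simpa using integrableOn_exp_sub_exp ha)
  simpa [Real.log_inv] using h

lemma integral_norm_exp_sub_exp {a : ℝ} (ha : 0 < a) :
    ∫ t in Set.Ioi 0, ‖t⁻¹ * (Real.exp (-(a * t)) - Real.exp (-t))‖ = |Real.log a| := by
  rcases le_total a 1 with h | h
  · rw [abs_of_nonpos (Real.log_nonpos ha.le h), ← integral_exp_sub_exp ha]
    refine setIntegral_congr_fun measurableSet_Ioi fun t (ht : 0 < t) => Real.norm_of_nonneg ?_
    refine mul_nonneg (by positivity) (sub_nonneg.2 (Real.exp_le_exp.2 ?_))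
    nlinarith
  · rw [abs_of_nonneg (Real.log_nonneg h), ← neg_neg (Real.log a), ← integral_exp_sub_exp ha,
      ← integral_neg]
    refine setIntegral_congr_fun measurableSet_Ioi fun t (ht : 0 < t) => Real.norm_of_nonpos ?_
    refine mul_nonpos_of_nonneg_of_nonpos (by positivity) (sub_nonpos.2 (Real.exp_le_exp.2 ?_))
    nlinarith

/-- The Gaussian kernel `exp (-t |z|²)`. -/
def gauss (t : ℝ) (z : Plane) : ℝ := Real.exp (-(‖z‖ ^ 2 * t))

lemma measurable_uncurry_gauss : Measurable fun p : Plane × ℝ => gauss p.2 p.1 := by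
  unfold gauss; fun_prop

@[fun_prop] lemma continuous_gauss (t : ℝ) : Continuous (gauss t) := by unfold gauss; fun_prop

lemma gauss_pos (t : ℝ) (z : Plane) : 0 < gauss t z := Real.exp_pos _

lemma norm_gauss_le_one {t : ℝ} (ht : 0 < t) (z : Plane) : ‖gauss t z‖ ≤ 1 := by
  rw [Real.norm_of_nonneg (gauss_pos t z).le, gauss, Real.exp_le_one_iff, neg_nonpos]
  positivity

/-- The density in `t > 0` of the decomposition of `4π g` into Gaussians; the value at the origin is
set to `0`, in agreement with `ln 0 = 0`. -/
def coulombSlice (t : ℝ) (z : Plane) : ℝ := if z = 0 then 0 else t⁻¹ * (gauss t z - Real.exp (-t))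

lemma coulombSlice_of_ne {z : Plane} (hz : z ≠ 0) (t : ℝ) :
    coulombSlice t z = t⁻¹ * (gauss t z - Real.exp (-t)) := if_neg hz

lemma measurable_uncurry_coulombSlice : Measurable fun p : Plane × ℝ => coulombSlice p.2 p.1 :=
  Measurable.ite (measurableSet_eq_fun measurable_fst measurable_const) measurable_const
    (measurable_snd.inv.mul (measurable_uncurry_gauss.sub (by fun_prop)))

lemma four_pi_mul_coulomb (z : Plane) : 4 * Real.pi * coulomb z = -Real.log (‖z‖ ^ 2) := by
  rw [coulomb, Real.log_pow]
  push_cast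
  field_simp
  ring

lemma integrableOn_coulombSlice (z : Plane) :
    IntegrableOn (fun t => coulombSlice t z) (Set.Ioi 0) := by
  rcases eq_or_ne z 0 with rfl | hz
  · simp [coulombSlice]
  · simp only [coulombSlice_of_ne hz]
    exact integrableOn_exp_sub_exp (pow_pos (norm_pos_iff.2 hz) 2)

lemma integral_coulombSlice (z : Plane) :
    ∫ t in Set.Ioi 0, coulombSlice t z = 4 * Real.pi * coulomb z := by
  rcases eq_or_ne z 0 with rfl | hz
  · simp [coulombSlice, coulomb_zero]
  · simp only [coulombSlice_of_ne hz]
    rw [four_pi_mul_coulomb]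
    exact integral_exp_sub_exp (pow_pos (norm_pos_iff.2 hz) 2)

lemma integral_norm_coulombSlice (z : Plane) :
    ∫ t in Set.Ioi 0, ‖coulombSlice t z‖ = 4 * Real.pi * ‖coulomb z‖ := by
  rcases eq_or_ne z 0 with rfl | hz
  · simp [coulombSlice, coulomb_zero]
  · simp only [coulombSlice_of_ne hz]
    rw [← Real.norm_of_nonneg (by positivity : 0 ≤ 4 * Real.pi), ← norm_mul, four_pi_mul_coulomb,
      norm_neg, Real.norm_eq_abs (Real.log _)]
    exact integral_norm_exp_sub_exp (pow_pos (norm_pos_iff.2 hz) 2)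

section Superposition

variable {X : Type*} [MeasurableSpace X] {ν : Measure X} {H : X → ℝ} {r : X → Plane}

lemma integrable_uncurry_mul_coulombSlice (hH : AEStronglyMeasurable H ν) (hr : Measurable r)
    (hint : Integrable (fun z => H z * coulomb (r z)) ν) :
    Integrable (fun p : X × ℝ => H p.1 * coulombSlice p.2 (r p.1))
      (ν.prod (volume.restrict (Set.Ioi 0))) := by
  have hmeas : Measurable fun p : X × ℝ => coulombSlice p.2 (r p.1) :=
    measurable_uncurry_coulombSlice.comp ((hr.comp measurable_fst).prodMk measurable_snd)
  refine (integrable_prod_iff (hH.comp_fst.mul hmeas.aestronglyMeasurable)).2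
    ⟨Eventually.of_forall fun z => (integrableOn_coulombSlice (r z)).const_mul (H z), ?_⟩
  refine (hint.norm.const_mul (4 * Real.pi)).congr (Eventually.of_forall fun z => ?_)
  simp only [Pi.mul_apply, norm_mul, integral_const_mul, integral_norm_coulombSlice]
  ring

lemma integrableOn_integral_mul_coulombSlice [SFinite ν] (hH : AEStronglyMeasurable H ν)
    (hr : Measurable r) (hint : Integrable (fun z => H z * coulomb (r z)) ν) :
    IntegrableOn (fun t => ∫ z, H z * coulombSlice t (r z) ∂ν) (Set.Ioi 0) :=
  (integrable_uncurry_mul_coulombSlice hH hr hint).integral_prod_right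

lemma integral_integral_mul_coulombSlice [SFinite ν] (hH : AEStronglyMeasurable H ν)
    (hr : Measurable r) (hint : Integrable (fun z => H z * coulomb (r z)) ν) :
    ∫ t in Set.Ioi 0, ∫ z, H z * coulombSlice t (r z) ∂ν
      = 4 * Real.pi * ∫ z, H z * coulomb (r z) ∂ν := by
  rw [← integral_integral_swap (integrable_uncurry_mul_coulombSlice hH hr hint),
    ← integral_const_mul]
  congr 1 with z
  rw [integral_const_mul, integral_coulombSlice]
  ring

lemma integral_mul_coulombSlice (hH : Integrable H ν) (hr : AEStronglyMeasurable r ν)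
    (hr0 : ∀ᵐ z ∂ν, r z ≠ 0) {t : ℝ} (ht : 0 < t) :
    ∫ z, H z * coulombSlice t (r z) ∂ν
      = t⁻¹ * ((∫ z, H z * gauss t (r z) ∂ν) - Real.exp (-t) * ∫ z, H z ∂ν) := by
  have hgauss : Integrable (fun z => H z * gauss t (r z)) ν :=
    hH.mul_bdd (c := 1) ((continuous_gauss t).comp_aestronglyMeasurable hr)
      (Eventually.of_forall fun z => norm_gauss_le_one ht _)
  rw [← integral_const_mul, ← integral_sub hgauss (hH.const_mul _), ← integral_const_mul]
  refine integral_congr_ae ?_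
  filter_upwards [hr0] with z hz
  rw [coulombSlice_of_ne hz]
  ring

end Superposition

/-! ### Gaussian energies in Fourier variables -/

/-- The Fourier weight `(4πt)⁻¹ exp (-|ζ|² / 4t)` of the Gaussian `exp (-t |x|²)`. -/
def gaussWeight (t : ℝ) (ζ : Plane) : ℝ := (4 * Real.pi * t)⁻¹ * Real.exp (-(‖ζ‖ ^ 2 / (4 * t)))

lemma gaussWeight_nonneg {t : ℝ} (ht : 0 < t) (ζ : Plane) : 0 ≤ gaussWeight t ζ := by
  unfold gaussWeight; positivity

@[fun_prop] lemma continuous_gaussWeight (t : ℝ) : Continuous (gaussWeight t) := by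
  unfold gaussWeight; fun_prop

lemma integrable_gauss {t : ℝ} (ht : 0 < t) : Integrable (gauss t) := by
  have h := GaussianFourier.integrable_cexp_neg_mul_sq_norm_add (V := Plane) (b := (t : ℂ))
    (by simpa using ht) 0 0
  refine h.norm.congr (Eventually.of_forall fun x => ?_)
  simp only [Complex.norm_exp, gauss]
  congr 1
  norm_cast
  simp [mul_comm]

lemma integral_gauss {t : ℝ} (ht : 0 < t) : ∫ x, gauss t x = Real.pi / t := by
  have h := GaussianFourier.integral_rexp_neg_mul_sq_norm (V := Plane) ht
  simpa [gauss, mul_comm] using h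

lemma gaussWeight_eq (t : ℝ) (ζ : Plane) :
    gaussWeight t ζ = (4 * Real.pi * t)⁻¹ * gauss (4 * t)⁻¹ ζ := by
  rw [gaussWeight, gauss, div_eq_mul_inv]

lemma integrable_gaussWeight {t : ℝ} (ht : 0 < t) : Integrable (gaussWeight t) := by
  rw [funext (gaussWeight_eq t)]
  exact (integrable_gauss (by positivity)).const_mul _

lemma ofReal_gauss {t : ℝ} (ht : 0 < t) (x : Plane) :
    (gauss t x : ℂ) = ∫ ζ, (gaussWeight t ζ : ℂ) * chr x ζ := by
  have hpi : (Real.pi : ℂ) ≠ 0 := by exact_mod_cast Real.pi_ne_zero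
  have htc : (t : ℂ) ≠ 0 := by exact_mod_cast ht.ne'
  have hweight (ζ : Plane) : (gaussWeight t ζ : ℂ) * chr x ζ = (4 * Real.pi * t : ℂ)⁻¹ *
      Complex.exp (-(((4 * t)⁻¹ : ℝ) : ℂ) * ‖ζ‖ ^ 2 + -Complex.I * (inner ℝ x ζ : ℝ)) := by
    rw [gaussWeight, chr, Complex.exp_add]
    push_cast
    rw [mul_assoc]
    congr 3
    · field_simp
    · ring
  have hprefactor : (4 * (Real.pi : ℂ) * (t : ℂ))⁻¹ * ((Real.pi : ℂ) / (4 * (t : ℂ))⁻¹) = 1 := by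
    field_simp
  simp_rw [hweight]
  rw [integral_const_mul, GaussianFourier.integral_cexp_neg_mul_sq_norm_add (V := Plane)
    (b := (((4 * t)⁻¹ : ℝ) : ℂ)) (by simpa using ht) (-Complex.I) x]
  simp only [finrank_euclideanSpace, Fintype.card_fin, gauss]
  push_cast
  rw [div_self two_ne_zero, Complex.cpow_one, ← mul_assoc, hprefactor, one_mul, neg_sq,
    Complex.I_sq]
  congr 1
  field_simp

lemma integral_mul_gauss {X : Type*} [MeasurableSpace X] {ν : Measure X} [SFinite ν]
    {H : X → ℝ} {r : X → Plane} (hH : Integrable H ν) (hr : Measurable r) {t : ℝ} (ht : 0 < t) :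
    ∫ z, H z * gauss t (r z) ∂ν
      = ∫ ζ, gaussWeight t ζ * (∫ z, chr (r z) ζ * H z ∂ν).re := by
  have hchr : AEStronglyMeasurable (fun p : X × Plane => chr (r p.1) p.2) (ν.prod volume) :=
    (continuous_chr.measurable.comp
      ((hr.comp measurable_fst).prodMk measurable_snd)).aestronglyMeasurable
  have hint : Integrable (Function.uncurry fun (z : X) (ζ : Plane) =>
      chr (r z) ζ * ((H z : ℂ) * (gaussWeight t ζ : ℂ))) (ν.prod volume) :=
    (hH.ofReal.mul_prod (integrable_gaussWeight ht).ofReal).bdd_mul (c := 1) hchr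
      (Eventually.of_forall fun p => by simp)
  have hcomplex : ((∫ z, H z * gauss t (r z) ∂ν : ℝ) : ℂ)
      = ∫ ζ, ∫ z, chr (r z) ζ * ((H z : ℂ) * (gaussWeight t ζ : ℂ)) ∂ν :=
    calc ((∫ z, H z * gauss t (r z) ∂ν : ℝ) : ℂ)
        = ∫ z, (∫ ζ, chr (r z) ζ * ((H z : ℂ) * (gaussWeight t ζ : ℂ))) ∂ν := by
          rw [← integral_complex_ofReal]
          congr 1 with z
          rw [Complex.ofReal_mul, ofReal_gauss ht, ← integral_const_mul]
          congr 1 with ζ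
          ring
      _ = _ := integral_integral_swap hint
  rw [← Complex.ofReal_re (∫ z, H z * gauss t (r z) ∂ν), hcomplex]
  refine (integral_re hint.integral_prod_right).symm.trans ?_
  congr 1 with ζ
  rw [← Complex.re_ofReal_mul, ← integral_const_mul]
  simp only [Function.uncurry, RCLike.re_to_complex]
  congr 2 with z
  ring

@[fun_prop] lemma continuous_empFt {E : Type*} [NormedAddCommGroup E] [InnerProductSpace ℝ E]
    {N : ℕ} (x : Fin N → E) : Continuous (empFt x) := by
  unfold empFt; fun_prop

lemma norm_empFt_le {E : Type*} [NormedAddCommGroup E] [InnerProductSpace ℝ E] {N : ℕ}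
    (x : Fin N → E) (ζ : E) : ‖empFt x ζ‖ ≤ 1 := by
  have hsum : ‖∑ i, chr (x i) ζ‖ ≤ N := (norm_sum_le _ _).trans (by simp)
  rw [empFt, norm_smul, Real.norm_of_nonneg (by positivity), one_div, inv_mul_eq_div]
  exact div_le_one_of_le₀ hsum N.cast_nonneg

lemma continuous_rft {f : Plane → ℝ} (hf : Integrable f) : Continuous (rft f) :=
  continuous_ft hf.ofReal

lemma conj_rft (f : Plane → ℝ) (ζ : Plane) :
    (starRingEnd ℂ) (rft f ζ) = ∫ y, chr (-y) ζ * f y := by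
  rw [rft, ft, ← integral_conj]
  congr 1 with y
  rw [map_mul, conj_chr, Complex.conj_ofReal]

lemma re_mul_conj_self (z : ℂ) : (z * (starRingEnd ℂ) z).re = ‖z‖ ^ 2 := by
  rw [Complex.mul_conj']
  norm_cast

lemma selfEnergy_gauss {f : Plane → ℝ} (hf : Integrable f) {t : ℝ} (ht : 0 < t) :
    selfEnergy (gauss t) f = ∫ ζ, gaussWeight t ζ * ‖rft f ζ‖ ^ 2 := by
  rw [selfEnergy, Measure.volume_eq_prod, integral_mul_gauss (hf.mul_prod hf) (by fun_prop) ht]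
  congr 1 with ζ
  rw [← re_mul_conj_self, conj_rft, rft, ft, ← integral_prod_mul]
  congr 3 with z
  rw [sub_eq_add_neg, chr_add_left]
  push_cast
  ring

lemma potential_gauss {f : Plane → ℝ} (hf : Integrable f) (y : Plane) {t : ℝ} (ht : 0 < t) :
    potential (gauss t) f y
      = ∫ ζ, gaussWeight t ζ * (rft f ζ * (starRingEnd ℂ) (chr y ζ)).re := by
  rw [potential, integral_mul_gauss hf (by fun_prop) ht]
  congr 1 with ζ
  rw [rft, ft, ← integral_mul_const]
  congr 3 with z
  rw [sub_eq_add_neg, chr_add_left, conj_chr]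
  ring

lemma gauss_sub {t : ℝ} (ht : 0 < t) (x y : Plane) :
    gauss t (x - y) = ∫ ζ, gaussWeight t ζ * (chr x ζ * (starRingEnd ℂ) (chr y ζ)).re := by
  have h := integral_mul_gauss (ν := Measure.dirac x) (H := fun _ => 1) (r := fun z => z - y)
    (integrable_const _) (by fun_prop) ht
  simp only [integral_dirac, one_mul, Complex.ofReal_one, mul_one] at h
  rw [h]
  simp only [sub_eq_add_neg, chr_add_left, conj_chr]

lemma norm_sub_empFt_sq {E : Type*} [NormedAddCommGroup E] [InnerProductSpace ℝ E] {N : ℕ}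
    (x : Fin N → E) (a : ℂ) (ζ : E) :
    ‖a - empFt x ζ‖ ^ 2 = ‖a‖ ^ 2 - 2 / (N : ℝ) * ∑ i, (a * (starRingEnd ℂ) (chr (x i) ζ)).re
      + 1 / (N : ℝ) ^ 2 * ∑ p : Fin N × Fin N,
          (chr (x p.1) ζ * (starRingEnd ℂ) (chr (x p.2) ζ)).re := by
  have hcross : (a * (starRingEnd ℂ) (empFt x ζ)).re
      = 1 / (N : ℝ) * ∑ i, (a * (starRingEnd ℂ) (chr (x i) ζ)).re := by
    rw [empFt, Complex.real_smul, map_mul, Complex.conj_ofReal, mul_left_comm,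
      Complex.re_ofReal_mul, map_sum, Finset.mul_sum, Complex.re_sum]
  have hself : ‖empFt x ζ‖ ^ 2 = 1 / (N : ℝ) ^ 2 * ∑ p : Fin N × Fin N,
      (chr (x p.1) ζ * (starRingEnd ℂ) (chr (x p.2) ζ)).re := by
    rw [empFt, norm_smul, mul_pow, ← re_mul_conj_self, map_sum, Fintype.sum_mul_sum,
      Complex.re_sum, Fintype.sum_prod_type]
    simp
  rw [← Complex.normSq_eq_norm_sq, Complex.normSq_sub, Complex.normSq_eq_norm_sq,
    Complex.normSq_eq_norm_sq, hself, hcross]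
  ring

lemma pairEnergy_gauss {f : Plane → ℝ} (hf : Integrable f) {N : ℕ} (x : Fin N → Plane) {t : ℝ}
    (ht : 0 < t) :
    pairEnergy (gauss t) f x = ∫ ζ, gaussWeight t ζ * ‖rft f ζ - empFt x ζ‖ ^ 2 := by
  have hF := continuous_rft hf
  have hFbdd (ζ : Plane) : ‖rft f ζ‖ ≤ ∫ y, ‖(f y : ℂ)‖ := norm_ft_le _ ζ
  have hint {u : Plane → ℝ} (hu : Continuous u) {D : ℝ} (hD : ∀ ζ, ‖u ζ‖ ≤ D) :
      Integrable fun ζ => gaussWeight t ζ * u ζ :=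
    (integrable_gaussWeight ht).mul_bdd (c := D) hu.aestronglyMeasurable (Eventually.of_forall hD)
  have hself : Integrable fun ζ => gaussWeight t ζ * ‖rft f ζ‖ ^ 2 :=
    hint (by fun_prop) fun ζ => by
      rw [norm_pow, norm_norm]
      exact pow_le_pow_left₀ (norm_nonneg _) (hFbdd ζ) 2
  have hcross (i) :
      Integrable fun ζ => gaussWeight t ζ * (rft f ζ * (starRingEnd ℂ) (chr (x i) ζ)).re :=
    hint (Complex.continuous_re.comp (by fun_prop)) fun ζ =>
      (Complex.abs_re_le_norm _).trans (by simpa using hFbdd ζ)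
  have hpoints (p : Fin N × Fin N) : Integrable fun ζ =>
      gaussWeight t ζ * (chr (x p.1) ζ * (starRingEnd ℂ) (chr (x p.2) ζ)).re :=
    hint (D := 1) (Complex.continuous_re.comp (by fun_prop)) fun ζ =>
      (Complex.abs_re_le_norm _).trans (by simp)
  have hcross' := (integrable_finsetSum Finset.univ fun i _ => hcross i).const_mul (2 / (N : ℝ))
  have hpoints' := (integrable_finsetSum Finset.univ fun p _ => hpoints p).const_mul
    (1 / (N : ℝ) ^ 2)
  simp only [pairEnergy, selfEnergy_gauss hf ht, potential_gauss hf _ ht, gauss_sub ht,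
    ← integral_finsetSum _ fun i _ => hcross i, ← integral_finsetSum _ fun p _ => hpoints p,
    ← integral_const_mul]
  rw [← integral_sub hself hcross', ← integral_add (by exact hself.sub hcross') hpoints']
  congr 1 with ζ
  rw [norm_sub_empFt_sq, ← Finset.mul_sum, ← Finset.mul_sum]
  ring

/-! ### Superposition of Gaussian energies -/

lemma ae_sub_ne_zero : ∀ᵐ z : Plane × Plane, z.1 - z.2 ≠ 0 := by
  rw [Measure.volume_eq_prod]
  refine (Measure.ae_prod_iff_ae_ae ?_).2 (Eventually.of_forall fun x => ?_)
  · exact (measurableSet_eq_fun (by fun_prop) measurable_const).compl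
  · filter_upwards [Measure.ae_ne volume x] with y hy using sub_ne_zero.2 hy.symm

section CoulombSlice

variable {f : Plane → ℝ} {N : ℕ} {x : Fin N → Plane}

lemma integrableOn_selfEnergy_coulombSlice (hf : IsDensity f) :
    IntegrableOn (fun t => selfEnergy (coulombSlice t) f) (Set.Ioi 0) :=
  integrableOn_integral_mul_coulombSlice
    (hf.integrable.mul_prod hf.integrable).aestronglyMeasurable (by fun_prop)
    hf.integrable_mul_mul_coulomb

lemma integrableOn_potential_coulombSlice (hf : IsDensity f) (y : Plane) :
    IntegrableOn (fun t => potential (coulombSlice t) f y) (Set.Ioi 0) :=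
  integrableOn_integral_mul_coulombSlice hf.integrable.aestronglyMeasurable (by fun_prop)
    (hf.integrable_mul_coulomb y)

lemma integrableOn_sum_coulombSlice (x : Fin N → Plane) :
    IntegrableOn (fun t => ∑ p : Fin N × Fin N, coulombSlice t (x p.1 - x p.2)) (Set.Ioi 0) :=
  integrable_finsetSum _ fun _ _ => integrableOn_coulombSlice _

lemma integrableOn_pairEnergy_coulombSlice (hf : IsDensity f) (x : Fin N → Plane) :
    IntegrableOn (fun t => pairEnergy (coulombSlice t) f x) (Set.Ioi 0) :=
  ((integrableOn_selfEnergy_coulombSlice hf).sub ((integrable_finsetSum _ fun i _ =>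
    integrableOn_potential_coulombSlice hf (x i)).const_mul _)).add
      ((integrableOn_sum_coulombSlice x).const_mul _)

lemma integral_pairEnergy_coulombSlice (hf : IsDensity f) (x : Fin N → Plane) :
    ∫ t in Set.Ioi 0, pairEnergy (coulombSlice t) f x = 4 * Real.pi * pairEnergy coulomb f x := by
  have hself := integrableOn_selfEnergy_coulombSlice hf
  have hpotential := (integrable_finsetSum Finset.univ fun i _ =>
    integrableOn_potential_coulombSlice hf (x i)).const_mul (2 / (N : ℝ))
  have hpoints := (integrableOn_sum_coulombSlice x).const_mul (1 / (N : ℝ) ^ 2)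
  have integral_self : ∫ t in Set.Ioi 0, selfEnergy (coulombSlice t) f
      = 4 * Real.pi * selfEnergy coulomb f :=
    integral_integral_mul_coulombSlice (hf.integrable.mul_prod hf.integrable).aestronglyMeasurable
      (by fun_prop) hf.integrable_mul_mul_coulomb
  have integral_potential (y : Plane) : ∫ t in Set.Ioi 0, potential (coulombSlice t) f y
      = 4 * Real.pi * potential coulomb f y :=
    integral_integral_mul_coulombSlice hf.integrable.aestronglyMeasurable (by fun_prop)
      (hf.integrable_mul_coulomb y)
  have hpair (p : Fin N × Fin N) :
      IntegrableOn (fun t => coulombSlice t (x p.1 - x p.2)) (Set.Ioi 0) :=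
    integrableOn_coulombSlice _
  simp only [pairEnergy]
  rw [integral_add (by exact hself.sub hpotential) hpoints, integral_sub hself hpotential,
    integral_const_mul, integral_const_mul,
    integral_finsetSum _ fun i _ => integrableOn_potential_coulombSlice hf (x i),
    integral_finsetSum _ fun p _ => hpair p]
  simp only [integral_self, integral_potential, integral_coulombSlice, ← Finset.mul_sum]
  ring

lemma sum_coulombSlice (hx : Function.Injective x) (t : ℝ) :
    ∑ p : Fin N × Fin N, coulombSlice t (x p.1 - x p.2)
      = t⁻¹ * ((∑ p : Fin N × Fin N, gauss t (x p.1 - x p.2)) - Real.exp (-t) * N ^ 2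
          - N * (1 - Real.exp (-t))) := by
  have hpair (i j : Fin N) : coulombSlice t (x i - x j) = t⁻¹ * (gauss t (x i - x j)
      - Real.exp (-t) - if i = j then 1 - Real.exp (-t) else 0) := by
    by_cases hij : i = j
    · simp [hij, coulombSlice, gauss]
    · rw [coulombSlice_of_ne (sub_ne_zero.2 (hx.ne hij)), if_neg hij, sub_zero]
  simp only [Fintype.sum_prod_type, hpair, ← Finset.mul_sum, Finset.sum_sub_distrib,
    Finset.sum_ite_eq, Finset.mem_univ, if_true, Finset.sum_const, Finset.card_univ,
    Fintype.card_prod, Nat.cast_mul, Fintype.card_fin, nsmul_eq_mul]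
  ring

lemma pairEnergy_coulombSlice (hf : Integrable f) (h1 : ∫ y, f y = 1) (hN : 1 ≤ N)
    (hx : Function.Injective x) {t : ℝ} (ht : 0 < t) :
    pairEnergy (coulombSlice t) f x
      = t⁻¹ * (pairEnergy (gauss t) f x - (1 - Real.exp (-t)) / N) := by
  have hN0 : (N : ℝ) ≠ 0 := by positivity
  have hmass : ∫ z : Plane × Plane, f z.1 * f z.2 = 1 := by
    rw [Measure.volume_eq_prod, integral_prod_mul, h1, one_mul]
  have hself : selfEnergy (coulombSlice t) f
      = t⁻¹ * (selfEnergy (gauss t) f - Real.exp (-t)) := by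
    rw [selfEnergy, integral_mul_coulombSlice (ν := (volume : Measure (Plane × Plane)))
      (hf.mul_prod hf) (by fun_prop) ae_sub_ne_zero ht, hmass, mul_one, selfEnergy]
  have hpotential (y : Plane) : potential (coulombSlice t) f y
      = t⁻¹ * (potential (gauss t) f y - Real.exp (-t)) := by
    have hne : ∀ᵐ z : Plane, z - y ≠ 0 := by
      filter_upwards [Measure.ae_ne volume y] with z hz using sub_ne_zero.2 hz
    rw [potential, integral_mul_coulombSlice hf (by fun_prop) hne ht, h1, mul_one, potential]
  rw [pairEnergy, hself, sum_coulombSlice hx, pairEnergy]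
  simp only [hpotential, ← Finset.mul_sum, Finset.sum_sub_distrib, Finset.sum_const,
    Finset.card_univ, Fintype.card_fin, nsmul_eq_mul]
  field_simp
  ring

lemma integrableOn_pairEnergy_gauss_sub (hf : IsDensity f) (h1 : ∫ y, f y = 1) (hN : 1 ≤ N)
    (hx : Function.Injective x) :
    IntegrableOn (fun t => t⁻¹ * (pairEnergy (gauss t) f x - (1 - Real.exp (-t)) / N))
      (Set.Ioi 0) :=
  (integrableOn_pairEnergy_coulombSlice hf x).congr_fun
    (fun _ ht => pairEnergy_coulombSlice hf.integrable h1 hN hx ht) measurableSet_Ioi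

lemma integral_pairEnergy_gauss_sub (hf : IsDensity f) (h1 : ∫ y, f y = 1) (hN : 1 ≤ N)
    (hx : Function.Injective x) :
    ∫ t in Set.Ioi 0, t⁻¹ * (pairEnergy (gauss t) f x - (1 - Real.exp (-t)) / N)
      = 4 * Real.pi * offDiagEnergy (density f - empirical x) := by
  rw [offDiagEnergy_density_sub_empirical hf.integrable hf.integrable_mul_mul_coulomb
    hf.integrable_mul_coulomb, ← integral_pairEnergy_coulombSlice hf]
  exact setIntegral_congr_fun measurableSet_Ioi
    fun t ht => (pairEnergy_coulombSlice hf.integrable h1 hN hx ht).symm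

end CoulombSlice

/-! ### Truncated Gaussian energies -/

lemma potential_gauss_le {f : Plane → ℝ} (hf : IsDensity f) (y : Plane) {t : ℝ} (ht : 0 < t) :
    potential (gauss t) f y ≤ normLinf f * (Real.pi / t) := by
  have hgauss : Integrable fun z => gauss t (z - y) := (integrable_gauss ht).comp_sub_right y
  rw [← integral_gauss ht, ← integral_sub_right_eq_self (gauss t) y, ← integral_const_mul,
    potential]
  refine integral_mono_ae (hf.integrable.mul_bdd (c := 1)
    ((continuous_gauss t).comp (by fun_prop)).aestronglyMeasurable
    (Eventually.of_forall fun z => norm_gauss_le_one ht _)) (hgauss.const_mul _) ?_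
  filter_upwards [ae_norm_le_normLinf hf.memLp_top] with z hz
  exact mul_le_mul_of_nonneg_right ((le_abs_self _).trans hz) (gauss_pos _ _).le

lemma selfEnergy_gauss_nonneg {f : Plane → ℝ} (hf : Integrable f) {t : ℝ} (ht : 0 < t) :
    0 ≤ selfEnergy (gauss t) f := by
  rw [selfEnergy_gauss hf ht]
  exact integral_nonneg fun ζ => mul_nonneg (gaussWeight_nonneg ht ζ) (by positivity)

lemma pairEnergy_gauss_nonneg {f : Plane → ℝ} (hf : Integrable f) {N : ℕ} (x : Fin N → Plane)
    {t : ℝ} (ht : 0 < t) : 0 ≤ pairEnergy (gauss t) f x := by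
  rw [pairEnergy_gauss hf x ht]
  exact integral_nonneg fun ζ => mul_nonneg (gaussWeight_nonneg ht ζ) (by positivity)

lemma selfEnergy_gauss_le {f : Plane → ℝ} (hf : IsDensity f) {N : ℕ} (hN : 1 ≤ N)
    (x : Fin N → Plane) {t : ℝ} (ht : 0 < t) :
    selfEnergy (gauss t) f
      ≤ pairEnergy (gauss t) f x - 1 / N + 2 * (normLinf f * (Real.pi / t)) := by
  have : (0 : ℝ) < N := by positivity
  have hpotential : 2 / (N : ℝ) * ∑ i, potential (gauss t) f (x i)
      ≤ 2 * (normLinf f * (Real.pi / t)) :=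
    calc _ ≤ 2 / (N : ℝ) * ∑ _i : Fin N, normLinf f * (Real.pi / t) := by
          gcongr with i
          exact potential_gauss_le hf _ ht
      _ = _ := by
          rw [Finset.sum_const, Finset.card_univ, Fintype.card_fin, nsmul_eq_mul]
          field_simp
  have hdiag : 1 / (N : ℝ)
      ≤ 1 / (N : ℝ) ^ 2 * ∑ p : Fin N × Fin N, gauss t (x p.1 - x p.2) :=
    calc 1 / (N : ℝ) = 1 / (N : ℝ) ^ 2 * ∑ i, gauss t (x i - x i) := by
          simp [gauss]
          field_simp
      _ ≤ _ := by
          rw [Fintype.sum_prod_type]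
          gcongr with i
          exact Finset.single_le_sum (f := fun j => gauss t (x i - x j))
            (fun j _ => (gauss_pos _ _).le) (Finset.mem_univ i)
  rw [pairEnergy]
  linarith

/-- The energy of `f` minus the empirical measure for the kernel `exp (-t |x|²)`, where the
interaction with the points is switched off for `t > N`, i.e. below the length scale `N^(-1/2)`. -/
def truncEnergy (f : Plane → ℝ) {N : ℕ} (x : Fin N → Plane) (t : ℝ) : ℝ :=
  if t ≤ N then pairEnergy (gauss t) f x else selfEnergy (gauss t) f

lemma truncEnergy_nonneg {f : Plane → ℝ} (hf : Integrable f) {N : ℕ} (x : Fin N → Plane) {t : ℝ}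
    (ht : 0 < t) : 0 ≤ truncEnergy f x t := by
  unfold truncEnergy
  split_ifs
  exacts [pairEnergy_gauss_nonneg hf x ht, selfEnergy_gauss_nonneg hf ht]

/-- A bound, as a function of `t`, for the error made in passing from the off-diagonal Coulomb
energy of a density bounded by `m` to its truncated Gaussian energies. -/
def truncErr (N : ℕ) (m : ℝ) : ℝ → ℝ :=
  (Set.Ioc (0 : ℝ) 1).indicator (fun _ => 1 / (N : ℝ))
    + (Set.Ioc 1 (N : ℝ)).indicator (fun t => 1 / (N : ℝ) * t⁻¹)
    + (Set.Ioi (N : ℝ)).indicator (fun t => 2 * Real.pi * m * t ^ (-2 : ℝ))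

lemma integrableOn_truncErr_and_integral {N : ℕ} (hN : 1 ≤ N) (m : ℝ) :
    IntegrableOn (truncErr N m) (Set.Ioi 0) ∧
      ∫ t in Set.Ioi 0, truncErr N m t = (1 + Real.log N) / N + 2 * Real.pi * m / N := by
  have hN1 : (1 : ℝ) ≤ N := by exact_mod_cast hN
  have hN0 : (0 : ℝ) < N := by positivity
  have hconst : IntegrableOn (fun _ => 1 / (N : ℝ)) (Set.Ioc (0 : ℝ) 1) :=
    integrableOn_const measure_Ioc_lt_top.ne
  have hinv : IntegrableOn (fun t => 1 / (N : ℝ) * t⁻¹) (Set.Ioc 1 (N : ℝ)) := by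
    refine (ContinuousOn.integrableOn_Icc ?_).mono_set Set.Ioc_subset_Icc_self
    exact continuousOn_const.mul
      (continuousOn_inv₀.mono fun t ht => (zero_lt_one.trans_le ht.1).ne')
  have htail : IntegrableOn (fun t => 2 * Real.pi * m * t ^ (-2 : ℝ)) (Set.Ioi (N : ℝ)) :=
    (integrableOn_Ioi_rpow_of_lt (by norm_num) hN0).const_mul _
  replace hconst := (hconst.integrable_indicator measurableSet_Ioc).integrableOn (s := Set.Ioi 0)
  replace hinv := (hinv.integrable_indicator measurableSet_Ioc).integrableOn (s := Set.Ioi 0)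
  replace htail := (htail.integrable_indicator measurableSet_Ioi).integrableOn (s := Set.Ioi 0)
  refine ⟨(hconst.add hinv).add htail, ?_⟩
  have hpow : (N : ℝ) ^ (-2 + 1 : ℝ) = (N : ℝ)⁻¹ := by
    rw [show (-2 + 1 : ℝ) = -1 by norm_num, Real.rpow_neg_one]
  simp only [truncErr, Pi.add_apply]
  rw [integral_add (by exact hconst.add hinv) htail, integral_add hconst hinv,
    setIntegral_indicator measurableSet_Ioc, setIntegral_indicator measurableSet_Ioc,
    setIntegral_indicator measurableSet_Ioi,
    Set.inter_eq_right.2 Set.Ioc_subset_Ioi_self,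
    Set.inter_eq_right.2 (Set.Ioc_subset_Ioi_self.trans (Set.Ioi_subset_Ioi zero_le_one)),
    Set.inter_eq_right.2 (Set.Ioi_subset_Ioi hN0.le), integral_const_mul, integral_const_mul,
    integral_Ioi_rpow_of_lt (by norm_num) hN0, ← intervalIntegral.integral_of_le hN1,
    integral_inv_of_pos one_pos hN0, hpow]
  simp
  field_simp
  ring

lemma inv_mul_truncEnergy_le {f : Plane → ℝ} (hf : IsDensity f) {N : ℕ} (hN : 1 ≤ N)
    (x : Fin N → Plane) {t : ℝ} (ht : 0 < t) :
    t⁻¹ * truncEnergy f x t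
      ≤ t⁻¹ * (pairEnergy (gauss t) f x - (1 - Real.exp (-t)) / N)
        + truncErr N (normLinf f) t := by
  have hN1 : (1 : ℝ) ≤ N := by exact_mod_cast hN
  have : (0 : ℝ) < N := by positivity
  have hexp_le : 1 - Real.exp (-t) ≤ t := by linarith [Real.add_one_le_exp (-t)]
  have hexp_le_one : (1 - Real.exp (-t)) / N ≤ 1 / N := by
    gcongr
    linarith [Real.exp_pos (-t)]
  simp only [truncEnergy, truncErr, Pi.add_apply, Set.indicator_apply, Set.mem_Ioc, Set.mem_Ioi, ht,
    true_and]
  rcases le_or_gt t 1 with ht1 | ht1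
  · have herr : t⁻¹ * ((1 - Real.exp (-t)) / N) ≤ 1 / N := by
      rw [← mul_div_assoc]
      gcongr
      rwa [inv_mul_le_iff₀ ht, mul_one]
    rw [if_pos (ht1.trans hN1), if_pos ht1, if_neg (fun h => ht1.not_gt h.1),
      if_neg (ht1.trans hN1).not_gt]
    linarith
  rcases le_or_gt t N with htN | htN
  · have herr : t⁻¹ * ((1 - Real.exp (-t)) / N) ≤ 1 / N * t⁻¹ := by
      rw [mul_comm]
      gcongr
    rw [if_pos htN, if_neg ht1.not_ge, if_pos ⟨ht1, htN⟩, if_neg htN.not_gt]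
    linarith
  · rw [if_neg htN.not_ge, if_neg ht1.not_ge, if_neg (fun h => htN.not_ge h.2), if_pos htN,
      Real.rpow_neg ht.le, Real.rpow_two, sq, mul_inv]
    calc t⁻¹ * selfEnergy (gauss t) f
        ≤ t⁻¹ * (pairEnergy (gauss t) f x - (1 - Real.exp (-t)) / N
          + 2 * (normLinf f * (Real.pi / t))) := by
          gcongr
          linarith [selfEnergy_gauss_le hf hN x ht]
      _ = _ := by ring

/-- The off-diagonal Coulomb energy of `f - (1/N) Σ δ_{x i}`, corrected by the self-interaction of
charges of radius `N^(-1/2)`, so as to become nonnegative. -/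
def renormEnergy (f : Plane → ℝ) {N : ℕ} (x : Fin N → Plane) : ℝ :=
  offDiagEnergy (density f - empirical x) + Real.log N / (2 * N) + (1 + normLinf f) / N

lemma integral_add_integral_truncErr_le {f : Plane → ℝ} (hf : IsDensity f) (h1 : ∫ y, f y = 1)
    {N : ℕ} (hN : 1 ≤ N) {x : Fin N → Plane} (hx : Function.Injective x) :
    (∫ t in Set.Ioi 0, t⁻¹ * (pairEnergy (gauss t) f x - (1 - Real.exp (-t)) / N))
      + ∫ t in Set.Ioi 0, truncErr N (normLinf f) t ≤ 4 * Real.pi * renormEnergy f x := by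
  have hlog : 0 ≤ (2 * Real.pi - 1) * Real.log N :=
    mul_nonneg (by linarith [Real.pi_gt_three]) (Real.log_nonneg (by exact_mod_cast hN))
  have hbound : 0 ≤ 2 * Real.pi * normLinf f :=
    mul_nonneg (by positivity) (normLinf_nonneg f)
  have hgap : 4 * Real.pi * (Real.log N / (2 * N) + (1 + normLinf f) / N)
      - ((1 + Real.log N) / N + 2 * Real.pi * normLinf f / N)
      = ((2 * Real.pi - 1) * Real.log N + (4 * Real.pi - 1) + 2 * Real.pi * normLinf f) / N := by
    field_simp
    ring
  have hgap_nonneg : 0 ≤ ((2 * Real.pi - 1) * Real.log N + (4 * Real.pi - 1)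
      + 2 * Real.pi * normLinf f) / N :=
    div_nonneg (by linarith [Real.pi_gt_three]) N.cast_nonneg
  rw [integral_pairEnergy_gauss_sub hf h1 hN hx, (integrableOn_truncErr_and_integral hN _).2,
    renormEnergy]
  linarith

lemma renormEnergy_nonneg_and_lintegral_truncEnergy_le {f : Plane → ℝ} (hf : IsDensity f)
    (h1 : ∫ y, f y = 1) {N : ℕ} (hN : 1 ≤ N) {x : Fin N → Plane} (hx : Function.Injective x) :
    0 ≤ renormEnergy f x ∧
    ∫⁻ t in Set.Ioi 0, ENNReal.ofReal (t⁻¹ * truncEnergy f x t)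
      ≤ ENNReal.ofReal (4 * Real.pi * renormEnergy f x) := by
  have herr := (integrableOn_truncErr_and_integral hN (normLinf f)).1
  have henergy := integrableOn_pairEnergy_gauss_sub hf h1 hN hx
  have hle := integral_add_integral_truncErr_le hf h1 hN hx
  have hnonneg : ∀ᵐ t ∂(volume.restrict (Set.Ioi (0 : ℝ))),
      0 ≤ t⁻¹ * (pairEnergy (gauss t) f x - (1 - Real.exp (-t)) / N)
        + truncErr N (normLinf f) t := by
    filter_upwards [ae_restrict_mem measurableSet_Ioi] with t ht
    exact (mul_nonneg (inv_nonneg.2 (le_of_lt ht)) (truncEnergy_nonneg hf.integrable x ht)).trans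
      (inv_mul_truncEnergy_le hf hN x ht)
  rw [← integral_add henergy herr] at hle
  refine ⟨nonneg_of_mul_nonneg_right ((integral_nonneg_of_ae hnonneg).trans hle) (by positivity),
    le_trans ?_ (ENNReal.ofReal_le_ofReal hle)⟩
  rw [ofReal_integral_eq_lintegral_ofReal (by exact henergy.add herr) hnonneg]
  exact setLIntegral_mono_ae' measurableSet_Ioi (Eventually.of_forall fun t ht =>
    ENNReal.ofReal_le_ofReal (inv_mul_truncEnergy_le hf hN x ht))

/-! ### Smearing the point charges -/

lemma expNegInvGlue_of_pos {s : ℝ} (hs : 0 < s) : expNegInvGlue s = Real.exp (-s⁻¹) := by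
  rw [expNegInvGlue, if_neg hs.not_ge]

lemma hasDerivAt_expNegInvGlue_div {c t : ℝ} (hc : 0 < c) (ht : 0 < t) :
    HasDerivAt (fun s => expNegInvGlue (s / c) / c) ((t ^ 2)⁻¹ * Real.exp (-(c / t))) t := by
  have h : HasDerivAt (fun s => Real.exp (-(c / s)) / c) ((t ^ 2)⁻¹ * Real.exp (-(c / t))) t := by
    refine ((((hasDerivAt_inv ht.ne').const_mul c).neg).exp.div_const c).congr_deriv ?_
    simp only [Pi.neg_apply, ← div_eq_mul_inv]
    field_simp
  refine h.congr_of_eventuallyEq ?_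
  filter_upwards [lt_mem_nhds ht] with s hs
  rw [expNegInvGlue_of_pos (by positivity), inv_div]

lemma lintegral_inv_sq_mul_exp_Ioi {c a : ℝ} (hc : 0 < c) (ha : 0 ≤ a) :
    ∫⁻ t in Set.Ioi a, ENNReal.ofReal ((t ^ 2)⁻¹ * Real.exp (-(c / t)))
      = ENNReal.ofReal ((1 - expNegInvGlue (a / c)) / c) := by
  have hcont : Continuous fun s => expNegInvGlue (s / c) / c :=
    ((expNegInvGlue.contDiff (n := 0)).continuous.comp (continuous_id.div_const c)).div_const c
  have hlim : Tendsto (fun s => expNegInvGlue (s / c) / c) atTop (𝓝 (1 / c)) := by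
    have h : Tendsto (fun s : ℝ => Real.exp (-(c / s)) / c) atTop (𝓝 (Real.exp (-0) / c)) :=
      ((Real.continuous_exp.tendsto _).comp
        (tendsto_const_nhds.div_atTop tendsto_id).neg).div_const c
    rw [neg_zero, Real.exp_zero] at h
    refine h.congr' ?_
    filter_upwards [eventually_gt_atTop 0] with s hs
    rw [expNegInvGlue_of_pos (by positivity), inv_div]
  have hderiv : ∀ t ∈ Set.Ioi a, HasDerivAt (fun s => expNegInvGlue (s / c) / c)
      ((t ^ 2)⁻¹ * Real.exp (-(c / t))) t :=
    fun t ht => hasDerivAt_expNegInvGlue_div hc (ha.trans_lt ht)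
  have hnonneg : ∀ t ∈ Set.Ioi a, 0 ≤ (t ^ 2)⁻¹ * Real.exp (-(c / t)) := fun t _ => by positivity
  rw [← ofReal_integral_eq_lintegral_ofReal
    (integrableOn_Ioi_deriv_of_nonneg hcont.continuousWithinAt hderiv hnonneg hlim)
    ((ae_restrict_mem measurableSet_Ioi).mono hnonneg),
    integral_Ioi_of_hasDerivAt_of_nonneg hcont.continuousWithinAt hderiv hnonneg hlim, sub_div]

lemma lintegral_inv_mul_gaussWeight_Ioi {a : ℝ} (ha : 0 ≤ a) {ζ : Plane} (hζ : ζ ≠ 0) :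
    ∫⁻ t in Set.Ioi a, ENNReal.ofReal (t⁻¹ * gaussWeight t ζ)
      = ENNReal.ofReal Real.pi⁻¹
        * ENNReal.ofReal ((1 - expNegInvGlue (a / (‖ζ‖ ^ 2 / 4))) / ‖ζ‖ ^ 2) := by
  have : 0 < ‖ζ‖ := norm_pos_iff.2 hζ
  have hweight (t : ℝ) : ENNReal.ofReal (t⁻¹ * gaussWeight t ζ) = ENNReal.ofReal (4 * Real.pi)⁻¹ *
      ENNReal.ofReal ((t ^ 2)⁻¹ * Real.exp (-(‖ζ‖ ^ 2 / 4 / t))) := by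
    rw [← ENNReal.ofReal_mul (by positivity), gaussWeight, div_div, mul_inv _ t]
    congr 1
    ring
  simp_rw [hweight]
  rw [lintegral_const_mul' _ _ ENNReal.ofReal_ne_top,
    lintegral_inv_sq_mul_exp_Ioi (by positivity) ha, ← ENNReal.ofReal_mul (by positivity),
    ← ENNReal.ofReal_mul (by positivity)]
  congr 1
  field_simp

/-- The Fourier transform `exp (-|ζ|² / 4N)` of the Gaussian `(N / π) exp (-N |x|²)`. -/
def smear (N : ℕ) : Plane → ℝ := gauss (4 * (N : ℝ))⁻¹

lemma smear_nonneg (N : ℕ) (ζ : Plane) : 0 ≤ smear N ζ := (gauss_pos _ _).le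

lemma smear_le_one (N : ℕ) (ζ : Plane) : smear N ζ ≤ 1 := by
  rw [smear, gauss, Real.exp_le_one_iff, Left.neg_nonpos_iff]
  positivity

@[fun_prop] lemma continuous_smear (N : ℕ) : Continuous (smear N) := continuous_gauss _

lemma lintegral_gaussWeight_Ioi {N : ℕ} (hN : 1 ≤ N) {ζ : Plane} (hζ : ζ ≠ 0) :
    ∫⁻ t in Set.Ioi (N : ℝ), ENNReal.ofReal (t⁻¹ * gaussWeight t ζ)
      = ENNReal.ofReal Real.pi⁻¹ * ENNReal.ofReal ((1 - smear N ζ) / ‖ζ‖ ^ 2) := by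
  have : 0 < ‖ζ‖ := norm_pos_iff.2 hζ
  rw [lintegral_inv_mul_gaussWeight_Ioi N.cast_nonneg hζ, expNegInvGlue_of_pos (by positivity),
    smear, gauss]
  congr 6
  field_simp

lemma lintegral_gaussWeight_Ioc {N : ℕ} (hN : 1 ≤ N) {ζ : Plane} (hζ : ζ ≠ 0) :
    ∫⁻ t in Set.Ioc 0 (N : ℝ), ENNReal.ofReal (t⁻¹ * gaussWeight t ζ)
      = ENNReal.ofReal Real.pi⁻¹ * ENNReal.ofReal (smear N ζ / ‖ζ‖ ^ 2) := by
  have htail_nonneg : 0 ≤ (1 - smear N ζ) / ‖ζ‖ ^ 2 :=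
    div_nonneg (sub_nonneg.2 (smear_le_one N ζ)) (by positivity)
  have hsplit : (∫⁻ t in Set.Ioc 0 (N : ℝ), ENNReal.ofReal (t⁻¹ * gaussWeight t ζ))
      + ENNReal.ofReal Real.pi⁻¹ * ENNReal.ofReal ((1 - smear N ζ) / ‖ζ‖ ^ 2)
      = ENNReal.ofReal Real.pi⁻¹ * ENNReal.ofReal (1 / ‖ζ‖ ^ 2) := by
    rw [← lintegral_gaussWeight_Ioi hN hζ, ← lintegral_union measurableSet_Ioi
      (Set.disjoint_left.2 fun t h h' => h.2.not_gt h'), Set.Ioc_union_Ioi_eq_Ioi N.cast_nonneg,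
      lintegral_inv_mul_gaussWeight_Ioi le_rfl hζ, zero_div, expNegInvGlue.zero, sub_zero]
  rw [ENNReal.eq_sub_of_add_eq (ENNReal.mul_ne_top ENNReal.ofReal_ne_top ENNReal.ofReal_ne_top)
    hsplit, ← ENNReal.mul_sub fun _ _ => ENNReal.ofReal_ne_top, ← ENNReal.ofReal_sub _ htail_nonneg]
  congr 2
  ring

lemma measurable_uncurry_gaussWeight : Measurable
    (Function.uncurry fun (t : ℝ) (ζ : Plane) => ENNReal.ofReal (t⁻¹ * gaussWeight t ζ)) := by
  unfold gaussWeight Function.uncurry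
  fun_prop

lemma ofReal_inv_mul_integral_gaussWeight {u : Plane → ℂ} (hu : Continuous u) {B : ℝ}
    (hB : ∀ ζ, ‖u ζ‖ ≤ B) {t : ℝ} (ht : 0 < t) :
    ENNReal.ofReal (t⁻¹ * ∫ ζ, gaussWeight t ζ * ‖u ζ‖ ^ 2)
      = ∫⁻ ζ, ENNReal.ofReal (t⁻¹ * gaussWeight t ζ) * ‖u ζ‖ₑ ^ 2 := by
  have hint : Integrable fun ζ => gaussWeight t ζ * ‖u ζ‖ ^ 2 :=
    (integrable_gaussWeight ht).mul_bdd (c := B ^ 2) (by fun_prop) (Eventually.of_forall fun ζ => by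
      rw [norm_pow, norm_norm]
      exact pow_le_pow_left₀ (norm_nonneg _) (hB ζ) 2)
  rw [← integral_const_mul, ofReal_integral_eq_lintegral_ofReal (hint.const_mul _)
    (Eventually.of_forall fun ζ => mul_nonneg (inv_nonneg.2 ht.le)
      (mul_nonneg (gaussWeight_nonneg ht ζ) (by positivity)))]
  congr 1 with ζ
  rw [← mul_assoc, ENNReal.ofReal_mul (mul_nonneg (inv_nonneg.2 ht.le) (gaussWeight_nonneg ht ζ)),
    ENNReal.ofReal_pow (norm_nonneg _), ofReal_norm]

lemma setLIntegral_inv_mul_integral_gaussWeight {u : Plane → ℂ} (hu : Continuous u) {B : ℝ}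
    (hB : ∀ ζ, ‖u ζ‖ ≤ B) {s : Set ℝ} (hs : MeasurableSet s) (hs0 : ∀ t ∈ s, 0 < t) :
    ∫⁻ t in s, ENNReal.ofReal (t⁻¹ * ∫ ζ, gaussWeight t ζ * ‖u ζ‖ ^ 2)
      = ∫⁻ ζ, (∫⁻ t in s, ENNReal.ofReal (t⁻¹ * gaussWeight t ζ)) * ‖u ζ‖ₑ ^ 2 := by
  have hm := measurable_uncurry_gaussWeight
  rw [setLIntegral_congr_fun hs fun t ht => ofReal_inv_mul_integral_gaussWeight hu hB (hs0 t ht),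
    lintegral_lintegral_swap
      (hm.mul ((hu.measurable.comp measurable_snd).enorm.pow_const 2)).aemeasurable]
  congr 1 with ζ
  exact lintegral_mul_const _ (hm.comp (measurable_id.prodMk measurable_const))

section TruncEnergy

variable {f : Plane → ℝ} (hf : Integrable f) {N : ℕ} (x : Fin N → Plane)
include hf

lemma setLIntegral_Ioc_truncEnergy :
    ∫⁻ t in Set.Ioc 0 (N : ℝ), ENNReal.ofReal (t⁻¹ * truncEnergy f x t)
      = ∫⁻ ζ, (∫⁻ t in Set.Ioc 0 (N : ℝ), ENNReal.ofReal (t⁻¹ * gaussWeight t ζ))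
        * ‖rft f ζ - empFt x ζ‖ₑ ^ 2 := by
  have hF : Continuous (rft f) := continuous_rft hf
  have hbound (ζ : Plane) : ‖rft f ζ - empFt x ζ‖ ≤ (∫ y, ‖(f y : ℂ)‖) + 1 :=
    (norm_sub_le _ _).trans (add_le_add (norm_ft_le _ ζ) (norm_empFt_le x ζ))
  rw [← setLIntegral_inv_mul_integral_gaussWeight (by fun_prop) hbound measurableSet_Ioc
    fun t ht => ht.1]
  refine setLIntegral_congr_fun measurableSet_Ioc fun t ht => ?_
  simp only [truncEnergy, if_pos ht.2, pairEnergy_gauss hf x ht.1]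

lemma setLIntegral_Ioi_truncEnergy :
    ∫⁻ t in Set.Ioi (N : ℝ), ENNReal.ofReal (t⁻¹ * truncEnergy f x t)
      = ∫⁻ ζ, (∫⁻ t in Set.Ioi (N : ℝ), ENNReal.ofReal (t⁻¹ * gaussWeight t ζ))
        * ‖rft f ζ‖ₑ ^ 2 := by
  have hpos (t : ℝ) (ht : t ∈ Set.Ioi (N : ℝ)) : 0 < t := N.cast_nonneg.trans_lt ht
  rw [← setLIntegral_inv_mul_integral_gaussWeight (continuous_rft hf) (fun ζ => norm_ft_le _ ζ)
    measurableSet_Ioi hpos]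
  refine setLIntegral_congr_fun measurableSet_Ioi fun t ht => ?_
  simp only [truncEnergy, if_neg (Set.mem_Ioi.1 ht).not_ge, selfEnergy_gauss hf (hpos t ht)]

lemma lintegral_truncEnergy_eq (hN : 1 ≤ N) :
    ∫⁻ t in Set.Ioi 0, ENNReal.ofReal (t⁻¹ * truncEnergy f x t)
      = ENNReal.ofReal Real.pi⁻¹ * ∫⁻ ζ, (ENNReal.ofReal (smear N ζ) * ‖rft f ζ - empFt x ζ‖ₑ ^ 2
        + ENNReal.ofReal (1 - smear N ζ) * ‖rft f ζ‖ₑ ^ 2) / ‖ζ‖ₑ ^ 2 := by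
  have hF : Continuous (rft f) := continuous_rft hf
  have hweight : Measurable fun ζ =>
      ∫⁻ t in Set.Ioc 0 (N : ℝ), ENNReal.ofReal (t⁻¹ * gaussWeight t ζ) :=
    Measurable.lintegral_prod_left' measurable_uncurry_gaussWeight
  have hmeas : Measurable fun ζ =>
      (∫⁻ t in Set.Ioc 0 (N : ℝ), ENNReal.ofReal (t⁻¹ * gaussWeight t ζ))
        * ‖rft f ζ - empFt x ζ‖ₑ ^ 2 := hweight.mul (by fun_prop)
  rw [← Set.Ioc_union_Ioi_eq_Ioi N.cast_nonneg, lintegral_union measurableSet_Ioi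
    (Set.disjoint_left.2 fun t h h' => h.2.not_gt h'), setLIntegral_Ioc_truncEnergy hf,
    setLIntegral_Ioi_truncEnergy hf, ← lintegral_add_left hmeas,
    ← lintegral_const_mul' _ _ ENNReal.ofReal_ne_top]
  refine lintegral_congr_ae ?_
  filter_upwards [Measure.ae_ne volume 0] with ζ hζ
  have : 0 < ‖ζ‖ := norm_pos_iff.2 hζ
  rw [lintegral_gaussWeight_Ioc hN hζ, lintegral_gaussWeight_Ioi hN hζ,
    ENNReal.ofReal_div_of_pos (by positivity), ENNReal.ofReal_div_of_pos (by positivity),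
    ENNReal.ofReal_pow (norm_nonneg _), ofReal_norm]
  simp only [div_eq_mul_inv]
  ring

end TruncEnergy

/-- The probability density `(N / π) exp (-N |x|²)`. -/
def bump (N : ℕ) : Plane → ℝ := gaussWeight (4 * (N : ℝ))⁻¹

section Bump

variable {N : ℕ} (hN : 1 ≤ N)
include hN

lemma integrable_bump : Integrable (bump N) := integrable_gaussWeight (by positivity)

lemma bump_nonneg (x : Plane) : 0 ≤ bump N x := gaussWeight_nonneg (by positivity) x

omit hN in
@[fun_prop] lemma continuous_bump : Continuous (bump N) := continuous_gaussWeight _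

lemma bump_eq (x : Plane) : bump N x = N / Real.pi * gauss N x := by
  rw [bump, gaussWeight_eq]
  congr 2 <;> field_simp

lemma integral_bump : ∫ x, bump N x = 1 := by
  have hN0 : (0 : ℝ) < N := by positivity
  simp_rw [bump_eq hN]
  rw [integral_const_mul, integral_gauss hN0]
  field_simp

lemma integral_chr_mul_bump (q ζ : Plane) :
    ∫ y, chr y ζ * bump N (y - q) = chr q ζ * smear N ζ := by
  have h := ft_comp_add_right (fun y => (bump N y : ℂ)) (-q) ζ
  rw [neg_neg] at h
  rw [smear, ofReal_gauss (by positivity)]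
  refine h.trans ?_
  rw [ft]
  congr 2 with y
  rw [chr_comm, mul_comm, bump]

lemma memLp_two_bump_sub (q : Plane) : MemLp (fun y => bump N (y - q)) 2 volume := by
  refine memLp_two_of_integrable_of_norm_le (C := N / Real.pi)
    ((integrable_bump hN).comp_sub_right q) fun y => ?_
  rw [Real.norm_of_nonneg (bump_nonneg hN _), bump_eq hN]
  refine mul_le_of_le_one_right (by positivity) ?_
  exact (le_abs_self _).trans (norm_gauss_le_one (by positivity) _)

end Bump

/-- `f` minus the empirical density of the points `x i`, smeared at the scale `N^(-1/2)`. -/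
def smeared (f : Plane → ℝ) {N : ℕ} (x : Fin N → Plane) (y : Plane) : ℝ :=
  f y - 1 / (N : ℝ) * ∑ i, bump N (y - x i)

section Smeared

variable {f : Plane → ℝ} {N : ℕ} (hN : 1 ≤ N) (x : Fin N → Plane)
include hN

lemma integrable_smeared (hf : Integrable f) : Integrable (smeared f x) :=
  hf.sub ((integrable_finsetSum _ fun i _ => (integrable_bump hN).comp_sub_right (x i)).const_mul _)

lemma memLp_two_smeared (hf : MemLp f 2 volume) : MemLp (smeared f x) 2 volume :=
  hf.sub ((memLp_finsetSum _ fun i _ => memLp_two_bump_sub hN (x i)).const_mul _)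

lemma integral_mul_smeared (hf : Integrable f) {φ : Plane → ℂ} (hφ : Continuous φ)
    (hφ1 : ∀ y, ‖φ y‖ ≤ 1) :
    ∫ y, φ y * smeared f x y
      = (∫ y, φ y * f y) - (1 / (N : ℝ)) • ∑ i, ∫ y, φ y * bump N (y - x i) := by
  have hmul {u : Plane → ℝ} (hu : Integrable u) : Integrable fun y => φ y * u y :=
    hu.ofReal.bdd_mul (c := 1) hφ.aestronglyMeasurable (Eventually.of_forall hφ1)
  have hbump (i : Fin N) : Integrable fun y => φ y * bump N (y - x i) :=
    hmul ((integrable_bump hN).comp_sub_right (x i))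
  rw [← integral_finsetSum _ fun i _ => hbump i, ← integral_smul, ← integral_sub (hmul hf)
    (by exact (integrable_finsetSum _ fun i _ => hbump i).smul (1 / (N : ℝ)))]
  congr 1 with y
  rw [smeared, Complex.real_smul, ← Finset.mul_sum]
  push_cast
  ring

lemma rft_smeared (hf : Integrable f) (ζ : Plane) :
    rft (smeared f x) ζ = rft f ζ - smear N ζ * empFt x ζ := by
  rw [rft, ft, integral_mul_smeared hN x hf (by fun_prop) (by simp), rft, ft, empFt]
  simp only [integral_chr_mul_bump hN, ← Finset.sum_mul, Complex.real_smul]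
  ring

end Smeared

lemma enorm_convex_comb_sq_le {θ : ℝ} (h0 : 0 ≤ θ) (h1 : θ ≤ 1) (a b : ℂ) :
    ‖θ * a + (1 - θ) * b‖ₑ ^ 2
      ≤ ENNReal.ofReal θ * ‖a‖ₑ ^ 2 + ENNReal.ofReal (1 - θ) * ‖b‖ₑ ^ 2 := by
  have h1' : 0 ≤ 1 - θ := sub_nonneg.2 h1
  have hconvex := (convexOn_pow (𝕜 := ℝ) 2).2 (norm_nonneg a) (norm_nonneg b) h0 h1' (by ring)
  have hnorm : ‖θ * a + (1 - θ) * b‖ ≤ θ * ‖a‖ + (1 - θ) * ‖b‖ := by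
    refine (norm_add_le _ _).trans_eq ?_
    rw [norm_mul, norm_mul, Complex.norm_of_nonneg h0, ← Complex.ofReal_one, ← Complex.ofReal_sub,
      Complex.norm_of_nonneg h1']
  simp only [← ofReal_norm, ← ENNReal.ofReal_pow (norm_nonneg _)]
  rw [← ENNReal.ofReal_mul h0, ← ENNReal.ofReal_mul h1', ← ENNReal.ofReal_add (by positivity)
    (by positivity)]
  exact ENNReal.ofReal_le_ofReal ((pow_le_pow_left₀ (norm_nonneg _) hnorm 2).trans hconvex)

section Coercivity

variable {f : Plane → ℝ} (hf : IsDensity f) (h1 : ∫ y, f y = 1) {N : ℕ} (hN : 1 ≤ N)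
  {x : Fin N → Plane} (hx : Function.Injective x)
include hf h1 hN hx

lemma renormEnergy_nonneg : 0 ≤ renormEnergy f x :=
  (renormEnergy_nonneg_and_lintegral_truncEnergy_le hf h1 hN hx).1

lemma hDotNegOneSq_smeared_le :
    hDotNegOneSq (fun y => (smeared f x y : ℂ))
      ≤ ENNReal.ofReal (4 * Real.pi ^ 2 * renormEnergy f x) := by
  have henergy := (renormEnergy_nonneg_and_lintegral_truncEnergy_le hf h1 hN hx).2
  rw [lintegral_truncEnergy_eq hf.integrable x hN] at henergy
  have hpi : 0 < Real.pi := Real.pi_pos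
  have hpointwise (ζ : Plane) : ‖rft (smeared f x) ζ‖ₑ ^ 2
      ≤ ENNReal.ofReal (smear N ζ) * ‖rft f ζ - empFt x ζ‖ₑ ^ 2
        + ENNReal.ofReal (1 - smear N ζ) * ‖rft f ζ‖ₑ ^ 2 := by
    refine le_trans (le_of_eq ?_)
      (enorm_convex_comb_sq_le (smear_nonneg N ζ) (smear_le_one N ζ) _ _)
    rw [rft_smeared hN x hf.integrable]
    congr 2
    ring
  calc hDotNegOneSq (fun y => (smeared f x y : ℂ))
      ≤ ∫⁻ ζ, (ENNReal.ofReal (smear N ζ) * ‖rft f ζ - empFt x ζ‖ₑ ^ 2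
        + ENNReal.ofReal (1 - smear N ζ) * ‖rft f ζ‖ₑ ^ 2) / ‖ζ‖ₑ ^ 2 :=
        lintegral_mono fun ζ => ENNReal.div_le_div_right (hpointwise ζ) _
    _ = ENNReal.ofReal Real.pi * (ENNReal.ofReal Real.pi⁻¹ *
        ∫⁻ ζ, (ENNReal.ofReal (smear N ζ) * ‖rft f ζ - empFt x ζ‖ₑ ^ 2
        + ENNReal.ofReal (1 - smear N ζ) * ‖rft f ζ‖ₑ ^ 2) / ‖ζ‖ₑ ^ 2) := by
        rw [← mul_assoc, ← ENNReal.ofReal_mul hpi.le, mul_inv_cancel₀ hpi.ne', ENNReal.ofReal_one,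
          one_mul]
    _ ≤ ENNReal.ofReal Real.pi * ENNReal.ofReal (4 * Real.pi * renormEnergy f x) := by gcongr
    _ = _ := by
        rw [← ENNReal.ofReal_mul hpi.le]
        congr 1
        ring

end Coercivity

/-! ### The correction constant and the modulated energy -/

lemma correctionSet_nonempty (M : ℝ) : (correctionSet M).Nonempty := by
  refine ⟨1 + |M|, by positivity, fun N X μ hN hX hμ h1 hM => ?_⟩
  have hE : 0 ≤ renormEnergy μ X := renormEnergy_nonneg hμ h1 hN hX
  have hle : (1 + M) / (N : ℝ) ≤ (1 + |M|) / N := by gcongr; exact le_abs_self M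
  rw [renormEnergy, hM] at hE
  linarith

lemma correction_nonneg (M : ℝ) : 0 ≤ correction M := Real.sInf_nonneg fun _ hb => hb.1

lemma offDiagEnergy_add_correction_nonneg {N : ℕ} {X : Fin N → Plane} {μ : Plane → ℝ} (hN : 1 ≤ N)
    (hX : Function.Injective X) (hμ : IsDensity μ) (h1 : ∫ x, μ x = 1) :
    0 ≤ offDiagEnergy (density μ - empirical X) + correction (normLinf μ) / N
      + Real.log N / (2 * N) := by
  have hN0 : (0 : ℝ) < N := by positivity
  have h : -(offDiagEnergy (density μ - empirical X) + Real.log N / (2 * N)) * N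
      ≤ correction (normLinf μ) := by
    refine le_csInf (correctionSet_nonempty _) fun b hb => ?_
    rw [← le_div_iff₀ hN0]
    linarith [hb.2 N X μ hN hX hμ h1 rfl]
  rw [← le_div_iff₀ hN0] at h
  linarith

section IsDensity

variable {f g h : Plane → ℝ}

lemma IsDensity.add (hf : IsDensity f) (hg : IsDensity g) : IsDensity (fun x => f x + g x) where
  memLp_one := hf.memLp_one.add hg.memLp_one
  memLp_top := hf.memLp_top.add hg.memLp_top
  compact := HasCompactSupport.add hf.compact hg.compact

lemma IsDensity.sub (hf : IsDensity f) (hg : IsDensity g) : IsDensity (fun x => f x - g x) where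
  memLp_one := hf.memLp_one.sub hg.memLp_one
  memLp_top := hf.memLp_top.sub hg.memLp_top
  compact := by exact HasCompactSupport.sub hf.compact hg.compact

lemma IsDensity.memLp_two (hf : IsDensity f) : MemLp f 2 volume :=
  memLp_two_of_memLp_one_of_memLp_top hf.memLp_one hf.memLp_top

lemma normLinf_add_sub_le (hf : IsDensity f) (hg : IsDensity g) (hh : IsDensity h) :
    normLinf (fun x => f x + g x - h x) ≤ normLinf f + normLinf g + normLinf h := by
  have hf := hf.memLp_top
  have hg := hg.memLp_top
  have hh := hh.memLp_top
  unfold normLinf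
  rw [← ENNReal.toReal_add hf.2.ne hg.2.ne,
    ← ENNReal.toReal_add (ENNReal.add_ne_top.2 ⟨hf.2.ne, hg.2.ne⟩) hh.2.ne]
  refine ENNReal.toReal_mono (by finiteness [hf.2.ne, hg.2.ne, hh.2.ne]) ?_
  calc _ ≤ eLpNorm (fun x => f x + g x) ∞ volume + eLpNorm h ∞ volume :=
        eLpNorm_sub_le (hf.1.add hg.1) hh.1 le_top
    _ ≤ _ := by gcongr; exact eLpNorm_add_le hf.1 hg.1 le_top

end IsDensity

/-- The part `(1 / N) ∑ᵢ |v(qᵢ) - pᵢ|²` of the modulated energy. -/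
def kinetic (v : Plane → Plane) {N : ℕ} (Q P : Fin N → Plane) : ℝ :=
  1 / (N : ℝ) * ∑ i, ‖v (Q i) - P i‖ ^ 2

lemma kinetic_nonneg (v : Plane → Plane) {N : ℕ} (Q P : Fin N → Plane) : 0 ≤ kinetic v Q P := by
  unfold kinetic; positivity

section ModulatedEnergy

variable {ω ρ ωN : Plane → ℝ} {N : ℕ} {Q : Fin N → Plane}

lemma kinetic_add_sq_le_modulatedEnergy (v : Plane → Plane) (P : Fin N → Plane)
    (hω : IsDensity ω) (hρ : IsDensity ρ) (hωN : IsDensity ωN)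
    (h1 : ∫ x, (ρ x + ω x - ωN x) = 1) (hN : 1 ≤ N) (hQ : Function.Injective Q) :
    kinetic v Q P + (eLpNorm (fun x => ω x - ωN x) 2 volume).toReal ^ 2
      ≤ modulatedEnergy ω ρ v ωN Q P := by
  have := offDiagEnergy_add_correction_nonneg hN hQ ((hρ.add hω).sub hωN) h1
  unfold modulatedEnergy kinetic
  linarith

lemma kinetic_add_sq_add_renormEnergy_le (v : Plane → Plane) (Q P : Fin N → Plane)
    (hω : IsDensity ω) (hρ : IsDensity ρ) (hωN : IsDensity ωN) {M : ℝ} (hM : normLinf ω ≤ M)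
    (hM' : normLinf ωN ≤ M) :
    kinetic v Q P + (eLpNorm (fun x => ω x - ωN x) 2 volume).toReal ^ 2
        + renormEnergy (fun x => ρ x + ω x - ωN x) Q
      ≤ modulatedEnergy ω ρ v ωN Q P + (1 + 2 * M) * ((1 + normLinf ρ) / N) := by
  have hM0 : 0 ≤ M := (normLinf_nonneg ω).trans hM
  have hnorm : (1 + normLinf (fun x => ρ x + ω x - ωN x)) / (N : ℝ)
      ≤ (1 + 2 * M) * ((1 + normLinf ρ) / N) := by
    rw [← mul_div_assoc]
    gcongr
    nlinarith [normLinf_add_sub_le hρ hω hωN, mul_nonneg hM0 (normLinf_nonneg ρ)]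
  have hcorr : 0 ≤ correction (normLinf (fun x => ρ x + ω x - ωN x)) / N :=
    div_nonneg (correction_nonneg _) (Nat.cast_nonneg _)
  unfold modulatedEnergy renormEnergy
  rw [← kinetic]
  linarith

end ModulatedEnergy

/-! ### Functions with bounded weak derivative -/

section HasWeakFDeriv

variable {F : Type*} [NormedAddCommGroup F] [NormedSpace ℝ F] {u : Plane → F}
  {u' : Plane → Plane →L[ℝ] F}

lemma norm_integral_normed_smul_le (φ : ContDiffBump (0 : Plane)) (hD : MemLp u' ∞ volume)
    (z e : Plane) : ‖∫ s, φ.normed volume (z - s) • u' s e‖ ≤ normLinf u' * ‖e‖ := by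
  have hi : Integrable (fun s => φ.normed volume (z - s)) := φ.integrable_normed.comp_sub_left z
  calc _ ≤ ∫ s, φ.normed volume (z - s) * (normLinf u' * ‖e‖) := by
        refine norm_integral_le_of_norm_le (hi.mul_const _) ?_
        filter_upwards [ae_norm_le_normLinf hD] with s hs
        rw [norm_smul, Real.norm_of_nonneg (φ.nonneg_normed _)]
        gcongr
        · exact φ.nonneg_normed _
        · exact (u' s).le_of_opNorm_le hs e
    _ = _ := by
        rw [integral_mul_const, integral_sub_left_eq_self (fun s => φ.normed volume s),
          φ.integral_normed, one_mul]

lemma fderiv_comp_const_sub_apply {φ : Plane → ℝ} (hφ : Differentiable ℝ φ) (z s e : Plane) :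
    fderiv ℝ (fun s => φ (z - s)) s e = -fderiv ℝ φ (z - s) e := by
  have h : HasFDerivAt (fun s => φ (z - s)) _ s :=
    (hφ (z - s)).hasFDerivAt.comp s ((hasFDerivAt_id s).const_sub z)
  simp [h.fderiv]

open Convolution in
lemma HasWeakFDeriv.hasFDerivAt_mollify (hw : HasWeakFDeriv u u') (φ : ContDiffBump (0 : Plane))
    (z : Plane) :
    ∃ A : Plane →L[ℝ] F, HasFDerivAt
      (φ.normed volume ⋆[ContinuousLinearMap.lsmul ℝ ℝ, volume] u) A z ∧
      ∀ e, A e = ∫ s, φ.normed volume (z - s) • u' s e := by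
  have hc := φ.hasCompactSupport_normed (μ := volume)
  have hs : ContDiff ℝ (⊤ : ℕ∞) (φ.normed volume) := φ.contDiff_normed
  refine ⟨_, hc.hasFDerivAt_convolution_left (ContinuousLinearMap.lsmul ℝ ℝ)
    (hs.of_le (by exact_mod_cast le_top)) hw.1 z, fun e => ?_⟩
  have h := hw.2.2 (fun s => φ.normed volume (z - s)) (by fun_prop)
    (hc.comp_homeomorph (Homeomorph.subLeft z)) e
  simp only [fderiv_comp_const_sub_apply (hs.differentiable (by simp)), neg_smul, integral_neg,
    neg_inj] at h
  rw [← h, ← integral_sub_left_eq_self _ volume z, convolution_def,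
    ContinuousLinearMap.integral_apply]
  · congr 1; ext s; simp
  · exact HasCompactSupport.convolutionExists_left _ (hc.fderiv ℝ)
      (hs.continuous_fderiv (by simp)) hw.1 z

lemma HasWeakFDeriv.norm_sub_le [CompleteSpace F] (hw : HasWeakFDeriv u u') (hu : Continuous u)
    (hD : MemLp u' ∞ volume) (x y : Plane) : ‖u x - u y‖ ≤ normLinf u' * ‖x - y‖ := by
  let φ : ℕ → ContDiffBump (0 : Plane) := fun n =>
    ⟨1 / ((n : ℝ) + 1) / 2, 1 / ((n : ℝ) + 1), by positivity, half_lt_self (by positivity)⟩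
  have hφ : Tendsto (fun n => (φ n).rOut) atTop (𝓝 0) := tendsto_one_div_add_atTop_nhds_zero_nat
  have hlim := fun z =>
    ContDiffBump.convolution_tendsto_right_of_continuous hφ hu z (μ := volume)
  refine le_of_tendsto ((hlim x).sub (hlim y)).norm (Eventually.of_forall fun n => ?_)
  choose A hA hA' using hw.hasFDerivAt_mollify (φ n)
  refine convex_univ.norm_image_sub_le_of_norm_hasFDerivWithin_le
    (fun z _ => (hA z).hasFDerivWithinAt) (fun z _ => ?_) trivial trivial
  refine ContinuousLinearMap.opNorm_le_bound _ (normLinf_nonneg _) fun e => ?_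
  rw [hA']
  exact norm_integral_normed_smul_le _ hD z e

end HasWeakFDeriv

lemma gradNorm_nonneg (Dv : Plane → Plane →L[ℝ] Plane)
    (D2v : Plane → Plane →L[ℝ] Plane →L[ℝ] Plane) : 0 ≤ gradNorm Dv D2v :=
  add_nonneg (normLinf_nonneg _) (normLinf_nonneg _)

lemma IsW2Inf.lipschitzWith {v : Plane → Plane} {Dv : Plane → Plane →L[ℝ] Plane}
    {D2v : Plane → Plane →L[ℝ] Plane →L[ℝ] Plane} (hv : IsW2Inf v Dv D2v) :
    LipschitzWith (gradNorm Dv D2v).toNNReal v :=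
  LipschitzWith.of_dist_le_mul fun x y => by
    rw [dist_eq_norm, dist_eq_norm, Real.coe_toNNReal _ (gradNorm_nonneg Dv D2v)]
    exact (hv.weak_deriv.norm_sub_le hv.cont hv.memLp_deriv x y).trans
      (mul_le_mul_of_nonneg_right (le_add_of_nonneg_right (normLinf_nonneg D2v)) (norm_nonneg _))

/-! ### The monokinetic defect in Fourier variables -/

section BumpMoment

variable {N : ℕ} (hN : 1 ≤ N)
include hN

lemma bump_mul_norm_le (z : Plane) :
    bump N z * ‖z‖ ≤ N / Real.pi * (Real.sqrt N)⁻¹ * gauss (N / 2) z := by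
  have hs : 0 < Real.sqrt N := Real.sqrt_pos.2 (by positivity)
  have hsq : (Real.sqrt N * ‖z‖) ^ 2 = ‖z‖ ^ 2 * N := by
    rw [mul_pow, Real.sq_sqrt N.cast_nonneg, mul_comm]
  have hexp : Real.sqrt N * ‖z‖ ≤ Real.exp (‖z‖ ^ 2 * (N / 2)) := by
    nlinarith [Real.add_one_le_exp (‖z‖ ^ 2 * (N / 2 : ℝ)), sq_nonneg (Real.sqrt N * ‖z‖ - 1)]
  have := Real.pi_pos
  rw [bump_eq hN, mul_assoc, mul_assoc]
  refine mul_le_mul_of_nonneg_left ?_ (by positivity)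
  rw [inv_mul_eq_div, le_div_iff₀ hs, gauss, gauss]
  calc Real.exp (-(‖z‖ ^ 2 * N)) * ‖z‖ * Real.sqrt N
      = Real.exp (-(‖z‖ ^ 2 * N)) * (Real.sqrt N * ‖z‖) := by ring
    _ ≤ Real.exp (-(‖z‖ ^ 2 * N)) * Real.exp (‖z‖ ^ 2 * (N / 2)) := by gcongr
    _ = _ := by rw [← Real.exp_add]; congr 1; ring

lemma integrable_bump_mul_norm : Integrable (fun z => bump N z * ‖z‖) := by
  refine ((integrable_gauss (t := N / 2) (by positivity)).const_mul
    (N / Real.pi * (Real.sqrt N)⁻¹)).mono' (by fun_prop) (Eventually.of_forall fun z => ?_)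
  rw [Real.norm_of_nonneg (mul_nonneg (bump_nonneg hN z) (norm_nonneg z))]
  exact bump_mul_norm_le hN z

lemma integral_bump_mul_norm_le : ∫ z, bump N z * ‖z‖ ≤ 2 / Real.sqrt N := by
  have hg : Integrable (gauss (N / 2)) := integrable_gauss (by positivity)
  refine (integral_mono (integrable_bump_mul_norm hN) (hg.const_mul _)
    (bump_mul_norm_le hN)).trans_eq ?_
  have := Real.pi_pos
  rw [integral_const_mul, integral_gauss (by positivity)]
  field_simp

lemma norm_sub_integral_mul_bump_le {φ : Plane → ℂ} {L : ℝ≥0} (hφ : LipschitzWith L φ)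
    (hφ1 : ∀ y, ‖φ y‖ ≤ 1) (q : Plane) :
    ‖φ q - ∫ y, φ y * bump N (y - q)‖ ≤ L * (2 / Real.sqrt N) := by
  have hbump : Integrable fun y => (bump N (y - q) : ℂ) :=
    ((integrable_bump hN).comp_sub_right q).ofReal
  have hq : φ q = ∫ y, φ q * bump N (y - q) := by
    rw [integral_const_mul, integral_complex_ofReal, integral_sub_right_eq_self (bump N) q,
      integral_bump hN, Complex.ofReal_one, mul_one]
  conv_lhs => rw [hq]
  rw [← integral_sub (hbump.const_mul _)
    (hbump.bdd_mul hφ.continuous.aestronglyMeasurable (Eventually.of_forall hφ1))]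
  calc _ ≤ ∫ y, L * (bump N (y - q) * ‖y - q‖) := by
        refine norm_integral_le_of_norm_le
          (((integrable_bump_mul_norm hN).comp_sub_right q).const_mul _)
          (Eventually.of_forall fun y => ?_)
        rw [← sub_mul, norm_mul, Complex.norm_of_nonneg (bump_nonneg hN _), norm_sub_rev y q,
          mul_comm (bump N _), ← mul_assoc]
        gcongr
        · exact bump_nonneg hN _
        · exact hφ.norm_sub_le q y
    _ ≤ _ := by
        rw [integral_const_mul, integral_sub_right_eq_self (fun z => bump N z * ‖z‖) q]
        gcongr
        exact integral_bump_mul_norm_le hN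

lemma avg_sub_integral_eq {f ρ u : Plane → ℝ} (hf : Integrable f) (hu : Integrable u)
    (hρ : ∀ y, ρ y = f y - u y) {φ : Plane → ℂ} (hφ : Continuous φ) (hφ1 : ∀ y, ‖φ y‖ ≤ 1)
    (x : Fin N → Plane) (a : Fin N → ℂ) :
    (1 / (N : ℝ)) • ∑ i, a i - ∫ y, φ y * ρ y
      = (1 / (N : ℝ)) • ∑ i, (a i - ∫ y, φ y * bump N (y - x i))
        - (∫ y, φ y * smeared f x y) + ∫ y, φ y * u y := by
  have hmul {w : Plane → ℝ} (hw : Integrable w) : Integrable fun y => φ y * w y :=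
    hw.ofReal.bdd_mul (c := 1) hφ.aestronglyMeasurable (Eventually.of_forall hφ1)
  have hsplit : ∫ y, φ y * ρ y = (∫ y, φ y * f y) - ∫ y, φ y * u y := by
    rw [← integral_sub (hmul hf) (hmul hu)]
    congr 1 with y
    rw [hρ]
    push_cast
    ring
  rw [hsplit, integral_mul_smeared hN x hf hφ hφ1, Finset.sum_sub_distrib, smul_sub]
  ring

end BumpMoment

section GraphMap

variable {G : ℝ≥0} {v : Plane → Plane}

lemma norm_phase_sq (ζ : Phase) : ‖ζ‖ ^ 2 = ‖ζ.fst‖ ^ 2 + ‖ζ.snd‖ ^ 2 :=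
  WithLp.prod_norm_sq_eq_of_L2 ζ

lemma lipschitzWith_graphMap (hv : LipschitzWith G v) :
    LipschitzWith (NNReal.sqrt (1 + G ^ 2)) (graphMap v) :=
  LipschitzWith.of_dist_le_mul fun x y => by
    have hvxy : ‖v x - v y‖ ≤ G * ‖x - y‖ := hv.norm_sub_le x y
    rw [dist_eq_norm, dist_eq_norm, Real.coe_sqrt]
    refine le_of_sq_le_sq ?_ (by positivity)
    rw [norm_phase_sq, mul_pow, Real.sq_sqrt (by positivity)]
    calc ‖x - y‖ ^ 2 + ‖v x - v y‖ ^ 2 ≤ ‖x - y‖ ^ 2 + (G * ‖x - y‖) ^ 2 := by gcongr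
      _ = _ := by push_cast; ring

lemma lipschitzWith_chr_comp {E : Type*} [NormedAddCommGroup E] [InnerProductSpace ℝ E]
    {w : Plane → E} {L : ℝ≥0} (hw : LipschitzWith L w) (ζ : E) :
    LipschitzWith (L * ‖ζ‖₊) fun x => chr (w x) ζ :=
  LipschitzWith.of_dist_le_mul fun x y => by
    rw [dist_eq_norm, dist_eq_norm]
    calc _ ≤ ‖w x - w y‖ * ‖ζ‖ := norm_chr_sub_le _ _ _
      _ ≤ L * ‖x - y‖ * ‖ζ‖ := by gcongr; exact hw.norm_sub_le x y
      _ = _ := by push_cast; ring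

lemma graphFt_eq_ft (v : Plane → Plane) (u : Plane → ℝ) (ζ : Phase) :
    graphFt v u ζ = ft (fun x => chr (v x) ζ.snd * u x) ζ.fst := by
  have h (x : Plane) : chr (graphMap v x) ζ = chr x ζ.fst * chr (v x) ζ.snd := by
    simp only [chr, ← Complex.exp_add, graphMap, WithLp.prod_inner_apply, WithLp.fst, WithLp.snd]
    push_cast
    ring_nf
  simp only [graphFt, ft, h, mul_assoc]

lemma continuous_graphFt (hv : Continuous v) {u : Plane → ℝ} (hu : Integrable u) :
    Continuous (graphFt v u) := by
  have := continuous_graphMap hv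
  refine continuous_of_dominated (bound := fun x => ‖u x‖) (fun ζ => ?_)
    (fun ζ => Eventually.of_forall fun x => by simp) hu.norm
    (Eventually.of_forall fun x => by fun_prop)
  exact (by fun_prop : Continuous fun x => chr (graphMap v x) ζ).aestronglyMeasurable.mul
    hu.ofReal.aestronglyMeasurable

end GraphMap

lemma norm_avg_sq_le {N : ℕ} (a : Fin N → ℂ) :
    ‖(1 / (N : ℝ)) • ∑ i, a i‖ ^ 2 ≤ 1 / (N : ℝ) * ∑ i, ‖a i‖ ^ 2 := by
  rcases N.eq_zero_or_pos with rfl | hN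
  · simp
  rw [norm_smul, mul_pow, Real.norm_of_nonneg (by positivity)]
  have hcauchy := sq_sum_le_card_mul_sum_sq (s := Finset.univ) (f := fun i => ‖a i‖)
  rw [Finset.card_univ, Fintype.card_fin] at hcauchy
  calc _ ≤ (1 / (N : ℝ)) ^ 2 * (∑ i, ‖a i‖) ^ 2 := by gcongr; exact norm_sum_le _ _
    _ ≤ (1 / (N : ℝ)) ^ 2 * (N * ∑ i, ‖a i‖ ^ 2) := by gcongr
    _ = _ := by field_simp

section Defect

variable {G : ℝ≥0} {v : Plane → Plane} (hv : LipschitzWith G v) {N : ℕ} (hN : 1 ≤ N)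
include hv hN

lemma norm_chr_sub_integral_chr_mul_bump_le (q p : Plane) (ζ : Phase) :
    ‖chr (WithLp.toLp 2 (q, p)) ζ - ∫ y, chr (graphMap v y) ζ * bump N (y - q)‖
      ≤ ‖ζ‖ * (‖v q - p‖ + Real.sqrt (1 + G ^ 2) * (2 / Real.sqrt N)) := by
  have hp : ‖chr (WithLp.toLp 2 (q, p)) ζ - chr (graphMap v q) ζ‖ ≤ ‖v q - p‖ * ‖ζ‖ := by
    have hnorm : ‖(WithLp.toLp 2 (q, p) : Phase) - graphMap v q‖ = ‖v q - p‖ := by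
      rw [← sq_eq_sq₀ (norm_nonneg _) (norm_nonneg _), norm_phase_sq, norm_sub_rev (v q)]
      simp [graphMap]
    exact (norm_chr_sub_le _ _ ζ).trans_eq (by rw [hnorm])
  have hq := norm_sub_integral_mul_bump_le hN (lipschitzWith_chr_comp (lipschitzWith_graphMap hv) ζ)
    (by simp) q
  push_cast at hq
  calc _ ≤ ‖v q - p‖ * ‖ζ‖ + Real.sqrt (1 + G ^ 2) * ‖ζ‖ * (2 / Real.sqrt N) :=
        (norm_sub_le_norm_sub_add_norm_sub _ _ _).trans (add_le_add hp hq)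
    _ = _ := by ring

lemma norm_avg_chr_sub_integral_sq_le (Q P : Fin N → Plane) (ζ : Phase) :
    ‖(1 / (N : ℝ)) • ∑ i, (chr (WithLp.toLp 2 (Q i, P i)) ζ
        - ∫ y, chr (graphMap v y) ζ * bump N (y - Q i))‖ ^ 2
      ≤ ‖ζ‖ ^ 2 * (2 * (kinetic v Q P + (1 + G ^ 2) * (4 / N))) := by
  have hN0 : (0 : ℝ) < N := by positivity
  refine (norm_avg_sq_le _).trans ?_
  calc _ ≤ 1 / (N : ℝ) * ∑ i, ‖ζ‖ ^ 2 * (2 * (‖v (Q i) - P i‖ ^ 2 + (1 + G ^ 2) * (4 / N))) := by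
        gcongr with i
        refine (pow_le_pow_left₀ (norm_nonneg _)
          (norm_chr_sub_integral_chr_mul_bump_le hv hN (Q i) (P i) ζ) 2).trans ?_
        rw [mul_pow]
        gcongr
        refine add_sq_le.trans_eq ?_
        rw [mul_pow, div_pow, Real.sq_sqrt (by positivity), Real.sq_sqrt hN0.le]
        norm_num
    _ = _ := by
        rw [← Finset.mul_sum, ← Finset.mul_sum, Finset.sum_add_distrib, Finset.sum_const,
          Finset.card_univ, Fintype.card_fin, nsmul_eq_mul, kinetic]
        field_simp

lemma fourierMeasure_defect_eq {f ρ u : Plane → ℝ} (hρ : Integrable ρ) (hf : Integrable f)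
    (hu : Integrable u) (hfu : ∀ y, ρ y = f y - u y) (Q P : Fin N → Plane) (ζ : Phase) :
    fourierMeasure (empirical (fun i => (WithLp.toLp 2 (Q i, P i) : Phase)) - monokinetic ρ v) ζ
      = (1 / (N : ℝ)) • ∑ i, (chr (WithLp.toLp 2 (Q i, P i)) ζ
          - ∫ y, chr (graphMap v y) ζ * bump N (y - Q i))
        - graphFt v (smeared f Q) ζ + graphFt v u ζ := by
  have := continuous_graphMap hv.continuous
  rw [fourierMeasure_sub, fourierMeasure_empirical, fourierMeasure_monokinetic hρ hv.continuous]
  exact avg_sub_integral_eq hN hf hu hfu (by fun_prop) (by simp) Q _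

end Defect

section PhaseWeight

/-- The mass `∫ (1 + |ζ|²)⁻² dζ` of the Bessel weight on the plane. -/
def besselMass : ℝ≥0∞ := ∫⁻ ζ : Plane, ENNReal.ofReal (bessel ζ)

lemma finrank_plane : Module.finrank ℝ Plane = 2 := finrank_euclideanSpace_fin

lemma besselMass_ne_top : besselMass ≠ ∞ :=
  (integrable_bessel (by rw [finrank_plane]; norm_num)).lintegral_lt_top.ne

lemma lintegral_phase_le (F : Plane → Plane → ℝ≥0∞) :
    ∫⁻ ζ : Phase, F ζ.fst ζ.snd ≤ ∫⁻ η, ∫⁻ ξ, F ξ η := by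
  calc ∫⁻ ζ : Phase, F ζ.fst ζ.snd = ∫⁻ z : Plane × Plane, F z.1 z.2 :=
        (WithLp.volume_preserving_ofLp Plane Plane).lintegral_comp_emb
          (MeasurableEquiv.toLp 2 (Plane × Plane)).symm.measurableEmbedding fun z => F z.1 z.2
    _ ≤ _ := by
        rw [Measure.volume_eq_prod, ← lintegral_prod_swap]
        exact lintegral_prod_le _

lemma rpow_neg_five (ζ : Phase) :
    (1 + ‖ζ‖ ^ 2) ^ (-5 : ℝ) = ((1 + (‖ζ.fst‖ ^ 2 + ‖ζ.snd‖ ^ 2)) ^ 5)⁻¹ := by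
  rw [Real.rpow_neg (by positivity), norm_phase_sq]
  norm_cast

lemma weight_mul_norm_sq_le (ζ : Phase) :
    (1 + ‖ζ‖ ^ 2) ^ (-5 : ℝ) * ‖ζ‖ ^ 2 ≤ bessel ζ.fst * bessel ζ.snd := by
  rw [rpow_neg_five, norm_phase_sq, bessel, bessel, ← mul_inv, inv_mul_le_iff₀ (by positivity),
    ← div_eq_mul_inv, le_div_iff₀ (by positivity)]
  set a := ‖ζ.fst‖ ^ 2
  set b := ‖ζ.snd‖ ^ 2
  have ha : 0 ≤ a := sq_nonneg _
  have hb : 0 ≤ b := sq_nonneg _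
  calc (a + b) * ((1 + a) ^ 2 * (1 + b) ^ 2)
      ≤ (1 + (a + b)) * ((1 + (a + b)) ^ 2 * (1 + (a + b)) ^ 2) :=
        mul_le_mul (by linarith) (by gcongr <;> linarith) (by positivity) (by positivity)
    _ = _ := by ring

lemma weight_le (ζ : Phase) :
    (1 + ‖ζ‖ ^ 2) ^ (-5 : ℝ) ≤ bessel ζ.snd * ((1 + ‖ζ.snd‖ ^ 2)⁻¹ * bessel ζ.fst) := by
  rw [rpow_neg_five, bessel, bessel, ← mul_inv, ← mul_inv]
  set a := ‖ζ.fst‖ ^ 2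
  set b := ‖ζ.snd‖ ^ 2
  have ha : 0 ≤ a := sq_nonneg _
  have hb : 0 ≤ b := sq_nonneg _
  gcongr
  calc (1 + b) ^ 2 * ((1 + b) * (1 + a) ^ 2)
      ≤ (1 + (a + b)) ^ 2 * ((1 + (a + b)) * (1 + (a + b)) ^ 2) := by gcongr <;> linarith
    _ = _ := by ring

lemma lintegral_weight_mul_norm_sq_le :
    ∫⁻ ζ : Phase, ENNReal.ofReal ((1 + ‖ζ‖ ^ 2) ^ (-5 : ℝ)) * ‖ζ‖ₑ ^ 2 ≤ besselMass ^ 2 := by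
  calc _ ≤ ∫⁻ ζ : Phase, ENNReal.ofReal (bessel ζ.fst) * ENNReal.ofReal (bessel ζ.snd) := by
        refine lintegral_mono fun ζ => ?_
        rw [← ofReal_norm, ← ENNReal.ofReal_pow (norm_nonneg _),
          ← ENNReal.ofReal_mul (by positivity), ← ENNReal.ofReal_mul (bessel_pos _).le]
        exact ENNReal.ofReal_le_ofReal (weight_mul_norm_sq_le ζ)
    _ ≤ ∫⁻ η : Plane, ∫⁻ ξ : Plane, ENNReal.ofReal (bessel ξ) * ENNReal.ofReal (bessel η) :=
        lintegral_phase_le fun ξ η => ENNReal.ofReal (bessel ξ) * ENNReal.ofReal (bessel η)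
    _ = besselMass ^ 2 := by
        simp_rw [lintegral_mul_const' _ _ ENNReal.ofReal_ne_top]
        rw [lintegral_const_mul _ (by fun_prop), sq, besselMass]

lemma lintegral_weight_mul_le {F : Plane → Plane → ℝ≥0∞} {A : ℝ≥0∞}
    (hF : ∀ η, ∫⁻ ξ, ENNReal.ofReal (bessel ξ) * F ξ η ≤ (1 + ‖η‖ₑ ^ 2) * A) :
    ∫⁻ ζ : Phase, ENNReal.ofReal ((1 + ‖ζ‖ ^ 2) ^ (-5 : ℝ)) * F ζ.fst ζ.snd ≤ besselMass * A := by
  set w : Plane → ℝ≥0∞ := fun η => ENNReal.ofReal (1 + ‖η‖ ^ 2)⁻¹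
  have hw_mul (η : Plane) : w η * (1 + ‖η‖ₑ ^ 2) = 1 := by
    rw [← ofReal_norm, ← ENNReal.ofReal_pow (norm_nonneg η), ← ENNReal.ofReal_one,
      ← ENNReal.ofReal_add zero_le_one (sq_nonneg _), ← ENNReal.ofReal_mul (by positivity),
      inv_mul_cancel₀ (by positivity)]
  calc _ ≤ ∫⁻ ζ : Phase, ENNReal.ofReal (bessel ζ.snd) *
        (w ζ.snd * (ENNReal.ofReal (bessel ζ.fst) * F ζ.fst ζ.snd)) := by
        refine lintegral_mono fun ζ => ?_
        rw [← mul_assoc, ← mul_assoc, mul_assoc (ENNReal.ofReal _),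
          ← ENNReal.ofReal_mul (by positivity), ← ENNReal.ofReal_mul (bessel_pos _).le]
        gcongr
        exact weight_le ζ
    _ ≤ ∫⁻ η, ∫⁻ ξ, ENNReal.ofReal (bessel η) * (w η * (ENNReal.ofReal (bessel ξ) * F ξ η)) :=
        lintegral_phase_le fun ξ η =>
          ENNReal.ofReal (bessel η) * (w η * (ENNReal.ofReal (bessel ξ) * F ξ η))
    _ ≤ ∫⁻ η : Plane, ENNReal.ofReal (bessel η) * A := by
        gcongr with η
        rw [lintegral_const_mul' _ _ ENNReal.ofReal_ne_top,
          lintegral_const_mul' _ _ ENNReal.ofReal_ne_top]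
        gcongr
        calc _ ≤ w η * ((1 + ‖η‖ₑ ^ 2) * A) := by gcongr; exact hF η
          _ = A := by rw [← mul_assoc, hw_mul, one_mul]
    _ = besselMass * A := lintegral_mul_const _ (by fun_prop)

end PhaseWeight

section GraphFt

variable {G : ℝ≥0} {v : Plane → Plane} {u : Plane → ℝ} (hv : LipschitzWith G v)
  (hu : Integrable u) (hu2 : MemLp u 2 volume)
include hv hu hu2

lemma lintegral_weight_mul_graphFt_le_hDotNegOneSq :
    ∫⁻ ζ : Phase, ENNReal.ofReal ((1 + ‖ζ‖ ^ 2) ^ (-5 : ℝ)) * ‖graphFt v u ζ‖ₑ ^ 2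
      ≤ besselMass * (8 * (1 + G ^ 2) * hDotNegOneSq fun x => (u x : ℂ)) := by
  simp_rw [graphFt_eq_ft]
  refine lintegral_weight_mul_le
    (F := fun ξ η => ‖ft (fun x => chr (v x) η * u x) ξ‖ₑ ^ 2) fun η => ?_
  have hbessel := lintegral_bessel_mul_ft_mul_le (by rw [finrank_plane]; norm_num) hu.ofReal
    hu2.ofReal (w := fun x => chr (v x) η) (by simp) (lipschitzWith_chr_comp hv η)
  rw [finrank_plane] at hbessel
  have hconst : 2 * 2 * (1 + (G * ‖η‖₊ + 1) ^ 2) ≤ (1 + ‖η‖₊ ^ 2) * (8 * (1 + G ^ 2)) := by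
    rw [← NNReal.coe_le_coe]
    push_cast
    nlinarith [sq_nonneg ((G : ℝ) - ‖η‖), sq_nonneg ((G : ℝ) * ‖η‖ - 1), sq_nonneg (G : ℝ),
      sq_nonneg ‖η‖]
  refine hbessel.trans ?_
  rw [← mul_assoc]
  refine mul_le_mul' ?_ le_rfl
  simp only [enorm]
  exact_mod_cast hconst

lemma lintegral_weight_mul_graphFt_le_lintegral_sq :
    ∫⁻ ζ : Phase, ENNReal.ofReal ((1 + ‖ζ‖ ^ 2) ^ (-5 : ℝ)) * ‖graphFt v u ζ‖ₑ ^ 2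
      ≤ besselMass * (plancherelConst Plane * ∫⁻ x, ‖u x‖ₑ ^ 2) := by
  simp_rw [graphFt_eq_ft]
  refine lintegral_weight_mul_le
    (F := fun ξ η => ‖ft (fun x => chr (v x) η * u x) ξ‖ₑ ^ 2) fun η => ?_
  have hchr : AEStronglyMeasurable fun x => chr (v x) η :=
    (lipschitzWith_chr_comp hv η).continuous.aestronglyMeasurable
  calc _ ≤ ∫⁻ ξ, ‖ft (fun x => chr (v x) η * u x) ξ‖ₑ ^ 2 :=
        lintegral_mono fun ξ => mul_le_of_le_one_left' (ENNReal.ofReal_le_one.2 (bessel_le_one ξ))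
    _ = plancherelConst Plane * ∫⁻ x, ‖chr (v x) η * u x‖ₑ ^ 2 :=
        lintegral_enorm_ft_sq
          (hu.ofReal.bdd_mul (c := 1) hchr (Eventually.of_forall fun x => by simp))
          (hu2.of_le (hchr.mul hu.ofReal.1) (Eventually.of_forall fun x => by simp))
    _ = 1 * (plancherelConst Plane * ∫⁻ x, ‖u x‖ₑ ^ 2) := by simp [← ofReal_norm]
    _ ≤ _ := by gcongr; exact le_self_add

end GraphFt

lemma enorm_sub_add_sq_le (a b c : ℂ) :
    ‖a - b + c‖ₑ ^ 2 ≤ 3 * (‖a‖ₑ ^ 2 + ‖b‖ₑ ^ 2 + ‖c‖ₑ ^ 2) := by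
  have h : ‖a - b + c‖ ≤ ‖a‖ + ‖b‖ + ‖c‖ :=
    (norm_add_le _ _).trans (by gcongr; exact norm_sub_le _ _)
  have hsq : ‖a - b + c‖₊ ^ 2 ≤ 3 * (‖a‖₊ ^ 2 + ‖b‖₊ ^ 2 + ‖c‖₊ ^ 2) := by
    rw [← NNReal.coe_le_coe]
    push_cast
    refine (pow_le_pow_left₀ (norm_nonneg _) h 2).trans ?_
    nlinarith [sq_nonneg (‖a‖ - ‖b‖), sq_nonneg (‖a‖ - ‖c‖), sq_nonneg (‖b‖ - ‖c‖)]
  simp only [enorm]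
  exact_mod_cast hsq

lemma sobolevNorm_le_of_lintegral_le {E : Type*} [NormedAddCommGroup E] [InnerProductSpace ℝ E]
    [FiniteDimensional ℝ E] [MeasurableSpace E] [BorelSpace E] {s : ℝ} {σ : SignedMeasure E}
    {c : ℝ} (hc : 0 ≤ c) (h : ∫⁻ ζ, ENNReal.ofReal ((1 + ‖ζ‖ ^ 2) ^ s) * ‖fourierMeasure σ ζ‖ₑ ^ 2
      ≤ ENNReal.ofReal (c ^ 2)) : sobolevNorm s σ ≤ ENNReal.ofReal c := by
  refine (ENNReal.rpow_le_rpow h (by norm_num)).trans_eq ?_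
  rw [ENNReal.ofReal_rpow_of_nonneg (sq_nonneg c) (by norm_num), ← Real.sqrt_eq_rpow,
    Real.sqrt_sq hc]

lemma lintegral_enorm_sq_eq_ofReal {u : Plane → ℝ} (hu : MemLp u 2 volume) :
    ∫⁻ x, ‖u x‖ₑ ^ 2 = ENNReal.ofReal ((eLpNorm u 2 volume).toReal ^ 2) := by
  rw [ENNReal.ofReal_pow ENNReal.toReal_nonneg, ENNReal.ofReal_toReal hu.eLpNorm_ne_top,
    eLpNorm_two_sq]

section Defect

variable {G : ℝ≥0} {v : Plane → Plane} (hv : LipschitzWith G v) {N : ℕ} (hN : 1 ≤ N)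
include hv hN

lemma lintegral_weight_mul_fourierMeasure_defect_le {f ρ u : Plane → ℝ} (hρ : Integrable ρ)
    (hf : Integrable f) (hf2 : MemLp f 2 volume) (hu : Integrable u) (hu2 : MemLp u 2 volume)
    (hfu : ∀ y, ρ y = f y - u y) (Q P : Fin N → Plane) :
    ∫⁻ ζ, ENNReal.ofReal ((1 + ‖ζ‖ ^ 2) ^ (-5 : ℝ)) * ‖fourierMeasure
        (empirical (fun i => (WithLp.toLp 2 (Q i, P i) : Phase)) - monokinetic ρ v) ζ‖ₑ ^ 2
      ≤ 3 * (ENNReal.ofReal (2 * (kinetic v Q P + (1 + G ^ 2) * (4 / N))) * besselMass ^ 2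
        + besselMass * (8 * (1 + G ^ 2) * hDotNegOneSq fun y => (smeared f Q y : ℂ))
        + besselMass * (plancherelConst Plane * ∫⁻ x, ‖u x‖ₑ ^ 2)) := by
  set w : Phase → ℝ≥0∞ := fun ζ => ENNReal.ofReal ((1 + ‖ζ‖ ^ 2) ^ (-5 : ℝ))
  set τ := 2 * (kinetic v Q P + (1 + G ^ 2) * (4 / N))
  have hf' := integrable_smeared hN Q hf
  have hsmeared := continuous_graphFt hv.continuous hf'
  have hu' := continuous_graphFt hv.continuous hu
  have hdefect (ζ : Phase) : ‖fourierMeasure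
      (empirical (fun i => (WithLp.toLp 2 (Q i, P i) : Phase)) - monokinetic ρ v) ζ‖ₑ ^ 2
      ≤ 3 * (ENNReal.ofReal τ * ‖ζ‖ₑ ^ 2 + ‖graphFt v (smeared f Q) ζ‖ₑ ^ 2
        + ‖graphFt v u ζ‖ₑ ^ 2) := by
    rw [fourierMeasure_defect_eq hv hN hρ hf hu hfu]
    refine (enorm_sub_add_sq_le _ _ _).trans ?_
    gcongr
    rw [← ofReal_norm, ← ofReal_norm, ← ENNReal.ofReal_pow (norm_nonneg _),
      ← ENNReal.ofReal_pow (norm_nonneg _), mul_comm, ← ENNReal.ofReal_mul (sq_nonneg _)]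
    exact ENNReal.ofReal_le_ofReal (norm_avg_chr_sub_integral_sq_le hv hN Q P ζ)
  calc _ ≤ ∫⁻ ζ, 3 * (ENNReal.ofReal τ * (w ζ * ‖ζ‖ₑ ^ 2)
        + w ζ * ‖graphFt v (smeared f Q) ζ‖ₑ ^ 2 + w ζ * ‖graphFt v u ζ‖ₑ ^ 2) := by
        refine lintegral_mono fun ζ => ?_
        refine (mul_le_mul_right (hdefect ζ) (w ζ)).trans_eq ?_
        ring
    _ = 3 * (ENNReal.ofReal τ * (∫⁻ ζ, w ζ * ‖ζ‖ₑ ^ 2)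
        + (∫⁻ ζ, w ζ * ‖graphFt v (smeared f Q) ζ‖ₑ ^ 2) + ∫⁻ ζ, w ζ * ‖graphFt v u ζ‖ₑ ^ 2) := by
        rw [lintegral_const_mul _ (by fun_prop), lintegral_add_right _ (by fun_prop),
          lintegral_add_right _ (by fun_prop), lintegral_const_mul _ (by fun_prop)]
    _ ≤ _ := by
        gcongr
        · exact lintegral_weight_mul_norm_sq_le
        · exact lintegral_weight_mul_graphFt_le_hDotNegOneSq hv hf' (memLp_two_smeared hN Q hf2)
        · exact lintegral_weight_mul_graphFt_le_lintegral_sq hv hu hu2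

end Defect

/-- The constant in the bound of the squared `H^{-5}` norm of the monokinetic defect by the
modulated energy. -/
def defectConst : ℝ≥0∞ :=
  3 * (besselMass ^ 2 * 8 + besselMass * ENNReal.ofReal (32 * Real.pi ^ 2)
    + besselMass * plancherelConst Plane)

lemma defectConst_ne_top : defectConst ≠ ∞ := by
  have := besselMass_ne_top
  have := plancherelConst_ne_top (E := Plane)
  unfold defectConst
  finiteness

section MonokineticEstimate

variable {G : ℝ≥0} {v : Plane → Plane} {ω ρ ωN : Plane → ℝ} {N : ℕ} {Q : Fin N → Plane}

lemma lintegral_weight_mul_fourierMeasure_defect_le_ofReal (hv : LipschitzWith G v) (hN : 1 ≤ N)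
    (hω : IsDensity ω) (hρ : IsDensity ρ) (hωN : IsDensity ωN)
    (h1 : ∫ x, (ρ x + ω x - ωN x) = 1) (hQ : Function.Injective Q) (P : Fin N → Plane) {S : ℝ}
    (hS : kinetic v Q P + (eLpNorm (fun x => ω x - ωN x) 2 volume).toReal ^ 2
        + renormEnergy (fun x => ρ x + ω x - ωN x) Q + 1 / N ≤ S) :
    ∫⁻ ζ, ENNReal.ofReal ((1 + ‖ζ‖ ^ 2) ^ (-5 : ℝ)) * ‖fourierMeasure
        (empirical (fun i => (WithLp.toLp 2 (Q i, P i) : Phase)) - monokinetic ρ v) ζ‖ₑ ^ 2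
      ≤ defectConst * ENNReal.ofReal ((1 + G ^ 2) * S) := by
  have hf := (hρ.add hω).sub hωN
  have hu := hω.sub hωN
  have henergy := hDotNegOneSq_smeared_le hf h1 hN hQ
  have hE := renormEnergy_nonneg hf h1 hN hQ
  have hκ := kinetic_nonneg v Q P
  have hl := sq_nonneg (eLpNorm (fun x => ω x - ωN x) 2 volume).toReal
  have hn : (0 : ℝ) ≤ 1 / N := by positivity
  have hγ : (1 : ℝ) ≤ 1 + G ^ 2 := by simp
  set E := renormEnergy (fun x => ρ x + ω x - ωN x) Q
  set l := (eLpNorm (fun x => ω x - ωN x) 2 volume).toReal ^ 2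
  set κ := kinetic v Q P
  set γ : ℝ := 1 + G ^ 2
  have hkinetic : 2 * (κ + γ * (4 / N)) ≤ 8 * (γ * S) := by
    have : 4 * (1 / (N : ℝ)) = 4 / N := by ring
    nlinarith
  have hcoulomb : 8 * (1 + G ^ 2 : ℝ≥0∞) * hDotNegOneSq
        (fun y => (smeared (fun x => ρ x + ω x - ωN x) Q y : ℂ))
      ≤ ENNReal.ofReal (32 * Real.pi ^ 2) * ENNReal.ofReal (γ * S) := by
    have hγ' : (8 * (1 + G ^ 2) : ℝ≥0∞) = ENNReal.ofReal (8 * γ) := by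
      rw [show 8 * γ = ((8 * (1 + G ^ 2) : ℝ≥0) : ℝ) by push_cast; rfl, ENNReal.ofReal_coe_nnreal]
      push_cast
      rfl
    refine (mul_le_mul_right henergy _).trans ?_
    rw [hγ', ← ENNReal.ofReal_mul (by positivity), ← ENNReal.ofReal_mul (by positivity)]
    refine ENNReal.ofReal_le_ofReal ?_
    calc 8 * γ * (4 * Real.pi ^ 2 * E) = 32 * Real.pi ^ 2 * (γ * E) := by ring
      _ ≤ _ := by gcongr; linarith
  have hL2 : l ≤ γ * S := by nlinarith
  refine (lintegral_weight_mul_fourierMeasure_defect_le hv hN hρ.integrable hf.integrable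
    hf.memLp_two hu.integrable hu.memLp_two (fun y => by ring) Q P).trans ?_
  rw [lintegral_enorm_sq_eq_ofReal hu.memLp_two]
  calc _ ≤ 3 * (ENNReal.ofReal (8 * (γ * S)) * besselMass ^ 2
        + besselMass * (ENNReal.ofReal (32 * Real.pi ^ 2) * ENNReal.ofReal (γ * S))
        + besselMass * (plancherelConst Plane * ENNReal.ofReal (γ * S))) := by
        gcongr 3 * (ENNReal.ofReal ?_ * _ + _ * ?_ + _ * (_ * ENNReal.ofReal ?_))
    _ = _ := by
        rw [ENNReal.ofReal_mul (by norm_num), ENNReal.ofReal_ofNat, defectConst]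
        ring

lemma exists_sobolevNorm_defect_le (M : ℝ) : ∃ C > 0, ∀ {G : ℝ≥0} {v : Plane → Plane}
    {ω ρ ωN : Plane → ℝ} {N : ℕ} {Q : Fin N → Plane} (P : Fin N → Plane), 1 ≤ N →
    IsDensity ω → IsDensity ρ → IsDensity ωN → ∫ x, (ρ x + ω x - ωN x) = 1 →
    normLinf ω ≤ M → normLinf ωN ≤ M → LipschitzWith G v → Function.Injective Q →
    sobolevNorm (-5) (empirical (fun i => (WithLp.toLp 2 (Q i, P i) : Phase)) - monokinetic ρ v)
      ≤ ENNReal.ofReal (C * (1 + G ^ 2) *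
        Real.sqrt (modulatedEnergy ω ρ v ωN Q P + (1 + normLinf ρ) / N)) := by
  set K := defectConst.toReal
  have hK : 0 ≤ K := ENNReal.toReal_nonneg
  refine ⟨1 + Real.sqrt (K * (2 + 2 * M)), by positivity, ?_⟩
  intro G v ω ρ ωN N Q P hN hω hρ hωN h1 hM hM' hv hQ
  have hM0 : 0 ≤ M := (normLinf_nonneg ω).trans hM
  have hS := kinetic_add_sq_add_renormEnergy_le v Q P hω hρ hωN hM hM'
  have hH := kinetic_add_sq_le_modulatedEnergy v P hω hρ hωN h1 hN hQ
  have hH0 := (add_nonneg (kinetic_nonneg v Q P) (sq_nonneg _)).trans hH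
  have hn : (1 : ℝ) / N ≤ (1 + normLinf ρ) / N := by
    gcongr
    linarith [normLinf_nonneg ρ]
  have hn0 : (0 : ℝ) ≤ 1 / N := by positivity
  set H := modulatedEnergy ω ρ v ωN Q P
  set X := H + (1 + normLinf ρ) / N
  have hX0 : 0 ≤ X := by linarith
  have hweighted := lintegral_weight_mul_fourierMeasure_defect_le_ofReal hv hN hω hρ hωN h1 hQ P
    (S := (2 + 2 * M) * X) (by nlinarith)
  refine sobolevNorm_le_of_lintegral_le (by positivity) (hweighted.trans ?_)
  rw [← ENNReal.ofReal_toReal defectConst_ne_top, ← ENNReal.ofReal_mul hK]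
  refine ENNReal.ofReal_le_ofReal ?_
  have hγ : (1 : ℝ) ≤ 1 + G ^ 2 := by simp
  rw [mul_pow, mul_pow, Real.sq_sqrt hX0]
  calc K * ((1 + G ^ 2) * ((2 + 2 * M) * X))
      = Real.sqrt (K * (2 + 2 * M)) ^ 2 * (1 + G ^ 2) * X := by
        rw [Real.sq_sqrt (by positivity)]
        ring
    _ ≤ _ := by
        gcongr
        · linarith
        · exact le_self_pow₀ hγ two_ne_zero

end MonokineticEstimate

section SpatialDensity

lemma fourierMeasure_empirical_sub_density_eq {N : ℕ} (hN : 1 ≤ N) {f ρ u : Plane → ℝ}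
    (hρ : Integrable ρ) (hf : Integrable f) (hu : Integrable u) (hfu : ∀ y, ρ y = f y - u y)
    (Q : Fin N → Plane) (ζ : Plane) :
    fourierMeasure (empirical Q - density ρ) ζ
      = ((1 - smear N ζ : ℝ) : ℂ) * empFt Q ζ - rft (smeared f Q) ζ + rft u ζ := by
  have hsplit : rft ρ ζ = rft f ζ - rft u ζ := by
    refine Eq.trans ?_ (ft_sub (f := fun y => (f y : ℂ)) (g := fun y => (u y : ℂ))
      hf.ofReal hu.ofReal ζ)
    simp only [rft, hfu, Complex.ofReal_sub]
  rw [fourierMeasure_sub, fourierMeasure_empirical, fourierMeasure_density hρ,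
    rft_smeared hN Q hf, hsplit]
  push_cast
  ring

lemma one_add_sq_rpow_le_one {a : ℝ} (ha : a < -1) (ζ : Plane) :
    ENNReal.ofReal ((1 + ‖ζ‖ ^ 2) ^ a) ≤ 1 :=
  ENNReal.ofReal_le_one.2 (Real.rpow_le_one_of_one_le_of_nonpos
    (le_add_of_nonneg_right (sq_nonneg _)) (by linarith))

lemma one_add_sq_rpow_le_inv_sq {a : ℝ} (ha : a < -1) (ζ : Plane) :
    ENNReal.ofReal ((1 + ‖ζ‖ ^ 2) ^ a) ≤ (‖ζ‖ₑ ^ 2)⁻¹ := by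
  calc _ ≤ ENNReal.ofReal (1 + ‖ζ‖ ^ 2)⁻¹ := by
        rw [← Real.rpow_neg_one]
        exact ENNReal.ofReal_le_ofReal (Real.rpow_le_rpow_of_exponent_le
          (le_add_of_nonneg_right (sq_nonneg _)) ha.le)
    _ ≤ _ := by
        rw [ENNReal.ofReal_inv_of_pos (by positivity), ENNReal.inv_le_inv, ← ofReal_norm,
          ← ENNReal.ofReal_pow (norm_nonneg _)]
        exact ENNReal.ofReal_le_ofReal (by linarith)

lemma lintegral_weight_mul_fourierMeasure_empirical_sub_density_le {a : ℝ} (ha : a < -1) {N : ℕ}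
    (hN : 1 ≤ N) {f ρ u : Plane → ℝ} (hρ : Integrable ρ) (hf : Integrable f) (hu : Integrable u)
    (hu2 : MemLp u 2 volume) (hfu : ∀ y, ρ y = f y - u y) (Q : Fin N → Plane) :
    ∫⁻ ζ, ENNReal.ofReal ((1 + ‖ζ‖ ^ 2) ^ a) * ‖fourierMeasure (empirical Q - density ρ) ζ‖ₑ ^ 2
      ≤ 3 * ((∫⁻ ζ : Plane, ENNReal.ofReal ((1 + ‖ζ‖ ^ 2) ^ a * (1 - smear N ζ) ^ 2))
        + (hDotNegOneSq fun y => (smeared f Q y : ℂ))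
        + plancherelConst Plane * ∫⁻ x, ‖u x‖ₑ ^ 2) := by
  have hcu : Continuous (rft u) := continuous_rft hu
  have hcs : Continuous (rft (smeared f Q)) := continuous_rft (integrable_smeared hN Q hf)
  have hdefect (ζ : Plane) : ‖((1 - smear N ζ : ℝ) : ℂ) * empFt Q ζ‖ₑ ^ 2
      ≤ ENNReal.ofReal ((1 - smear N ζ) ^ 2) := by
    rw [← ofReal_norm, ← ENNReal.ofReal_pow (norm_nonneg _), norm_mul, mul_pow, Complex.norm_real,
      Real.norm_eq_abs, sq_abs]
    exact ENNReal.ofReal_le_ofReal (mul_le_of_le_one_right (sq_nonneg _)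
      (pow_le_one₀ (norm_nonneg _) (norm_empFt_le Q ζ)))
  have hplancherel : ∫⁻ ζ, ‖rft u ζ‖ₑ ^ 2 = plancherelConst Plane * ∫⁻ x, ‖u x‖ₑ ^ 2 := by
    simpa only [rft, enorm_coe_complex] using
      lintegral_enorm_ft_sq (f := fun x => (u x : ℂ)) hu.ofReal hu2.ofReal
  calc _ ≤ ∫⁻ ζ, 3 * (ENNReal.ofReal ((1 + ‖ζ‖ ^ 2) ^ a * (1 - smear N ζ) ^ 2)
        + ‖rft (smeared f Q) ζ‖ₑ ^ 2 / ‖ζ‖ₑ ^ 2 + ‖rft u ζ‖ₑ ^ 2) := by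
        refine lintegral_mono fun ζ => ?_
        rw [fourierMeasure_empirical_sub_density_eq hN hρ hf hu hfu,
          ENNReal.ofReal_mul (by positivity)]
        refine (mul_le_mul_right (enorm_sub_add_sq_le _ _ _) _).trans ?_
        rw [mul_left_comm]
        gcongr 3 * ?_
        rw [mul_add, mul_add, div_eq_mul_inv, mul_comm _ (‖rft (smeared f Q) ζ‖ₑ ^ 2)]
        gcongr
        · exact hdefect ζ
        · exact one_add_sq_rpow_le_inv_sq ha ζ
        · exact mul_le_of_le_one_left' (one_add_sq_rpow_le_one ha ζ)
    _ = 3 * ((∫⁻ ζ : Plane, ENNReal.ofReal ((1 + ‖ζ‖ ^ 2) ^ a * (1 - smear N ζ) ^ 2))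
        + (∫⁻ ζ, ‖rft (smeared f Q) ζ‖ₑ ^ 2 / ‖ζ‖ₑ ^ 2) + ∫⁻ ζ, ‖rft u ζ‖ₑ ^ 2) := by
        rw [lintegral_const_mul' _ _ (by norm_num), lintegral_add_right _ (by fun_prop),
          lintegral_add_right]
        exact (hcs.measurable.enorm.pow_const 2).div (by fun_prop)
    _ = _ := by
        rw [hplancherel]
        rfl

lemma tendsto_smear (ζ : Plane) : Tendsto (fun N : ℕ => smear N ζ) atTop (𝓝 1) := by
  have h : Tendsto (fun N : ℕ => -(‖ζ‖ ^ 2 * (4 * (N : ℝ))⁻¹)) atTop (𝓝 (-(‖ζ‖ ^ 2 * 0))) :=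
    ((tendsto_inv_atTop_zero.comp (tendsto_natCast_atTop_atTop.const_mul_atTop
      four_pos)).const_mul _).neg
  simpa [Function.comp_def, smear, gauss] using (Real.continuous_exp.tendsto _).comp h

lemma integrable_one_add_norm_sq_rpow {a : ℝ} (ha : a < -1) :
    Integrable fun ζ : Plane => (1 + ‖ζ‖ ^ 2) ^ a := by
  have h := integrable_rpow_neg_one_add_norm_sq (E := Plane) (μ := volume) (r := -(2 * a))
    (by rw [finrank_plane]; push_cast; linarith)
  simpa only [neg_neg, mul_div_cancel_left₀ a (two_ne_zero (α := ℝ))] using h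

lemma tendsto_lintegral_smear {a : ℝ} (ha : a < -1) :
    Tendsto (fun N : ℕ => ∫⁻ ζ : Plane, ENNReal.ofReal ((1 + ‖ζ‖ ^ 2) ^ a * (1 - smear N ζ) ^ 2))
      atTop (𝓝 0) := by
  have : Continuous fun ζ : Plane => (1 + ‖ζ‖ ^ 2) ^ a :=
    (by fun_prop : Continuous fun ζ : Plane => 1 + ‖ζ‖ ^ 2).rpow_const
      fun ζ => Or.inl (by positivity)
  have (N : ℕ) := continuous_smear N
  rw [← lintegral_zero (α := Plane) (μ := volume)]
  refine tendsto_lintegral_of_dominated_convergence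
    (fun ζ => ENNReal.ofReal ((1 + ‖ζ‖ ^ 2) ^ a)) (fun N => by fun_prop)
    (fun N => Eventually.of_forall fun ζ => ?_)
    (integrable_one_add_norm_sq_rpow ha).lintegral_lt_top.ne (Eventually.of_forall fun ζ => ?_)
  · refine ENNReal.ofReal_le_ofReal (mul_le_of_le_one_right (by positivity) ?_)
    exact pow_le_one₀ (by linarith [smear_le_one N ζ]) (by linarith [smear_nonneg N ζ])
  · have h := (((tendsto_smear ζ).const_sub 1).pow 2).const_mul ((1 + ‖ζ‖ ^ 2) ^ a)
    simpa using ENNReal.tendsto_ofReal h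

end SpatialDensity

lemma tendsto_sobolevNorm_of_lintegral {E : Type*} [NormedAddCommGroup E] [InnerProductSpace ℝ E]
    [FiniteDimensional ℝ E] [MeasurableSpace E] [BorelSpace E] {s : ℝ} {σ : ℕ → SignedMeasure E}
    (h : Tendsto (fun N => ∫⁻ ζ : E, ENNReal.ofReal ((1 + ‖ζ‖ ^ 2) ^ s) *
      ‖fourierMeasure (σ N) ζ‖ₑ ^ 2) atTop (𝓝 0)) :
    Tendsto (fun N => sobolevNorm s (σ N)) atTop (𝓝 0) := by
  simpa [Function.comp_def, sobolevNorm] using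
    ((ENNReal.continuous_rpow_const (y := 1 / 2)).tendsto 0).comp h

lemma tendsto_add_mul_div_natCast {x : ℕ → ℝ} (hx : Tendsto x atTop (𝓝 0)) (b c : ℝ) :
    Tendsto (fun N : ℕ => x N + b * (c / N)) atTop (𝓝 0) := by
  simpa using hx.add ((tendsto_const_div_atTop_nhds_zero_nat c).const_mul b)

section Convergence

variable {ω ρ : Plane → ℝ} {v : Plane → Plane} {ωN : ℕ → Plane → ℝ}
  {Q P : (N : ℕ) → Fin N → Plane} (hω : IsDensity ω) (hρ : IsDensity ρ)
  (hωN : ∀ N : ℕ, 1 ≤ N → IsDensity (ωN N))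
  (h1 : ∀ N : ℕ, 1 ≤ N → ∫ x, (ρ x + ω x - ωN N x) = 1)
  (hQ : ∀ N : ℕ, 1 ≤ N → Function.Injective (Q N))
  (hH : Tendsto (fun N : ℕ => modulatedEnergy ω ρ v (ωN N) (Q N) (P N)) atTop (𝓝 0))
include hω hρ hωN h1 hQ hH

lemma tendsto_eLpNorm_sub :
    Tendsto (fun N : ℕ => eLpNorm (fun x => ωN N x - ω x) 2 volume) atTop (𝓝 0) := by
  have hlim : Tendsto (fun N : ℕ => ENNReal.ofReal
      (Real.sqrt (modulatedEnergy ω ρ v (ωN N) (Q N) (P N)))) atTop (𝓝 0) := by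
    simpa using ENNReal.tendsto_ofReal hH.sqrt
  refine tendsto_of_tendsto_of_tendsto_of_le_of_le' tendsto_const_nhds hlim
    (Eventually.of_forall fun _ => bot_le) ?_
  filter_upwards [eventually_ge_atTop 1] with N hN
  have henergy :=
    kinetic_add_sq_le_modulatedEnergy v (P N) hω hρ (hωN N hN) (h1 N hN) hN (hQ N hN)
  have hkinetic := kinetic_nonneg v (Q N) (P N)
  have hcomm : eLpNorm (fun x => ωN N x - ω x) 2 volume
      = eLpNorm (fun x => ω x - ωN N x) 2 volume :=
    eLpNorm_sub_comm (ωN N) ω 2 volume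
  rw [hcomm, ← ENNReal.ofReal_toReal (hω.sub (hωN N hN)).memLp_two.eLpNorm_ne_top]
  exact ENNReal.ofReal_le_ofReal (Real.le_sqrt_of_sq_le (by linarith))

variable {M : ℝ} (hM : normLinf ω ≤ M) (hM' : ∀ N : ℕ, 1 ≤ N → normLinf (ωN N) ≤ M)
include hM hM'

lemma tendsto_sobolevNorm_empirical_sub_density {a : ℝ} (ha : a < -1) :
    Tendsto (fun N : ℕ => sobolevNorm a (empirical (Q N) - density ρ)) atTop (𝓝 0) := by
  set Y : ℕ → ℝ := fun N => modulatedEnergy ω ρ v (ωN N) (Q N) (P N)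
    + (1 + 2 * M) * ((1 + normLinf ρ) / N)
  have hY : Tendsto Y atTop (𝓝 0) := tendsto_add_mul_div_natCast hH _ _
  have hbound : Tendsto (fun N : ℕ =>
      3 * ((∫⁻ ζ : Plane, ENNReal.ofReal ((1 + ‖ζ‖ ^ 2) ^ a * (1 - smear N ζ) ^ 2))
      + ENNReal.ofReal (4 * Real.pi ^ 2 * Y N)
      + plancherelConst Plane * ENNReal.ofReal (Y N))) atTop (𝓝 0) := by
    have hcoulomb := ENNReal.tendsto_ofReal (hY.const_mul (4 * Real.pi ^ 2))
    have hL2 := ENNReal.Tendsto.const_mul (a := plancherelConst Plane)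
      (ENNReal.tendsto_ofReal hY) (Or.inr plancherelConst_ne_top)
    simpa using ENNReal.Tendsto.const_mul (a := 3)
      (((tendsto_lintegral_smear ha).add hcoulomb).add hL2) (Or.inr (by norm_num))
  refine tendsto_sobolevNorm_of_lintegral (tendsto_of_tendsto_of_tendsto_of_le_of_le'
    tendsto_const_nhds hbound (Eventually.of_forall fun _ => bot_le) ?_)
  filter_upwards [eventually_ge_atTop 1] with N hN
  have hf := (hρ.add hω).sub (hωN N hN)
  have hu := hω.sub (hωN N hN)
  have henergy := kinetic_add_sq_add_renormEnergy_le v (Q N) (P N) hω hρ (hωN N hN) hM (hM' N hN)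
  have hkinetic := kinetic_nonneg v (Q N) (P N)
  have hsq := sq_nonneg (eLpNorm (fun x => ω x - ωN N x) 2 volume).toReal
  have hrenorm := renormEnergy_nonneg hf (h1 N hN) hN (hQ N hN)
  refine (lintegral_weight_mul_fourierMeasure_empirical_sub_density_le ha hN hρ.integrable
    hf.integrable hu.integrable hu.memLp_two (fun y => by ring) (Q N)).trans ?_
  rw [lintegral_enorm_sq_eq_ofReal hu.memLp_two]
  gcongr
  · refine (hDotNegOneSq_smeared_le hf (h1 N hN) hN (hQ N hN)).trans (ENNReal.ofReal_le_ofReal ?_)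
    gcongr
    linarith
  · linarith

lemma tendsto_sobolevNorm_defect {G : ℝ≥0} (hv : LipschitzWith G v) :
    Tendsto (fun N : ℕ => sobolevNorm (-5)
      (empirical (fun i => (WithLp.toLp 2 (Q N i, P N i) : Phase)) - monokinetic ρ v))
      atTop (𝓝 0) := by
  obtain ⟨C, -, hC⟩ := exists_sobolevNorm_defect_le M
  have hlim : Tendsto (fun N : ℕ => ENNReal.ofReal (C * (1 + G ^ 2) * Real.sqrt
      (modulatedEnergy ω ρ v (ωN N) (Q N) (P N) + (1 + normLinf ρ) / N))) atTop (𝓝 0) := by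
    have h := tendsto_add_mul_div_natCast hH 1 (1 + normLinf ρ)
    simpa using ENNReal.tendsto_ofReal (h.sqrt.const_mul (C * (1 + (G : ℝ) ^ 2)))
  refine tendsto_of_tendsto_of_tendsto_of_le_of_le' tendsto_const_nhds hlim
    (Eventually.of_forall fun _ => bot_le) ?_
  filter_upwards [eventually_ge_atTop 1] with N hN
  exact hC (P N) hN hω hρ (hωN N hN) (h1 N hN) hM (hM' N hN) hv (hQ N hN)

end Convergence

end Spray

end

theorem proposition1p6_general :
    (∀ M : ℝ, ∃ C : ℝ, 0 < C ∧
      ∀ (N : ℕ) (ω ρ ωN : Spray.Plane → ℝ) (v : Spray.Plane → Spray.Plane) (G : ℝ≥0)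
        (Q P : Fin N → Spray.Plane),
        1 ≤ N → Spray.IsDensity ω → Spray.IsDensity ρ → Spray.IsDensity ωN →
        ∫ x, (ρ x + ω x - ωN x) = 1 →
        Spray.normLinf ω ≤ M → Spray.normLinf ωN ≤ M →
        LipschitzWith G v → Function.Injective Q →
        Spray.sobolevNorm (-5)
            (Spray.empirical (fun i => (WithLp.toLp 2 (Q i, P i) : Spray.Phase))
              - Spray.monokinetic ρ v)
          ≤ ENNReal.ofReal (C * (1 + G ^ 2) *
              Real.sqrt (Spray.modulatedEnergy ω ρ v ωN Q P + (1 + Spray.normLinf ρ) / N))) ∧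
    (∀ (ω ρ : Spray.Plane → ℝ) (v : Spray.Plane → Spray.Plane) (G : ℝ≥0)
        (ωN : ℕ → Spray.Plane → ℝ) (Q P : (N : ℕ) → Fin N → Spray.Plane),
        Spray.IsDensity ω → Spray.IsDensity ρ → LipschitzWith G v →
        (∀ N : ℕ, 1 ≤ N → Spray.IsDensity (ωN N) ∧ ∫ x, (ρ x + ω x - ωN N x) = 1 ∧
          Function.Injective (Q N)) →
        (∃ K : ℝ, ∀ N : ℕ, 1 ≤ N → Spray.normLinf (ωN N) ≤ K) →
        Tendsto (fun N : ℕ => Spray.modulatedEnergy ω ρ v (ωN N) (Q N) (P N)) atTop (𝓝 0) →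
        Tendsto (fun N : ℕ => eLpNorm (fun x => ωN N x - ω x) 2 volume) atTop (𝓝 0) ∧
        (∀ a : ℝ, a < -1 →
          Tendsto (fun N : ℕ => Spray.sobolevNorm a (Spray.empirical (Q N) - Spray.density ρ))
            atTop (𝓝 0)) ∧
        Tendsto (fun N : ℕ => Spray.sobolevNorm (-5)
          (Spray.empirical (fun i => (WithLp.toLp 2 (Q N i, P N i) : Spray.Phase))
            - Spray.monokinetic ρ v)) atTop (𝓝 0)) := by
  refine ⟨fun M => ?_, ?_⟩
  · obtain ⟨C, hC, hbound⟩ := Spray.exists_sobolevNorm_defect_le M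
    exact ⟨C, hC, fun N ω ρ ωN v G Q P hN hω hρ hωN h1 hM hM' hv hQ =>
      hbound P hN hω hρ hωN h1 hM hM' hv hQ⟩
  · intro ω ρ v G ωN Q P hω hρ hv hN ⟨K, hK⟩ hH
    have hωN (N : ℕ) (h : 1 ≤ N) : Spray.IsDensity (ωN N) := (hN N h).1
    have h1 (N : ℕ) (h : 1 ≤ N) : ∫ x, (ρ x + ω x - ωN N x) = 1 := (hN N h).2.1
    have hQ (N : ℕ) (h : 1 ≤ N) : Function.Injective (Q N) := (hN N h).2.2
    have hM : Spray.normLinf ω ≤ max (Spray.normLinf ω) K := le_max_left _ _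
    have hM' (N : ℕ) (h : 1 ≤ N) : Spray.normLinf (ωN N) ≤ max (Spray.normLinf ω) K :=
      (hK N h).trans (le_max_right _ _)
    exact ⟨Spray.tendsto_eLpNorm_sub hω hρ hωN h1 hQ hH, fun a ha =>
      Spray.tendsto_sobolevNorm_empirical_sub_density hω hρ hωN h1 hQ hH hM hM' ha,
      Spray.tendsto_sobolevNorm_defect hω hρ hωN h1 hQ hH hM hM' hv⟩

theorem proposition1p6 :
    (∃ β : ℝ, 0 < β ∧ ∀ M : ℝ, ∃ C : ℝ, 0 < C ∧
      ∀ (N : ℕ) (ω ρ ωN : Spray.Plane → ℝ) (v : Spray.Plane → Spray.Plane)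
        (Dv : Spray.Plane → Spray.Plane →L[ℝ] Spray.Plane)
        (D2v : Spray.Plane → Spray.Plane →L[ℝ] Spray.Plane →L[ℝ] Spray.Plane)
        (Q P : Fin N → Spray.Plane),
        1 ≤ N → Spray.IsDensity ω → Spray.IsDensity ρ → Spray.IsDensity ωN →
        ∫ x, (ρ x + ω x - ωN x) = 1 →
        Spray.normLinf ω ≤ M → Spray.normLinf ωN ≤ M →
        Spray.IsW2Inf v Dv D2v → Function.Injective Q →
        Spray.sobolevNorm (-5)
            (Spray.empirical (fun i => (WithLp.toLp 2 (Q i, P i) : Spray.Phase))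
              - Spray.monokinetic ρ v)
          ≤ ENNReal.ofReal (C * (1 + Spray.gradNorm Dv D2v ^ 2) *
              Real.sqrt (Spray.modulatedEnergy ω ρ v ωN Q P
                + (1 + Spray.normLinf ρ) * (N : ℝ) ^ (-β)))) ∧
    (∀ (ω ρ : Spray.Plane → ℝ) (v : Spray.Plane → Spray.Plane)
        (Dv : Spray.Plane → Spray.Plane →L[ℝ] Spray.Plane)
        (D2v : Spray.Plane → Spray.Plane →L[ℝ] Spray.Plane →L[ℝ] Spray.Plane)
        (ωN : ℕ → Spray.Plane → ℝ) (Q P : (N : ℕ) → Fin N → Spray.Plane),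
        Spray.IsDensity ω → Spray.IsDensity ρ → Spray.IsW2Inf v Dv D2v →
        (∀ N : ℕ, 1 ≤ N → Spray.IsDensity (ωN N) ∧ ∫ x, (ρ x + ω x - ωN N x) = 1 ∧
          Function.Injective (Q N)) →
        (∃ K : ℝ, ∀ N : ℕ, 1 ≤ N → Spray.normLinf (ωN N) ≤ K) →
        Tendsto (fun N : ℕ => Spray.modulatedEnergy ω ρ v (ωN N) (Q N) (P N)) atTop (𝓝 0) →
        Tendsto (fun N : ℕ => eLpNorm (fun x => ωN N x - ω x) 2 volume) atTop (𝓝 0) ∧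
        (∀ a : ℝ, a < -1 →
          Tendsto (fun N : ℕ => Spray.sobolevNorm a (Spray.empirical (Q N) - Spray.density ρ))
            atTop (𝓝 0)) ∧
        Tendsto (fun N : ℕ => Spray.sobolevNorm (-5)
          (Spray.empirical (fun i => (WithLp.toLp 2 (Q N i, P N i) : Spray.Phase))
            - Spray.monokinetic ρ v)) atTop (𝓝 0)) := by
  obtain ⟨hbound, hlimit⟩ := proposition1p6_general
  refine ⟨⟨1, one_pos, fun M => ?_⟩, fun ω ρ v Dv D2v ωN Q P hω hρ hv =>
    hlimit ω ρ v _ ωN Q P hω hρ hv.lipschitzWith⟩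
  obtain ⟨C, hC, hdefect⟩ := hbound M
  refine ⟨C, hC, fun N ω ρ ωN v Dv D2v Q P hN hω hρ hωN h1 hM hM' hv hQ => ?_⟩
  rw [Real.rpow_neg_one, ← div_eq_mul_inv,
    ← Real.coe_toNNReal _ (Spray.gradNorm_nonneg Dv D2v)]
  exact hdefect N ω ρ ωN v _ Q P hN hω hρ hωN h1 hM hM' hv.lipschitzWith hQ
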